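/- Let $n\ge 4$ be even, let $\Delta$ be the Laplace--Beltrami operator of the standard metric on $S^n$, let $q'\ge 1$ be a real number, and let $f_1,f_2,f_3:\mathbb R\to\mathbb R$ be functions such that $|f_1|+|f_2|+|f_3|$ is bounded on $(0,1]$. Let $\alpha,\chi\in C^\infty((0,\infty)\times S^n)$ be a solution on $(0,\infty)\times S^n$ of the model system $$\partial_\tau^2\alpha+\frac1\tau\partial_\tau\alpha+4q'\alpha-\frac{4}{(\tau^2+1)^2}\Delta\alpha=f_1(\tau)\,\tau\,\partial_\tau\alpha+f_2(\tau)\,\tau^2\alpha+f_3(\tau)\,\chi,\qquad \partial_\tau\chi=2\tau\alpha ,$$ with initial data $\chi(1),\alpha(1),\partial_\tau\alpha(1)\in C^\infty(S^n)$ at $\tau=1$. Set $$F(\tau)=-4q'\alpha+\frac{4}{(\tau^2+1)^2}\Delta\alpha+f_1(\tau)\,\tau\,\partial_\tau\alpha+f_2(\tau)\,\tau^2\alpha+f_3(\tau)\Big(\chi(1)-\int_\tau^1 2\tau'\alpha(\tau')\,d\tau'\Big).$$ Then there exist $\chi(0),\mathcal O,h\in C^\infty(S^n)$ which determine the asymptotic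 data of $(\alpha,\chi)$ at $\tau=0$, that is: * $\alpha-\mathcal O\log\tau-h$ extends to a $C^1$ curve $[0,\infty)\to C^\infty(S^n)$, and $\chi$ extends to a $C^1$ curve $[0,\infty)\to C^\infty(S^n)$ with value $\chi(0)$ at $\tau=0$ (for the Fréchet topology of $C^\infty(S^n)$); * as $\tau\to0^+$, in every $C^k(S^n)$ norm, $$\alpha(\tau)=\mathcal O\log\tau+h+O\big(\tau^2|\log\tau|^2\big),\qquad \partial_\tau\alpha(\tau)=\frac{\mathcal O}{\tau}+O\big(\tau|\log\tau|^2\big).$$ Moreover, at every point of $S^n$ the functions $\tau\alpha$, $\tau F$ and $\tau\log\tau\,F$ are integrable on $(0,T)$ for all $T>0$, the data are given by $$\chi(0)=\chi(1)-\int_0^1 2\tau'\alpha\,d\tau',\qquad \mathcal O=\partial_\tau\alpha(1)-\int_0^1\tau' F\,d\tau',\qquad h=\alpha(1)+\int_0^1\tau'\log\tau'\,F\,d\tau',$$ and for all $\tau>0$ $$\alpha(\tau)=\alpha(1)+\partial_\tau\alpha(1)\log\tau-\log\tau\int_\tau^1\tau'F\,d\tau'+\int_\tau^1\tau'\log\tau'\,F\,d\tau',$$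 $$\alpha(\tau)=\mathcal O\log\tau+h+\log\tau\int_0^\tau\tau'F\,d\tau'-\int_0^\tau\tau'\log\tau'\,F\,d\tau'.$$ -/

import Mathlib

open Set Filter Topology MeasureTheory
open scoped Manifold ContDiff

namespace ModelSystem

/-- The unit sphere `S^n` in `ℝ^(n+1)`, with Mathlib's smooth structure. -/
abbrev Sph (n : ℕ) : Type :=
  Metric.sphere (0 : EuclideanSpace ℝ (Fin (n + 1))) 1

/-- `f ∈ C^∞(S^n)`. -/
def Smooth {n : ℕ} (f : Sph n → ℝ) : Prop :=
  ContMDiff (𝓡 n) 𝓘(ℝ, ℝ) ∞ f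

/-- `α ∈ C^∞((0,∞) × S^n)`. The values `α τ` with `τ ≤ 0` play no role. -/
def SmoothOnPos {n : ℕ} (α : ℝ → Sph n → ℝ) : Prop :=
  ContMDiffOn (𝓘(ℝ, ℝ).prod (𝓡 n)) 𝓘(ℝ, ℝ) ∞ (Function.uncurry α) (Ioi (0 : ℝ) ×ˢ univ)

open Classical in
/-- The extension of a function on the sphere to `ℝ^(n+1) \ {0}` that is constant along rays,
`y ↦ f (y / |y|)`; the value at the origin is irrelevant. -/
noncomputable def radialExt {n : ℕ} (f : Sph n → ℝ) : EuclideanSpace ℝ (Fin (n + 1)) → ℝ :=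
  fun y => if hy : y ≠ 0 then f ⟨‖y‖⁻¹ • y, by simp [norm_smul, hy]⟩ else 0

/-- The Laplace-Beltrami operator of the standard metric on `S^n` (with its nonpositive sign),
`(Δ f)(x) = Δ_{ℝ^(n+1)} (f (y / |y|)) (x)` for `|x| = 1`. -/
noncomputable def sphLaplacian {n : ℕ} (f : Sph n → ℝ) : Sph n → ℝ :=
  fun x => Laplacian.laplacian (radialExt f) (x : EuclideanSpace ℝ (Fin (n + 1)))

/-- The time derivative `∂_τ α`. -/
noncomputable def dtau {n : ℕ} (α : ℝ → Sph n → ℝ) : ℝ → Sph n → ℝ :=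
  fun τ x => deriv (fun t => α t x) τ

/-- Convergence in the Fréchet space `C^∞(S^n)`: uniform convergence on the sphere of all
derivatives, of every order `k`, of the extensions that are constant along rays. -/
def TendstoCinf {n : ℕ} (F : ℝ → Sph n → ℝ) (l : Filter ℝ) (g : Sph n → ℝ) : Prop :=
  ∀ k : ℕ, TendstoUniformlyOn (fun τ y => iteratedFDeriv ℝ k (radialExt (F τ)) y)
    (fun y => iteratedFDeriv ℝ k (radialExt g) y) l
    (Metric.sphere (0 : EuclideanSpace ℝ (Fin (n + 1))) 1)

/-- `R τ = O(b τ)` in `C^∞(S^n)` as `τ → 0+`, that is, in every `C^k` seminorm. -/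
def BigOCinf {n : ℕ} (R : ℝ → Sph n → ℝ) (b : ℝ → ℝ) : Prop :=
  ∀ k : ℕ, ∃ C : ℝ, ∀ᶠ τ in 𝓝[>] (0 : ℝ), ∀ x : Sph n,
    ‖iteratedFDeriv ℝ k (radialExt (R τ)) (x : EuclideanSpace ℝ (Fin (n + 1)))‖ ≤ C * b τ

/-- `G ∈ C^1_τ([0,∞)) C^∞(S^n)`: `G` is a continuously differentiable curve, defined on
`[0,∞)`, in the Fréchet space `C^∞(S^n)` (`G'` is its derivative, one-sided at `0`). -/
def IsC1Curve {n : ℕ} (G : ℝ → Sph n → ℝ) : Prop :=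
  ∃ G' : ℝ → Sph n → ℝ, ∀ τ₀ ∈ Ici (0 : ℝ),
    Smooth (G τ₀) ∧ Smooth (G' τ₀) ∧
    TendstoCinf G (𝓝[Ici 0] τ₀) (G τ₀) ∧
    TendstoCinf G' (𝓝[Ici 0] τ₀) (G' τ₀) ∧
    TendstoCinf (fun τ => slope G τ₀ τ) (𝓝[Ici 0 \ {τ₀}] τ₀) (G' τ₀)

/-- `(α, χ)` is a smooth solution on `(0,∞) × S^n` of the model system
`∂²α + τ⁻¹ ∂α + 4 q α - 4 (τ² + 1)⁻² Δα = f₁ τ ∂α + f₂ τ² α + f₃ χ`, `∂χ = 2 τ α`. -/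
structure IsSmoothSolution {n : ℕ} (q : ℝ) (f₁ f₂ f₃ : ℝ → ℝ) (α χ : ℝ → Sph n → ℝ) :
    Prop where
  smooth_alpha : SmoothOnPos α
  smooth_chi : SmoothOnPos χ
  main_eq : ∀ τ : ℝ, 0 < τ → ∀ x : Sph n,
    dtau (dtau α) τ x + 1 / τ * dtau α τ x + 4 * q * α τ x
        - 4 / (τ ^ 2 + 1) ^ 2 * sphLaplacian (α τ) x
      = f₁ τ * τ * dtau α τ x + f₂ τ * τ ^ 2 * α τ x + f₃ τ * χ τ x
  chi_eq : ∀ τ : ℝ, 0 < τ → ∀ x : Sph n, dtau χ τ x = 2 * τ * α τ x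

/-- `(χ, α, ∂_τ α)` equals `(χ₁, a₁, b₁)` at `τ = 1`. -/
structure HasInitialData {n : ℕ} (α χ : ℝ → Sph n → ℝ) (χ₁ a₁ b₁ : Sph n → ℝ) : Prop where
  chi_one : χ 1 = χ₁
  alpha_one : α 1 = a₁
  dtau_alpha_one : dtau α 1 = b₁

/-- `(χ₀, 𝒪, h)` determine the asymptotic data at `τ = 0` of `(α, χ)`. The functions
`α - 𝒪 log τ - h` and `χ` are given for `τ > 0`; that they are `C^1` on `[0,∞)` means that they
have an extension to `τ = 0` with this property, where the extension of `χ` has value `χ₀`. -/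
structure HasAsymptoticData {n : ℕ} (α χ : ℝ → Sph n → ℝ) (χ₀ 𝒪 h : Sph n → ℝ) : Prop where
  smooth_chi₀ : Smooth χ₀
  smooth_O : Smooth 𝒪
  smooth_h : Smooth h
  alpha_C1 : ∃ G : ℝ → Sph n → ℝ,
    (∀ τ : ℝ, 0 < τ → ∀ x : Sph n, G τ x = α τ x - 𝒪 x * Real.log τ - h x) ∧ IsC1Curve G
  chi_C1 : ∃ X : ℝ → Sph n → ℝ,
    (∀ τ : ℝ, 0 < τ → X τ = χ τ) ∧ X 0 = χ₀ ∧ IsC1Curve X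
  alpha_expansion :
    BigOCinf (fun τ x => α τ x - 𝒪 x * Real.log τ - h x) (fun τ => τ ^ 2 * |Real.log τ| ^ 2)
  dtau_alpha_expansion :
    BigOCinf (fun τ x => dtau α τ x - 𝒪 x / τ) (fun τ => τ * |Real.log τ| ^ 2)

/-- The right-hand side `F` of `∂²α + τ⁻¹ ∂α = F`, where `χ` is expressed through `α` and
`χ₁ = χ(1)`. -/
noncomputable def source {n : ℕ} (q : ℝ) (f₁ f₂ f₃ : ℝ → ℝ) (α : ℝ → Sph n → ℝ)
    (χ₁ : Sph n → ℝ) : ℝ → Sph n → ℝ :=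
  fun τ x => -(4 * q * α τ x) + 4 / (τ ^ 2 + 1) ^ 2 * sphLaplacian (α τ) x
    + f₁ τ * τ * dtau α τ x + f₂ τ * τ ^ 2 * α τ x
    + f₃ τ * (χ₁ x - ∫ s in τ..1, 2 * s * α s x)

end ModelSystem

/-! Functions on the sphere are extended to `ℝ^(n+1) \ {0}` so as to be constant along rays. On this
class `|y|²Δ` is the Laplace-Beltrami operator and preserves the class. Gradients are orthogonal to
`y`, so a radial cutoff `g(|y|²)` creates no cross terms with them. Analysis on the sphere becomes
analysis in flat space with a radial weight.

The crux is the bound `C/τ` for every spatial derivative of `∂_τ α` on `(0,1]`. The energy `e` of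
`∂_τ α`, `∇α`, `α`, `χ` satisfies `τ e' + (2 + Cτ) e ≥ 0`: the singular term `τ⁻¹ ∂_τ α` accounts
for the 2, all other terms for `Cτ`. Hence `τ² e exp(Cτ)` is nondecreasing and `e` is at most a
constant times `τ⁻²` (`IsHomSolution.exists_energy_le`). The coefficients depend on `τ` only, so
applying the Laplacian to a solution gives another solution. A Sobolev inequality
(`exists_norm_iteratedFDeriv_le_annulusL1`), proved through Fourier decay, then makes the bound
pointwise for all derivatives. Integrating back from `τ = 1` shows that `α`, `χ` and `F` are `O(1 -
log τ)` with all spatial derivatives (`LogBounded`).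

What remains is an ordinary differential equation with parameter: `(τ ∂_τ α)' = τ F` and `(log τ · τ
∂_τ α - α)' = τ log τ F`. The integrals converge at 0, the formulas for `𝒪` and `h` follow, and `α -
𝒪 log τ - h = ∫₀^τ (log τ - log t) t F dt`, `∂_τ α - 𝒪/τ = ∫₀^τ (t/τ) F dt`. The weights are bounded
by `τ` and by 1, and `∫₀^τ (1 - log t) dt = τ (2 - log τ)`; this gives the rates, and
differentiation under the integral gives them in every `C^k`. The same bounds show that the
remainder and `χ` have derivative 0 at `τ = 0`, hence are `C¹` up to 0. -/

namespace ModelSystem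

/-! ### Derivative bounds from decay of the Fourier transform. -/

section Fourier

open scoped FourierTransform SchwartzMap
open Laplacian

variable {E : Type*} [NormedAddCommGroup E] [InnerProductSpace ℝ E] [FiniteDimensional ℝ E]
  [MeasurableSpace E] [BorelSpace E]

lemma norm_sq_mul_norm_fourier (f : 𝓢(E, ℂ)) (ξ : E) :
    ‖ξ‖ ^ 2 * ‖𝓕 f ξ‖ = ((2 * Real.pi) ^ 2)⁻¹ * ‖𝓕 (Δ f) ξ‖ := by
  have h : 𝓕 (Δ f) ξ = -(((2 * Real.pi) ^ 2 * ‖ξ‖ ^ 2 : ℝ) : ℂ) * 𝓕 f ξ := by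
    rw [SchwartzMap.laplacian_eq_fourierMultiplierCLM, SchwartzMap.fourierMultiplierCLM_apply]
    rw [FourierTransform.fourier_smul, FourierTransform.fourier_fourierInv_eq]
    have : (fun x : E => ‖x‖ ^ 2).HasTemperateGrowth := by fun_prop
    rw [_root_.smul_apply, SchwartzMap.smulLeftCLM_apply_apply this]
    simp only [Complex.real_smul, neg_smul]
    push_cast
    ring
  rw [h, norm_mul, norm_neg, Complex.norm_real, Real.norm_of_nonneg (by positivity)]
  field_simp

/-- Fourier inversion: `k` derivatives cost a factor `‖ξ‖ ^ k`, and decay of high even order makes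
the result integrable. Even powers suffice because decay will come from iterated Laplacians. -/
lemma exists_norm_iteratedFDeriv_le_fourier (k : ℕ) :
    ∃ C : ℝ, 0 ≤ C ∧ ∃ N : ℕ, ∀ f : 𝓢(E, ℂ), ∀ M : ℝ, (∀ ξ, ‖𝓕 f ξ‖ ≤ M) →
      (∀ ξ, ‖ξ‖ ^ (2 * N) * ‖𝓕 f ξ‖ ≤ M) → ∀ y, ‖iteratedFDeriv ℝ k f y‖ ≤ C * M := by
  -- This `l` exceeds the dimension, for integrability, and makes `k + l = 2 * N` with `N = k +
  -- finrank + 1`.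
  set l := k + 2 * (Module.finrank ℝ E + 1) with hl
  have hint : Integrable (fun ξ : E => (1 + ‖ξ‖) ^ (-(l : ℝ))) :=
    integrable_one_add_norm (by rw [hl]; push_cast; linarith [(Nat.cast_nonneg k : (0:ℝ) ≤ k),
      (Nat.cast_nonneg (Module.finrank ℝ E) : (0:ℝ) ≤ Module.finrank ℝ E)])
  set J := ∫ ξ : E, (1 + ‖ξ‖) ^ (-(l : ℝ))
  have hJ : 0 ≤ J := integral_nonneg fun ξ => by positivity
  set c := (2 * Real.pi * ‖innerSL ℝ (E := E)‖) ^ k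
  refine ⟨c * (2 ^ l * 2 * J), by positivity, k + Module.finrank ℝ E + 1, fun f M h0 h1 y => ?_⟩
  set g : 𝓢(E, ℂ) := 𝓕 f with hg
  have hM : 0 ≤ M := (norm_nonneg _).trans (h0 0)
  have hfg : (f : E → ℂ) = 𝓕 (fun ξ => g (-ξ)) := by
    rw [← Real.fourierInv_eq_fourier_comp_neg, ← SchwartzMap.fourierInv_coe, hg,
      FourierPair.fourierInv_fourier_eq]
  have hbound : ∀ ξ, ‖ξ‖ ^ k * ‖g (-ξ)‖ ≤ 2 ^ l * (M + M) * (1 + ‖ξ‖) ^ (-(l : ℝ)) := by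
    intro ξ
    refine pow_mul_le_of_le_of_pow_mul_le (norm_nonneg _) (norm_nonneg _) (h0 _) ?_
    have := h1 (-ξ)
    rw [norm_neg] at this
    convert this using 3
    omega
  have hgi : ∀ m : ℕ, Integrable (fun ξ : E => ‖ξ‖ ^ m * ‖g (-ξ)‖) := by
    intro m
    have := (g.integrable_pow_mul volume m).comp_neg
    simpa using this
  have hcont : Continuous (fun ξ : E => g (-ξ)) := g.continuous.comp continuous_neg
  have hle : ∀ ξ, ‖VectorFourier.fourierPowSMulRight (innerSL ℝ) (fun ξ => g (-ξ)) ξ k‖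
      ≤ c * (2 ^ l * (M + M)) * (1 + ‖ξ‖) ^ (-(l : ℝ)) := by
    intro ξ
    refine (VectorFourier.norm_fourierPowSMulRight_le _ _ _ _).trans ?_
    calc _ = c * (‖ξ‖ ^ k * ‖g (-ξ)‖) := by ring
      _ ≤ c * (2 ^ l * (M + M) * (1 + ‖ξ‖) ^ (-(l : ℝ))) := by
        exact mul_le_mul_of_nonneg_left (hbound ξ) (by positivity)
      _ = _ := by ring
  rw [hfg, Real.iteratedFDeriv_fourier (N := ⊤) (fun m _ => hgi m)
    hcont.aestronglyMeasurable (by simp)]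
  calc _ ≤ ∫ ξ, ‖VectorFourier.fourierPowSMulRight (innerSL ℝ) (fun ξ => g (-ξ)) ξ k‖ :=
        VectorFourier.norm_fourierIntegral_le_integral_norm _ _ _ _ _
    _ ≤ ∫ ξ, c * (2 ^ l * (M + M)) * (1 + ‖ξ‖) ^ (-(l : ℝ)) := by
        refine integral_mono_of_nonneg (ae_of_all _ fun _ => norm_nonneg _)
          (hint.const_mul _) (ae_of_all _ hle)
    _ = _ := by rw [integral_const_mul]; ring

end Fourier

/-! ### Functions constant along rays, and the operator `|y|²Δ`. -/

section Radial

variable {E : Type*} [NormedAddCommGroup E] [InnerProductSpace ℝ E]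

/-- Functions that are smooth away from the origin and constant along rays. -/
structure HomSmooth (u : E → ℝ) : Prop where
  smooth : ContDiffOn ℝ ∞ u {0}ᶜ
  hom : ∀ c : ℝ, 0 < c → ∀ y, u (c • y) = u y

namespace HomSmooth

variable {u : E → ℝ}

lemma contDiffAt (hu : HomSmooth u) {y : E} (hy : y ≠ 0) : ContDiffAt ℝ ∞ u y :=
  hu.smooth.contDiffAt (isOpen_compl_singleton.mem_nhds hy)

lemma fderiv_smul (hu : HomSmooth u) {c : ℝ} (hc : 0 < c) :
    fderiv ℝ u = fun y => c • fderiv ℝ u (c • y) := by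
  ext1 y
  rw [← fderiv_comp_smul]
  simp_rw [hu.hom c hc]

/-- Euler's identity in degree 0. It removes every cross term between a radial factor and `u` below.
-/
lemma fderiv_self (hu : HomSmooth u) {y : E} (hy : y ≠ 0) : fderiv ℝ u y y = 0 := by
  have h1 : HasDerivAt (fun c : ℝ => u (c • y)) (fderiv ℝ u ((1 : ℝ) • y) ((1 : ℝ) • y)) 1 := by
    refine HasFDerivAt.comp_hasDerivAt (1 : ℝ) (DifferentiableAt.hasFDerivAt ?_)
      ((hasDerivAt_id (1 : ℝ)).smul_const y)
    rw [one_smul]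
    exact (hu.contDiffAt hy).differentiableAt (by simp)
  have h2 : (fun c : ℝ => u (c • y)) =ᶠ[𝓝 1] fun _ => u y := by
    filter_upwards [lt_mem_nhds (zero_lt_one (α := ℝ))] with c hc using hu.hom c hc y
  have := h1.unique ((hasDerivAt_const (1 : ℝ) (u y)).congr_of_eventuallyEq h2)
  simpa using this

end HomSmooth

lemma hasFDerivAt_comp_norm_sq {g : ℝ → ℝ} (hg : Differentiable ℝ g) (y : E) :
    HasFDerivAt (fun z : E => g (‖z‖ ^ 2)) ((2 * deriv g (‖y‖ ^ 2)) • innerSL ℝ y) y := by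
  have := (hg (‖y‖ ^ 2)).hasDerivAt.comp_hasFDerivAt y (hasStrictFDerivAt_norm_sq y).hasFDerivAt
  refine HasFDerivAt.congr_fderiv this ?_
  ext v
  simp
  ring

variable [FiniteDimensional ℝ E]

/-- The operator `|y|² Δ` on functions on a Euclidean space. On functions that are constant along
rays it is the Laplace-Beltrami operator of the unit sphere. -/
noncomputable def scaledLaplacian (u : E → ℝ) : E → ℝ :=
  fun y => ‖y‖ ^ 2 * Laplacian.laplacian u y

lemma laplacian_eq_sum_fderiv_fderiv (f : E → ℝ) (y : E) :
    Laplacian.laplacian f y = ∑ i, fderiv ℝ (fderiv ℝ f) y (stdOrthonormalBasis ℝ E i)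
      (stdOrthonormalBasis ℝ E i) := by
  rw [InnerProductSpace.laplacian_eq_iteratedFDeriv_stdOrthonormalBasis]
  simp [iteratedFDeriv_two_apply]

lemma laplacian_eq_sum_fderiv {f : E → ℝ} {y : E} (hf : ContDiffAt ℝ 2 f y) :
    Laplacian.laplacian f y = ∑ i, fderiv ℝ (fun z => fderiv ℝ f z (stdOrthonormalBasis ℝ E i)) y
      (stdOrthonormalBasis ℝ E i) := by
  rw [laplacian_eq_sum_fderiv_fderiv]
  refine Finset.sum_congr rfl fun i _ => ?_
  have hd : DifferentiableAt ℝ (fderiv ℝ f) y :=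
    (hf.fderiv_right (m := 1) (by norm_num)).differentiableAt (by norm_num)
  rw [fderiv_clm_apply hd (differentiableAt_const _)]
  simp

lemma contDiffAt_laplacian {f : E → ℝ} {y : E} (hf : ContDiffAt ℝ ∞ f y) :
    ContDiffAt ℝ ∞ (Laplacian.laplacian f) y := by
  have : (Laplacian.laplacian f) = fun y => ∑ i, fderiv ℝ (fderiv ℝ f) y
      (stdOrthonormalBasis ℝ E i) (stdOrthonormalBasis ℝ E i) := by
    ext y; exact laplacian_eq_sum_fderiv_fderiv f y
  rw [this]
  have h2 : ContDiffAt ℝ ∞ (fderiv ℝ (fderiv ℝ f)) y :=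
    (hf.fderiv_right (m := ∞) (by simp)).fderiv_right (m := ∞) (by simp)
  exact ContDiffAt.sum fun i _ => (h2.clm_apply contDiffAt_const).clm_apply contDiffAt_const

namespace HomSmooth

variable {u : E → ℝ}

/-- Second derivatives are homogeneous of degree -2, which the factor `‖y‖ ^ 2` compensates. -/
lemma scaledLaplacian (hu : HomSmooth u) : HomSmooth (scaledLaplacian u) where
  smooth y hy := ((contDiff_norm_sq ℝ).contDiffAt.mul
    (contDiffAt_laplacian (hu.contDiffAt hy))).contDiffWithinAt
  hom c hc y := by
    rcases eq_or_ne y 0 with rfl | hy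
    · simp
    have hcy : c • y ≠ 0 := smul_ne_zero hc.ne' hy
    have hd : DifferentiableAt ℝ (fderiv ℝ u) (c • y) :=
      ((hu.contDiffAt hcy).fderiv_right (m := 1) (by norm_cast)).differentiableAt (by norm_num)
    have hd' : DifferentiableAt ℝ (fun z => fderiv ℝ u (c • z)) y :=
      DifferentiableAt.comp y hd (differentiableAt_id.const_smul c)
    have h : fderiv ℝ (fderiv ℝ u) y = c • (c • fderiv ℝ (fderiv ℝ u) (c • y)) := by
      have h := congrArg (fun F => fderiv ℝ F y) (hu.fderiv_smul hc)
      rw [h, ← fderiv_comp_smul]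
      exact fderiv_fun_const_smul hd' c
    simp only [ModelSystem.scaledLaplacian, laplacian_eq_sum_fderiv_fderiv, h]
    rw [norm_smul, Real.norm_of_nonneg hc.le, mul_pow, Finset.mul_sum, Finset.mul_sum]
    refine Finset.sum_congr rfl fun i _ => ?_
    simp
    ring

end HomSmooth

/-- The product rule for the Laplacian; its mixed term is absent because the gradient of `g(‖z‖²)`
is radial and that of `u` is orthogonal to `z`. -/
lemma laplacian_comp_norm_sq_mul {g : ℝ → ℝ} (hg : ContDiff ℝ ∞ g) {u : E → ℝ}
    (hu : HomSmooth u) {y : E} (hy : y ≠ 0) :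
    Laplacian.laplacian (fun z : E => g (‖z‖ ^ 2) * u z) y
      = (4 * ‖y‖ ^ 2 * deriv (deriv g) (‖y‖ ^ 2)
          + 2 * Module.finrank ℝ E * deriv g (‖y‖ ^ 2)) * u y
        + g (‖y‖ ^ 2) * Laplacian.laplacian u y := by
  have hg1 : Differentiable ℝ g := hg.differentiable (by simp)
  have hg' : ContDiff ℝ ∞ (deriv g) := (contDiff_infty_iff_deriv.1 hg).2
  have hg2 : Differentiable ℝ (deriv g) := hg'.differentiable (by simp)
  have hdu : ∀ z : E, z ≠ 0 → HasFDerivAt u (fderiv ℝ u z) z := fun z hz =>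
    ((hu.contDiffAt hz).differentiableAt (by simp)).hasFDerivAt
  have hcd : ContDiffAt ℝ 2 (fun z : E => g (‖z‖ ^ 2) * u z) y :=
    (((hg.comp (contDiff_norm_sq ℝ)).contDiffAt.mul (hu.contDiffAt hy)).of_le (by norm_cast))
  have hddu : DifferentiableAt ℝ (fderiv ℝ u) y :=
    ((hu.contDiffAt hy).fderiv_right (m := 1) (by norm_cast)).differentiableAt (by norm_num)
  have key : ∀ v : E, fderiv ℝ (fun z => fderiv ℝ (fun z : E => g (‖z‖ ^ 2) * u z) z v) y v
      = 4 * deriv (deriv g) (‖y‖ ^ 2) * u y * (inner ℝ y v) ^ 2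
        + 2 * deriv g (‖y‖ ^ 2) * u y * ‖v‖ ^ 2
        + 4 * deriv g (‖y‖ ^ 2) * (inner ℝ y v * fderiv ℝ u y v)
        + g (‖y‖ ^ 2) * fderiv ℝ (fun z => fderiv ℝ u z v) y v := by
    intro v
    have h1 : (fun z => fderiv ℝ (fun z : E => g (‖z‖ ^ 2) * u z) z v) =ᶠ[𝓝 y]
        fun z => g (‖z‖ ^ 2) * fderiv ℝ u z v + u z * (2 * deriv g (‖z‖ ^ 2) * inner ℝ v z) := by
      filter_upwards [isOpen_compl_singleton.mem_nhds hy] with z hz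
      rw [((hasFDerivAt_comp_norm_sq hg1 z).fun_mul (hdu z hz)).fderiv]
      simp [real_inner_comm]
    have h3 : HasFDerivAt (fun z => fderiv ℝ u z v) (fderiv ℝ (fun z => fderiv ℝ u z v) y) y :=
      (hddu.clm_apply (differentiableAt_const v)).hasFDerivAt
    have h4 : HasFDerivAt (fun z : E => inner ℝ v z) (innerSL ℝ v) y :=
      (innerSL ℝ v).hasFDerivAt
    have h5 := ((hasFDerivAt_comp_norm_sq hg1 y).fun_mul h3).fun_add
      ((hdu y hy).fun_mul (((hasFDerivAt_comp_norm_sq hg2 y).const_mul 2).fun_mul h4))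
    rw [h1.fderiv_eq, h5.fderiv]
    simp [real_inner_comm]
    ring
  rw [laplacian_eq_sum_fderiv hcd, laplacian_eq_sum_fderiv
    ((hu.contDiffAt hy).of_le (by norm_cast))]
  simp_rw [key, Finset.sum_add_distrib, ← Finset.mul_sum]
  have hs : ∑ i, inner ℝ y (stdOrthonormalBasis ℝ E i) * fderiv ℝ u y (stdOrthonormalBasis ℝ E i)
      = 0 := by
    rw [← hu.fderiv_self hy]
    conv_rhs => enter [2]; rw [← (stdOrthonormalBasis ℝ E).sum_repr' y]
    rw [map_sum]
    simp [real_inner_comm]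
  rw [hs, (stdOrthonormalBasis ℝ E).sum_sq_inner_left]
  simp
  ring

end Radial

/-! ### A Sobolev inequality on annuli with the Laplacian as only derivative. -/

section Sobolev

open scoped FourierTransform SchwartzMap

/-- The annulus of points `y` with `a ≤ |y|² ≤ b`. -/
def annulus (E : Type*) [NormedAddCommGroup E] (a b : ℝ) : Set E := {y | ‖y‖ ^ 2 ∈ Icc a b}

lemma ne_zero_of_mem_annulus {E : Type*} [NormedAddCommGroup E] {a b : ℝ} (ha : 0 < a) {y : E} (hy : y ∈ annulus E a b) : y ≠ 0 := by
  rintro rfl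
  have := hy.1
  simp at this
  linarith

variable {E : Type*} [NormedAddCommGroup E] [InnerProductSpace ℝ E]

lemma HomSmooth.continuousOn_annulus {u : E → ℝ} (hu : HomSmooth u) {a b : ℝ} (ha : 0 < a) :
    ContinuousOn u (annulus E a b) :=
  hu.smooth.continuousOn.mono fun _ hy => ne_zero_of_mem_annulus ha hy

lemma isCompact_annulus [FiniteDimensional ℝ E] (a b : ℝ) : IsCompact (annulus E a b) := by
  have : ProperSpace E := FiniteDimensional.proper_real E
  refine Metric.isCompact_of_isClosed_isBounded
    (isClosed_Icc.preimage (by fun_prop)) ((Metric.isBounded_closedBall (x := (0 : E)) (r := 1 + |b|)).subset ?_)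
  intro y hy
  have h := hy.2
  rw [mem_closedBall_zero_iff]
  have : |b| ≥ 0 := abs_nonneg b
  nlinarith [norm_nonneg y, le_abs_self b]

/-- Smooth functions on `ℝ` supported in the interval `[a, b]`. -/
structure IsCutoff (a b : ℝ) (g : ℝ → ℝ) : Prop where
  smooth : ContDiff ℝ ∞ g
  eq_zero : ∀ s, s ∉ Icc a b → g s = 0

namespace IsCutoff

variable {a b : ℝ} {g : ℝ → ℝ} {u : E → ℝ}

lemma eventually_eq_zero (hg : IsCutoff a b g) {s : ℝ} (hs : s ∉ Icc a b) : ∀ᶠ t in 𝓝 s, g t = 0 := by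
  filter_upwards [isClosed_Icc.isOpen_compl.mem_nhds hs] with t ht using hg.eq_zero t ht

lemma deriv (hg : IsCutoff a b g) : IsCutoff a b (deriv g) where
  smooth := (contDiff_infty_iff_deriv.1 hg.smooth).2
  eq_zero s hs := by
    have : g =ᶠ[𝓝 s] fun _ => (0 : ℝ) := hg.eventually_eq_zero hs
    rw [this.deriv_eq, deriv_const]

lemma mul_left (hg : IsCutoff a b g) {f : ℝ → ℝ} (hf : ContDiff ℝ ∞ f) :
    IsCutoff a b (fun s => f s * g s) where
  smooth := hf.mul hg.smooth
  eq_zero s hs := by simp [hg.eq_zero s hs]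

lemma add (hg : IsCutoff a b g) {f : ℝ → ℝ} (hf : IsCutoff a b f) :
    IsCutoff a b (fun s => f s + g s) where
  smooth := hf.smooth.add hg.smooth
  eq_zero s hs := by simp [hg.eq_zero s hs, hf.eq_zero s hs]

/-- Needed because replacing `Δ` by `‖y‖² Δ` divides the cutoff by `‖y‖²`. -/
lemma div (hg : IsCutoff a b g) (ha : 0 < a) : IsCutoff a b (fun s => g s / s) where
  smooth := by
    rw [contDiff_iff_contDiffAt]
    intro s
    by_cases hs : s ∈ Icc a b
    · exact hg.smooth.contDiffAt.div contDiffAt_id (ha.trans_le hs.1).ne'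
    · refine (contDiffAt_const (c := (0 : ℝ))).congr_of_eventuallyEq ?_
      filter_upwards [hg.eventually_eq_zero hs] with t ht
      simp [ht]
  eq_zero s hs := by simp [hg.eq_zero s hs]

lemma exists_bound (hg : IsCutoff a b g) : ∃ C, 0 ≤ C ∧ ∀ s, |g s| ≤ C := by
  obtain ⟨C, hC⟩ := isCompact_Icc.exists_bound_of_continuousOn
    (s := Icc a b) hg.smooth.continuous.continuousOn
  refine ⟨max C 0, le_max_right _ _, fun s => ?_⟩
  by_cases hs : s ∈ Icc a b
  · exact (hC s hs).trans (le_max_left _ _)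
  · simp [hg.eq_zero s hs]

lemma hasCompactSupport [FiniteDimensional ℝ E] (hg : IsCutoff a b g) (u : E → ℝ) :
    HasCompactSupport (fun y : E => g (‖y‖ ^ 2) * u y) :=
  HasCompactSupport.intro (isCompact_annulus a b) fun y hy => by
    rw [hg.eq_zero _ hy, zero_mul]

lemma contDiff_mul (hg : IsCutoff a b g) (ha : 0 < a) {n : ℕ∞ω} (hn : n ≤ ∞)
    (hu : ContDiffOn ℝ n u {0}ᶜ) : ContDiff ℝ n (fun y : E => g (‖y‖ ^ 2) * u y) := by
  rw [contDiff_iff_contDiffAt]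
  intro y
  by_cases hy : y ∈ annulus E a b
  · exact ((hg.smooth.comp (contDiff_norm_sq ℝ)).contDiffAt.of_le hn).mul
      (hu.contDiffAt (isOpen_compl_singleton.mem_nhds (ne_zero_of_mem_annulus ha hy)))
  · refine (contDiffAt_const (c := (0 : ℝ))).congr_of_eventuallyEq ?_
    have : Tendsto (fun y : E => ‖y‖ ^ 2) (𝓝 y) (𝓝 (‖y‖ ^ 2)) :=
      (continuous_norm.pow 2).continuousAt
    filter_upwards [this.eventually (hg.eventually_eq_zero hy)] with t ht
    simp [ht]

end IsCutoff

variable [FiniteDimensional ℝ E]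

lemma exists_schwartz_cutoff {a b : ℝ} {g : ℝ → ℝ} (hg : IsCutoff a b g) (ha : 0 < a) {u : E → ℝ}
    (hu : HomSmooth u) : ∃ f : 𝓢(E, ℂ), ∀ y, f y = ((g (‖y‖ ^ 2) * u y : ℝ) : ℂ) := by
  have h1 : HasCompactSupport (fun y : E => ((g (‖y‖ ^ 2) * u y : ℝ) : ℂ)) :=
    (hg.hasCompactSupport u).comp_left (g := fun x : ℝ => (x : ℂ)) (by simp)
  have h2 : ContDiff ℝ ∞ (fun y : E => ((g (‖y‖ ^ 2) * u y : ℝ) : ℂ)) :=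
    Complex.ofRealCLM.contDiff.comp (hg.contDiff_mul ha le_rfl hu.smooth)
  exact ⟨h1.toSchwartzMap h2, fun y => rfl⟩

/-- Both coefficients on the right are again cutoffs in `‖y‖²`, with the same interval, and no first
derivative of `u` occurs. This closes the induction on the order of Fourier decay. -/
lemma laplacian_cutoff_mul {a b : ℝ} {g : ℝ → ℝ} (hg : IsCutoff a b g) (ha : 0 < a) {u : E → ℝ}
    (hu : HomSmooth u) (y : E) :
    Laplacian.laplacian (fun z : E => g (‖z‖ ^ 2) * u z) y
      = (4 * ‖y‖ ^ 2 * deriv (deriv g) (‖y‖ ^ 2)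
          + 2 * Module.finrank ℝ E * deriv g (‖y‖ ^ 2)) * u y
        + g (‖y‖ ^ 2) / ‖y‖ ^ 2 * scaledLaplacian u y := by
  rcases eq_or_ne y 0 with rfl | hy
  · have h0 : ‖(0 : E)‖ ^ 2 ∉ Icc a b := by simp [ha]
    have h1 : (fun z : E => g (‖z‖ ^ 2) * u z) =ᶠ[𝓝 0] fun _ => (0 : ℝ) := by
      have : Tendsto (fun y : E => ‖y‖ ^ 2) (𝓝 0) (𝓝 (‖(0 : E)‖ ^ 2)) :=
        (continuous_norm.pow 2).continuousAt
      filter_upwards [this.eventually (hg.eventually_eq_zero h0)] with t ht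
      simp [ht]
    rw [(InnerProductSpace.laplacian_congr_nhds h1).eq_of_nhds, hg.eq_zero _ h0,
      hg.deriv.eq_zero _ h0, hg.deriv.deriv.eq_zero _ h0]
    simp [InnerProductSpace.laplacian_const]
  · rw [laplacian_comp_norm_sq_mul hg.smooth hu hy]
    have : ‖y‖ ≠ 0 := norm_ne_zero_iff.2 hy
    unfold scaledLaplacian
    field_simp

variable [MeasurableSpace E] [BorelSpace E]

/-- The `L¹` norm of `u` on an annulus. -/
noncomputable def annulusL1 (a b : ℝ) (u : E → ℝ) : ℝ := ∫ y in annulus E a b, |u y|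

lemma annulusL1_nonneg (a b : ℝ) (u : E → ℝ) : 0 ≤ annulusL1 a b u :=
  integral_nonneg fun _ => abs_nonneg _

/-- Each factor `‖ξ‖ ^ 2` is traded for one Laplacian of the cut-off function, which splits into
cut-off versions of `u` and of `scaledLaplacian u`. The cutoff changes at each stage, so the
induction quantifies over all `g`. -/
lemma norm_pow_mul_fourier_cutoff_le {a b : ℝ} (ha : 0 < a) (N : ℕ) :
    ∀ g : ℝ → ℝ, IsCutoff a b g → ∃ C : ℝ, 0 ≤ C ∧ ∀ u : E → ℝ, HomSmooth u →
      ∀ f : 𝓢(E, ℂ), (∀ y, f y = ((g (‖y‖ ^ 2) * u y : ℝ) : ℂ)) →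
      ∀ ξ, ‖ξ‖ ^ (2 * N) * ‖𝓕 f ξ‖
        ≤ C * ∑ j ∈ Finset.range (N + 1), annulusL1 a b (scaledLaplacian^[j] u) := by
  induction N with
  | zero =>
    intro g hg
    obtain ⟨C, hC0, hC⟩ := hg.exists_bound
    refine ⟨C, hC0, fun u hu f hf ξ => ?_⟩
    simp only [mul_zero, pow_zero, one_mul, zero_add, Finset.range_one, Finset.sum_singleton,
      Function.iterate_zero, id_eq]
    have hint : IntegrableOn (fun y => |u y|) (annulus E a b) :=
      (hu.continuousOn_annulus ha).abs.integrableOn_compact (isCompact_annulus a b)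
    calc ‖𝓕 f ξ‖ ≤ ∫ y, ‖f y‖ := VectorFourier.norm_fourierIntegral_le_integral_norm _ _ _ _ _
      _ = ∫ y in annulus E a b, ‖f y‖ := by
        refine (setIntegral_eq_integral_of_forall_compl_eq_zero fun y hy => ?_).symm
        rw [hf, hg.eq_zero _ hy]
        simp
      _ ≤ ∫ y in annulus E a b, C * |u y| := by
        refine integral_mono_of_nonneg (ae_of_all _ fun _ => norm_nonneg _)
          (hint.const_mul C) (ae_of_all _ fun y => ?_)
        simp only [hf, Complex.norm_real, Real.norm_eq_abs, abs_mul]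
        exact mul_le_mul_of_nonneg_right (hC _) (abs_nonneg _)
      _ = _ := by rw [integral_const_mul]; rfl
  | succ N ih =>
    intro g hg
    have hg1 : IsCutoff a b (fun s => 4 * s * deriv (deriv g) s
        + 2 * Module.finrank ℝ E * deriv g s) :=
      (hg.deriv.mul_left contDiff_const).add (hg.deriv.deriv.mul_left (by fun_prop))
    have hg2 := hg.div ha
    obtain ⟨C1, hC1, h1⟩ := ih _ hg1
    obtain ⟨C2, hC2, h2⟩ := ih _ hg2
    refine ⟨((2 * Real.pi) ^ 2)⁻¹ * (C1 + C2), by positivity, fun u hu f hf ξ => ?_⟩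
    obtain ⟨f1, hf1⟩ := exists_schwartz_cutoff hg1 ha hu
    obtain ⟨f2, hf2⟩ := exists_schwartz_cutoff hg2 ha hu.scaledLaplacian
    have hΔ : Laplacian.laplacian f = f1 + f2 := by
      ext y
      rw [SchwartzMap.laplacian_apply, _root_.add_apply, hf1, hf2]
      have hfeq : (f : E → ℂ) = Complex.ofRealCLM ∘ fun z : E => g (‖z‖ ^ 2) * u z := by
        ext z; simp [hf]
      rw [hfeq, ContDiffAt.laplacian_CLM_comp_left
        ((hg.contDiff_mul ha le_rfl hu.smooth).contDiffAt.of_le (by norm_cast))]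
      simp only [Function.comp_apply, laplacian_cutoff_mul hg ha hu]
      simp
    set S := ∑ j ∈ Finset.range (N + 1 + 1), annulusL1 a b (scaledLaplacian^[j] u)
    have hS1 : ∑ j ∈ Finset.range (N + 1), annulusL1 a b (scaledLaplacian^[j] u) ≤ S :=
      Finset.sum_le_sum_of_subset_of_nonneg (by gcongr; simp) fun _ _ _ => annulusL1_nonneg _ _ _
    have hS2 : ∑ j ∈ Finset.range (N + 1), annulusL1 a b (scaledLaplacian^[j] (scaledLaplacian u))
        ≤ S := by
      -- The sum for `scaledLaplacian u` is the shifted sum for `u`, which lacks only the term `j =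
      -- 0`.
      simp only [S, Finset.sum_range_succ' _ (N + 1)]
      exact le_add_of_nonneg_right (annulusL1_nonneg _ _ _)
    calc ‖ξ‖ ^ (2 * (N + 1)) * ‖𝓕 f ξ‖ = ‖ξ‖ ^ (2 * N) * (‖ξ‖ ^ 2 * ‖𝓕 f ξ‖) := by ring
      _ = ((2 * Real.pi) ^ 2)⁻¹ * (‖ξ‖ ^ (2 * N) * ‖𝓕 f1 ξ + 𝓕 f2 ξ‖) := by
        rw [norm_sq_mul_norm_fourier, hΔ, FourierTransform.fourier_add, _root_.add_apply]
        ring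
      _ ≤ ((2 * Real.pi) ^ 2)⁻¹ * (‖ξ‖ ^ (2 * N) * ‖𝓕 f1 ξ‖ + ‖ξ‖ ^ (2 * N) * ‖𝓕 f2 ξ‖) := by
        rw [← mul_add]
        gcongr
        exact norm_add_le _ _
      _ ≤ ((2 * Real.pi) ^ 2)⁻¹ * (C1 * S + C2 * S) := by
        refine mul_le_mul_of_nonneg_left (add_le_add ?_ ?_) (by positivity)
        · exact (h1 u hu f1 hf1 ξ).trans (mul_le_mul_of_nonneg_left hS1 hC1)
        · exact (h2 _ hu.scaledLaplacian f2 hf2 ξ).trans (mul_le_mul_of_nonneg_left hS2 hC2)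
      _ = _ := by ring

lemma exists_isCutoff {c r R : ℝ} (hr : 0 < r) (hrR : r < R) :
    ∃ g : ℝ → ℝ, IsCutoff (c - R) (c + R) g ∧ (∀ s, 0 ≤ g s) ∧ ∀ s ∈ Icc (c - r) (c + r), g s = 1 := by
  let φ : ContDiffBump c := ⟨r, R, hr, hrR⟩
  refine ⟨φ, ⟨φ.contDiff, fun s hs => φ.zero_of_le_dist ?_⟩, fun s => φ.nonneg, fun s hs => ?_⟩
  · rw [← Real.closedBall_eq_Icc] at hs
    exact (not_le.1 hs).le
  · rw [← Real.closedBall_eq_Icc] at hs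
    exact φ.one_of_mem_closedBall hs

/-- A Sobolev inequality on annuli for functions that are constant along rays. -/
theorem exists_norm_iteratedFDeriv_le_annulusL1 (k : ℕ) :
    ∃ C : ℝ, 0 ≤ C ∧ ∃ N : ℕ, ∀ u : E → ℝ, HomSmooth u → ∀ y : E, ‖y‖ ^ 2 ∈ Ioo (1 / 2 : ℝ) (7 / 2) →
      ‖iteratedFDeriv ℝ k u y‖
        ≤ C * ∑ j ∈ Finset.range N, annulusL1 (1 / 4) (15 / 4) (scaledLaplacian^[j] u) := by
  obtain ⟨g, hg, -, hg1⟩ := exists_isCutoff (c := 2) (r := 3 / 2) (R := 7 / 4) (by norm_num)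
    (by norm_num)
  norm_num at hg hg1
  have ha : (0 : ℝ) < 1 / 4 := by norm_num
  obtain ⟨C, hC, N, h⟩ := exists_norm_iteratedFDeriv_le_fourier (E := E) k
  obtain ⟨C0, hC0, h0⟩ := norm_pow_mul_fourier_cutoff_le (E := E) ha 0 g hg
  obtain ⟨C1, hC1, h1⟩ := norm_pow_mul_fourier_cutoff_le (E := E) ha N g hg
  refine ⟨C * (C0 + C1), by positivity, N + 1, fun u hu y hy => ?_⟩
  obtain ⟨f, hf⟩ := exists_schwartz_cutoff hg ha hu
  set S := ∑ j ∈ Finset.range (N + 1), annulusL1 (1 / 4) (15 / 4) (scaledLaplacian^[j] u)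
  have hS : 0 ≤ S := Finset.sum_nonneg fun _ _ => annulusL1_nonneg _ _ _
  have hS0 : ∑ j ∈ Finset.range (0 + 1), annulusL1 (1 / 4) (15 / 4) (scaledLaplacian^[j] u) ≤ S :=
    Finset.sum_le_sum_of_subset_of_nonneg (by gcongr; simp) fun _ _ _ => annulusL1_nonneg _ _ _
  have hb := h f ((C0 + C1) * S)
    (fun ξ => by
      have := h0 u hu f hf ξ
      simp only [mul_zero, pow_zero, one_mul] at this
      nlinarith [mul_le_mul_of_nonneg_left hS0 hC0, mul_nonneg hC1 hS])
    (fun ξ => by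
      have := h1 u hu f hf ξ
      nlinarith [mul_nonneg hC0 hS]) y
  -- The cutoff is 1 near `y`, so `u` and the Schwartz function have the same germ there, and the
  -- isometry `ℝ → ℂ` preserves norms of derivatives.
  have heq : (Complex.ofRealLI ∘ u) =ᶠ[𝓝 y] f := by
    have : Tendsto (fun y : E => ‖y‖ ^ 2) (𝓝 y) (𝓝 (‖y‖ ^ 2)) :=
      (continuous_norm.pow 2).continuousAt
    filter_upwards [this.eventually (isOpen_Ioo.mem_nhds hy)] with z hz
    have := hg1 (‖z‖ ^ 2) (by linarith [hz.1]) (by linarith [hz.2])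
    simp [hf, this]
  have hy0 : y ≠ 0 := by
    rintro rfl
    have := hy.1
    norm_num at this
  rw [← Complex.ofRealLI.norm_iteratedFDeriv_comp_left (hu.contDiffAt hy0) (by exact_mod_cast le_top),
    heq.iteratedFDeriv (𝕜 := ℝ) k |>.eq_of_nhds]
  linarith

end Sobolev

/-! ### Time-dependent families: time and space derivatives commute. -/

section Family

variable {E : Type*} [NormedAddCommGroup E] [NormedSpace ℝ E]
  {V : Type*} [NormedAddCommGroup V] [NormedSpace ℝ V]
  {W : Type*} [NormedAddCommGroup W] [NormedSpace ℝ W]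

/-- Families of functions that are jointly smooth for `t > 0` and `y ≠ 0`. -/
def SmoothFamily (A : ℝ → E → V) : Prop :=
  ContDiffOn ℝ ∞ (Function.uncurry A) (Ioi (0 : ℝ) ×ˢ {0}ᶜ)

/-- The time derivative of a family of functions. -/
noncomputable def tderiv (A : ℝ → E → V) : ℝ → E → V := fun t y => deriv (fun s => A s y) t

lemma isOpen_Ioi_prod_compl {E : Type*} [NormedAddCommGroup E] :
    IsOpen (Ioi (0 : ℝ) ×ˢ ({0}ᶜ : Set E)) :=
  isOpen_Ioi.prod isOpen_compl_singleton

namespace SmoothFamily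

variable {A : ℝ → E → V} {t : ℝ} {y : E}

lemma contDiffAt (hA : SmoothFamily A) (ht : 0 < t) (hy : y ≠ 0) :
    ContDiffAt ℝ ∞ (Function.uncurry A) (t, y) :=
  ContDiffOn.contDiffAt hA (isOpen_Ioi_prod_compl.mem_nhds ⟨ht, hy⟩)

lemma contDiffAt_space (hA : SmoothFamily A) (ht : 0 < t) (hy : y ≠ 0) :
    ContDiffAt ℝ ∞ (A t) y :=
  (hA.contDiffAt ht hy).comp y (contDiffAt_const.prodMk contDiffAt_id)

lemma contDiffAt_time (hA : SmoothFamily A) (ht : 0 < t) (hy : y ≠ 0) :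
    ContDiffAt ℝ ∞ (fun s => A s y) t :=
  (hA.contDiffAt ht hy).comp t (contDiffAt_id.prodMk contDiffAt_const)

lemma hasFDerivAt (hA : SmoothFamily A) (ht : 0 < t) (hy : y ≠ 0) :
    HasFDerivAt (Function.uncurry A) (fderiv ℝ (Function.uncurry A) (t, y)) (t, y) :=
  ((hA.contDiffAt ht hy).differentiableAt (by simp)).hasFDerivAt

lemma hasDerivAt (hA : SmoothFamily A) (ht : 0 < t) (hy : y ≠ 0) :
    HasDerivAt (fun s => A s y) (tderiv A t y) t :=
  ((hA.contDiffAt_time ht hy).differentiableAt (by simp)).hasDerivAt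

lemma tderiv_eq (hA : SmoothFamily A) (ht : 0 < t) (hy : y ≠ 0) :
    tderiv A t y = fderiv ℝ (Function.uncurry A) (t, y) (1, 0) := by
  have h : HasDerivAt (fun s : ℝ => (s, y)) ((1, 0) : ℝ × E) t :=
    (hasDerivAt_id t).prodMk (hasDerivAt_const t y)
  exact ((hA.hasFDerivAt ht hy).comp_hasDerivAt t h).deriv

lemma fderiv_eq (hA : SmoothFamily A) (ht : 0 < t) (hy : y ≠ 0) :
    fderiv ℝ (A t) y
      = (fderiv ℝ (Function.uncurry A) (t, y)).comp (ContinuousLinearMap.inr ℝ ℝ E) :=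
  ((hA.hasFDerivAt ht hy).comp y (hasFDerivAt_prodMk_right t y)).fderiv

lemma fderiv_uncurry (hA : SmoothFamily A) :
    ContDiffOn ℝ ∞ (fun p => _root_.fderiv ℝ (Function.uncurry A) p)
      (Ioi (0 : ℝ) ×ˢ ({0}ᶜ : Set E)) := fun p hp =>
  ((hA.contDiffAt hp.1 hp.2).fderiv_right (m := ∞) (by simp)).contDiffWithinAt

lemma tderiv (hA : SmoothFamily A) : SmoothFamily (tderiv A) := by
  refine ContDiffOn.congr (f := fun p => _root_.fderiv ℝ (Function.uncurry A) p (1, 0)) ?_ ?_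
  · exact hA.fderiv_uncurry.clm_apply contDiffOn_const
  · exact fun p hp => hA.tderiv_eq hp.1 hp.2

lemma fderiv (hA : SmoothFamily A) : SmoothFamily (fun t y => fderiv ℝ (A t) y) := by
  refine ContDiffOn.congr (f := fun p => (_root_.fderiv ℝ (Function.uncurry A) p).comp
    (ContinuousLinearMap.inr ℝ ℝ E)) ?_ ?_
  · exact hA.fderiv_uncurry.clm_comp contDiffOn_const
  · exact fun p hp => hA.fderiv_eq hp.1 hp.2

lemma clm_comp (hA : SmoothFamily A) (L : V →L[ℝ] W) : SmoothFamily (fun t y => L (A t y)) :=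
  L.contDiff.comp_contDiffOn hA

lemma tderiv_clm_comp (hA : SmoothFamily A) (L : V →L[ℝ] W) (ht : 0 < t) (hy : y ≠ 0) :
    ModelSystem.tderiv (fun t y => L (A t y)) t y = L (ModelSystem.tderiv A t y) :=
  (L.hasFDerivAt.comp_hasDerivAt t (hA.hasDerivAt ht hy)).deriv

/-- Symmetry of the second derivative of the uncurried map, evaluated on a time vector and a space
vector. -/
lemma tderiv_fderiv (hA : SmoothFamily A) (ht : 0 < t) (hy : y ≠ 0) :
    ModelSystem.tderiv (fun t y => _root_.fderiv ℝ (A t) y) t y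
      = _root_.fderiv ℝ (ModelSystem.tderiv A t) y := by
  set Φ := _root_.fderiv ℝ (Function.uncurry A) with hΦ
  have hΦd : HasFDerivAt Φ (_root_.fderiv ℝ Φ (t, y)) (t, y) :=
    ((((hA.contDiffAt ht hy).fderiv_right (m := ∞) (by simp))).differentiableAt
      (by simp)).hasFDerivAt
  have hsymm : IsSymmSndFDerivAt ℝ (Function.uncurry A) (t, y) :=
    (hA.contDiffAt ht hy).isSymmSndFDerivAt (by simp; norm_cast)
  ext w
  have h1 : HasDerivAt (fun s => (Φ (s, y)).comp (ContinuousLinearMap.inr ℝ ℝ E))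
      ((_root_.fderiv ℝ Φ (t, y) (1, 0)).comp (ContinuousLinearMap.inr ℝ ℝ E)) t := by
    have h := hΦd.comp_hasDerivAt t ((hasDerivAt_id t).prodMk (hasDerivAt_const t y))
    exact (((ContinuousLinearMap.compL ℝ E (ℝ × E) V).flip
      (ContinuousLinearMap.inr ℝ ℝ E)).hasFDerivAt.comp_hasDerivAt t h)
  have h2 : HasFDerivAt (fun z => Φ (t, z) (1, 0))
      ((ContinuousLinearMap.apply ℝ V ((1, 0) : ℝ × E)).comp
        ((_root_.fderiv ℝ Φ (t, y)).comp (ContinuousLinearMap.inr ℝ ℝ E))) y := by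
    have h := hΦd.comp y (hasFDerivAt_prodMk_right t y)
    exact (ContinuousLinearMap.apply ℝ V ((1, 0) : ℝ × E)).hasFDerivAt.comp y h
  have e1 : (fun s => _root_.fderiv ℝ (A s) y) =ᶠ[𝓝 t]
      fun s => (Φ (s, y)).comp (ContinuousLinearMap.inr ℝ ℝ E) := by
    filter_upwards [lt_mem_nhds ht] with s hs using hA.fderiv_eq hs hy
  have e2 : ModelSystem.tderiv A t =ᶠ[𝓝 y] fun z => Φ (t, z) (1, 0) := by
    filter_upwards [isOpen_compl_singleton.mem_nhds hy] with z hz using hA.tderiv_eq ht hz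
  rw [e2.fderiv_eq, h2.fderiv]
  change deriv (fun s => _root_.fderiv ℝ (A s) y) t w = _
  rw [e1.deriv_eq, h1.deriv]
  simpa using hsymm (1, 0) (0, w)

lemma iteratedFDeriv (hA : SmoothFamily A) (k : ℕ) :
    SmoothFamily (fun t y => iteratedFDeriv ℝ k (A t) y) := by
  induction k with
  | zero =>
    exact hA.clm_comp (continuousMultilinearCurryFin0 ℝ E V).symm.toContinuousLinearEquiv.toContinuousLinearMap
  | succ k ih =>
    exact ih.fderiv.clm_comp (continuousMultilinearCurryLeftEquiv ℝ
      (fun _ : Fin (k + 1) => E) V).symm.toContinuousLinearEquiv.toContinuousLinearMap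

lemma tderiv_iteratedFDeriv (hA : SmoothFamily A) (k : ℕ) (ht : 0 < t) (hy : y ≠ 0) :
    ModelSystem.tderiv (fun t y => _root_.iteratedFDeriv ℝ k (A t) y) t y
      = _root_.iteratedFDeriv ℝ k (ModelSystem.tderiv A t) y := by
  induction k generalizing y with
  | zero =>
    exact hA.tderiv_clm_comp (continuousMultilinearCurryFin0 ℝ E V).symm.toContinuousLinearEquiv.toContinuousLinearMap ht hy
  | succ k ih =>
    have h := (hA.iteratedFDeriv k).fderiv.tderiv_clm_comp (continuousMultilinearCurryLeftEquiv ℝ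
      (fun _ : Fin (k + 1) => E) V).symm.toContinuousLinearEquiv.toContinuousLinearMap ht hy
    rw [(hA.iteratedFDeriv k).tderiv_fderiv ht hy] at h
    refine h.trans ?_
    rw [iteratedFDeriv_succ_eq_comp_left, Function.comp_apply]
    have e : ModelSystem.tderiv (fun t y => _root_.iteratedFDeriv ℝ k (A t) y) t =ᶠ[𝓝 y]
        _root_.iteratedFDeriv ℝ k (ModelSystem.tderiv A t) := by
      filter_upwards [isOpen_compl_singleton.mem_nhds hy] with z hz using ih hz
    rw [e.fderiv_eq]
    rfl

lemma hasDerivAt_iteratedFDeriv (hA : SmoothFamily A) (k : ℕ) (ht : 0 < t) (hy : y ≠ 0) :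
    HasDerivAt (fun s => _root_.iteratedFDeriv ℝ k (A s) y)
      (_root_.iteratedFDeriv ℝ k (ModelSystem.tderiv A t) y) t := by
  rw [← hA.tderiv_iteratedFDeriv k ht hy]
  exact (hA.iteratedFDeriv k).hasDerivAt ht hy

lemma add {B : ℝ → E → V} (hA : SmoothFamily A) (hB : SmoothFamily B) :
    SmoothFamily (fun t y => A t y + B t y) := ContDiffOn.add hA hB

lemma smul {w : ℝ → ℝ} (hw : ContDiffOn ℝ ∞ w (Ioi 0)) (hA : SmoothFamily A) :
    SmoothFamily (fun t y => w t • A t y) :=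
  (hw.comp contDiffOn_fst fun _ hp => hp.1).smul hA

end SmoothFamily

end Family

/-! ### The model system for ray-constant families, and its invariance under the Laplacian. -/

section HomFamily

variable {E : Type*} [NormedAddCommGroup E] [InnerProductSpace ℝ E] {A : ℝ → E → ℝ} {t : ℝ}

/-- Families of functions that are jointly smooth for `t > 0` and `y ≠ 0`, and constant along
rays. -/
structure HomFamily (A : ℝ → E → ℝ) : Prop where
  smooth : SmoothFamily A
  hom : ∀ t : ℝ, 0 < t → ∀ c : ℝ, 0 < c → ∀ y, A t (c • y) = A t y

lemma HomFamily.homSmooth (hA : HomFamily A) (ht : 0 < t) : HomSmooth (A t) where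
  smooth _ hy := (hA.smooth.contDiffAt_space ht hy).contDiffWithinAt
  hom := hA.hom t ht

lemma HomFamily.tderiv (hA : HomFamily A) : HomFamily (tderiv A) where
  smooth := hA.smooth.tderiv
  hom t ht c hc y := by
    refine Filter.EventuallyEq.deriv_eq ?_
    filter_upwards [lt_mem_nhds ht] with s hs using hA.hom s hs c hc y

lemma HomFamily.add {B : ℝ → E → ℝ} (hA : HomFamily A) (hB : HomFamily B) :
    HomFamily (fun t y => A t y + B t y) where
  smooth := hA.smooth.add hB.smooth
  hom t ht c hc y := by simp only [hA.hom t ht c hc y, hB.hom t ht c hc y]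

lemma HomFamily.mul {w : ℝ → ℝ} (hw : ContDiffOn ℝ ∞ w (Ioi 0)) (hA : HomFamily A) :
    HomFamily (fun t y => w t * A t y) where
  smooth := SmoothFamily.smul hw hA.smooth
  hom t ht c hc y := by simp only [hA.hom t ht c hc y]

variable [FiniteDimensional ℝ E]

lemma scaledLaplacian_eq_sum (u : E → ℝ) (y : E) :
    scaledLaplacian u y = ‖y‖ ^ 2 * ∑ i, iteratedFDeriv ℝ 2 u y
      ![stdOrthonormalBasis ℝ E i, stdOrthonormalBasis ℝ E i] := by
  rw [scaledLaplacian, InnerProductSpace.laplacian_eq_iteratedFDeriv_stdOrthonormalBasis]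

lemma scaledLaplacian_congr {u v : E → ℝ} {y : E} (h : u =ᶠ[𝓝 y] v) :
    scaledLaplacian u y = scaledLaplacian v y := by
  rw [scaledLaplacian, scaledLaplacian, (InnerProductSpace.laplacian_congr_nhds h).eq_of_nhds]

lemma scaledLaplacian_add {u v : E → ℝ} {y : E} (hu : ContDiffAt ℝ ∞ u y)
    (hv : ContDiffAt ℝ ∞ v y) :
    scaledLaplacian (fun z => u z + v z) y = scaledLaplacian u y + scaledLaplacian v y := by
  have := (hu.of_le (m := 2) (by norm_cast)).laplacian_add (hv.of_le (by norm_cast))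
  rw [scaledLaplacian, scaledLaplacian, scaledLaplacian, ← mul_add, ← this]
  rfl

lemma scaledLaplacian_const_mul {u : E → ℝ} {y : E} (hu : ContDiffAt ℝ ∞ u y) (c : ℝ) :
    scaledLaplacian (fun z => c * u z) y = c * scaledLaplacian u y := by
  have := InnerProductSpace.laplacian_smul (𝕜 := ℝ) c (hu.of_le (m := 2) (by norm_cast))
  rw [scaledLaplacian, scaledLaplacian, mul_left_comm, ← smul_eq_mul c, ← this]
  rfl

lemma SmoothFamily.scaledLaplacian (hA : SmoothFamily A) :
    SmoothFamily (fun t => scaledLaplacian (A t)) := by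
  have h := hA.iteratedFDeriv 2
  refine ContDiffOn.congr (f := fun p : ℝ × E => ‖p.2‖ ^ 2 * ∑ i, _root_.iteratedFDeriv ℝ 2 (A p.1) p.2
    ![stdOrthonormalBasis ℝ E i, stdOrthonormalBasis ℝ E i]) ?_
    fun p _ => scaledLaplacian_eq_sum (A p.1) p.2
  refine ContDiffOn.mul ((contDiff_norm_sq ℝ).comp contDiff_snd).contDiffOn
    (ContDiffOn.sum fun i _ => ?_)
  exact h.clm_comp (ContinuousMultilinearMap.apply ℝ (fun _ : Fin 2 => E) ℝ
    ![stdOrthonormalBasis ℝ E i, stdOrthonormalBasis ℝ E i])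

lemma SmoothFamily.tderiv_scaledLaplacian (hA : SmoothFamily A) (ht : 0 < t) :
    ModelSystem.tderiv (fun t => ModelSystem.scaledLaplacian (A t)) t
      = ModelSystem.scaledLaplacian (ModelSystem.tderiv A t) := by
  ext y
  rcases eq_or_ne y 0 with rfl | hy
  -- At the origin the factor `‖y‖ ^ 2` makes both sides 0. The identity thus holds between
  -- functions, as the iteration of the operator requires.
  · simp [ModelSystem.scaledLaplacian, ModelSystem.tderiv]
  · rw [scaledLaplacian_eq_sum]
    refine HasDerivAt.deriv ?_
    simp_rw [scaledLaplacian_eq_sum]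
    refine (HasDerivAt.fun_sum fun i _ => ?_).const_mul _
    exact (ContinuousMultilinearMap.apply ℝ (fun _ : Fin 2 => E) ℝ
      ![stdOrthonormalBasis ℝ E i, stdOrthonormalBasis ℝ E i]).hasFDerivAt.comp_hasDerivAt t
      (hA.hasDerivAt_iteratedFDeriv 2 ht hy)

lemma HomFamily.scaledLaplacian (hA : HomFamily A) :
    HomFamily (fun t => scaledLaplacian (A t)) where
  smooth := hA.smooth.scaledLaplacian
  hom _ ht := (hA.homSmooth ht).scaledLaplacian.hom

/-- Solutions of the model system, extended to the punctured Euclidean space so that they are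
constant along rays. -/
structure IsHomSolution (q : ℝ) (f₁ f₂ f₃ : ℝ → ℝ) (A X : ℝ → E → ℝ) : Prop where
  hom_alpha : HomFamily A
  hom_chi : HomFamily X
  main_eq : ∀ t : ℝ, 0 < t → ∀ y : E, y ≠ 0 →
    tderiv (tderiv A) t y = (f₁ t * t - 1 / t) * tderiv A t y + (f₂ t * t ^ 2 - 4 * q) * A t y
      + 4 / (t ^ 2 + 1) ^ 2 * scaledLaplacian (A t) y + f₃ t * X t y
  chi_eq : ∀ t : ℝ, 0 < t → ∀ y : E, y ≠ 0 → tderiv X t y = 2 * t * A t y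

namespace IsHomSolution

variable {q : ℝ} {f₁ f₂ f₃ : ℝ → ℝ} {X : ℝ → E → ℝ}

/-- At fixed `t` the coefficients are constants in space, so the equation can be differentiated
without any regularity of the `fᵢ` in time. -/
lemma scaledLaplacian (h : IsHomSolution q f₁ f₂ f₃ A X) :
    IsHomSolution q f₁ f₂ f₃ (fun t => scaledLaplacian (A t)) (fun t => scaledLaplacian (X t)) where
  hom_alpha := h.hom_alpha.scaledLaplacian
  hom_chi := h.hom_chi.scaledLaplacian
  main_eq t ht y hy := by
    have e1 : tderiv (tderiv fun t => ModelSystem.scaledLaplacian (A t)) t y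
        = ModelSystem.scaledLaplacian (tderiv (tderiv A) t) y := by
      rw [← h.hom_alpha.tderiv.smooth.tderiv_scaledLaplacian ht]
      refine Filter.EventuallyEq.deriv_eq ?_
      filter_upwards [lt_mem_nhds ht] with s hs
      rw [h.hom_alpha.smooth.tderiv_scaledLaplacian hs]
    have e2 : tderiv (tderiv A) t =ᶠ[𝓝 y] fun y => (f₁ t * t - 1 / t) * tderiv A t y
        + (f₂ t * t ^ 2 - 4 * q) * A t y
        + 4 / (t ^ 2 + 1) ^ 2 * ModelSystem.scaledLaplacian (A t) y + f₃ t * X t y := by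
      filter_upwards [isOpen_compl_singleton.mem_nhds hy] with z hz using h.main_eq t ht z hz
    have c1 := h.hom_alpha.smooth.contDiffAt_space ht hy
    have c2 := h.hom_alpha.tderiv.smooth.contDiffAt_space ht hy
    have c3 := h.hom_alpha.scaledLaplacian.smooth.contDiffAt_space ht hy
    have c4 := h.hom_chi.smooth.contDiffAt_space ht hy
    rw [e1, scaledLaplacian_congr e2, scaledLaplacian_add (by fun_prop) (by fun_prop),
      scaledLaplacian_add (by fun_prop) (by fun_prop),
      scaledLaplacian_add (by fun_prop) (by fun_prop), scaledLaplacian_const_mul c1,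
      scaledLaplacian_const_mul c2, scaledLaplacian_const_mul c3, scaledLaplacian_const_mul c4,
      h.hom_alpha.smooth.tderiv_scaledLaplacian ht]
  chi_eq t ht y hy := by
    have e : tderiv X t =ᶠ[𝓝 y] fun y => 2 * t * A t y := by
      filter_upwards [isOpen_compl_singleton.mem_nhds hy] with z hz using h.chi_eq t ht z hz
    rw [h.hom_chi.smooth.tderiv_scaledLaplacian ht, scaledLaplacian_congr e,
      scaledLaplacian_const_mul (h.hom_alpha.smooth.contDiffAt_space ht hy)]

lemma iterate_scaledLaplacian (h : IsHomSolution q f₁ f₂ f₃ A X) (j : ℕ) :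
    IsHomSolution q f₁ f₂ f₃ (fun t => ModelSystem.scaledLaplacian^[j] (A t))
      (fun t => ModelSystem.scaledLaplacian^[j] (X t)) := by
  induction j with
  | zero => exact h
  | succ j ih =>
    simp_rw [Function.iterate_succ_apply']
    exact ih.scaledLaplacian

end IsHomSolution

lemma HomFamily.tderiv_iterate_scaledLaplacian (hA : HomFamily A) (j : ℕ) (ht : 0 < t) :
    ModelSystem.tderiv (fun t => ModelSystem.scaledLaplacian^[j] (A t)) t
      = ModelSystem.scaledLaplacian^[j] (ModelSystem.tderiv A t) := by
  induction j generalizing A with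
  | zero => rfl
  | succ j ih =>
    simp_rw [Function.iterate_succ_apply]
    rw [ih hA.scaledLaplacian, hA.smooth.tderiv_scaledLaplacian ht]

end HomFamily

/-! ### Energy density, its pointwise inequality, and Green's formula with radial weight. -/

section Energy

variable {E : Type*} [NormedAddCommGroup E] [InnerProductSpace ℝ E] [FiniteDimensional ℝ E]

/-- The inner product of the gradients along the unit sphere, for functions that are constant
along rays. -/
noncomputable def gradInner (u v : E → ℝ) (y : E) : ℝ :=
  ‖y‖ ^ 2 * ∑ i, fderiv ℝ u y (stdOrthonormalBasis ℝ E i) * fderiv ℝ v y (stdOrthonormalBasis ℝ E i)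

/-- The energy density. -/
noncomputable def energyDensity (A X : ℝ → E → ℝ) (t : ℝ) (y : E) : ℝ :=
  ((tderiv A t y) ^ 2 + 4 / (t ^ 2 + 1) ^ 2 * gradInner (A t) (A t) y + A t y ^ 2 + X t y ^ 2) / 2

lemma smoothFamily_energyDensity {A X : ℝ → E → ℝ} (hA : SmoothFamily A) (hX : SmoothFamily X) :
    SmoothFamily (energyDensity A X) := by
  have h1 : ContDiffOn ℝ ∞ (fun p : ℝ × E => tderiv A p.1 p.2) (Ioi (0 : ℝ) ×ˢ {0}ᶜ) := hA.tderiv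
  have h2 : ContDiffOn ℝ ∞ (fun p : ℝ × E => A p.1 p.2) (Ioi (0 : ℝ) ×ˢ {0}ᶜ) := hA
  have h3 : ContDiffOn ℝ ∞ (fun p : ℝ × E => X p.1 p.2) (Ioi (0 : ℝ) ×ˢ {0}ᶜ) := hX
  have h4 : ContDiffOn ℝ ∞ (fun p : ℝ × E => 4 / (p.1 ^ 2 + 1) ^ 2) (Ioi (0 : ℝ) ×ˢ {0}ᶜ) := by
    refine ContDiffOn.div contDiffOn_const (by fun_prop) fun p _ => by positivity
  have h5 : ContDiffOn ℝ ∞ (fun p : ℝ × E => gradInner (A p.1) (A p.1) p.2)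
      (Ioi (0 : ℝ) ×ˢ {0}ᶜ) := by
    have hd : ∀ v : E, ContDiffOn ℝ ∞ (fun p : ℝ × E => fderiv ℝ (A p.1) p.2 v)
        (Ioi (0 : ℝ) ×ˢ {0}ᶜ) := fun v => hA.fderiv.clm_apply contDiffOn_const
    exact ((contDiff_norm_sq ℝ).comp contDiff_snd).contDiffOn.mul
      (ContDiffOn.sum fun i _ => (hd _).mul (hd _))
  exact (((h1.pow 2).add (h4.mul h5)).add (h2.pow 2)).add (h3.pow 2) |>.div_const 2

lemma tderiv_energyDensity {A X : ℝ → E → ℝ} (hA : SmoothFamily A) (hX : SmoothFamily X) {t : ℝ}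
    (ht : 0 < t) {y : E} (hy : y ≠ 0) :
    tderiv (energyDensity A X) t y = tderiv A t y * tderiv (tderiv A) t y
      - 8 * t / (t ^ 2 + 1) ^ 3 * gradInner (A t) (A t) y
      + 4 / (t ^ 2 + 1) ^ 2 * gradInner (A t) (tderiv A t) y + A t y * tderiv A t y
      + X t y * tderiv X t y := by
  have h1 := (hA.tderiv.hasDerivAt ht hy).fun_pow 2
  have h2 := (hA.hasDerivAt ht hy).fun_pow 2
  have h3 := (hX.hasDerivAt ht hy).fun_pow 2
  have h4 : HasDerivAt (fun s : ℝ => 4 / (s ^ 2 + 1) ^ 2) (-(16 * t) / (t ^ 2 + 1) ^ 3) t := by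
    have h := (hasDerivAt_const t (4 : ℝ)).fun_div ((((hasDerivAt_id t).fun_pow 2).add_const 1).fun_pow 2)
      (by simp only [id_eq]; positivity)
    refine h.congr_deriv ?_
    simp
    field_simp
    ring
  have h5 : HasDerivAt (fun s => gradInner (A s) (A s) y) (2 * gradInner (A t) (tderiv A t) y) t := by
    have hd : ∀ v : E, HasDerivAt (fun s => fderiv ℝ (A s) y v) (fderiv ℝ (tderiv A t) y v) t := by
      intro v
      have h := hA.fderiv.hasDerivAt ht hy
      rw [hA.tderiv_fderiv ht hy] at h
      simpa using h.clm_apply (hasDerivAt_const t v)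
    have h := (HasDerivAt.fun_sum (u := Finset.univ) fun i _ =>
      (hd (stdOrthonormalBasis ℝ E i)).fun_mul (hd (stdOrthonormalBasis ℝ E i))).const_mul (‖y‖ ^ 2)
    refine h.congr_deriv ?_
    rw [gradInner, mul_left_comm, Finset.mul_sum (a := (2 : ℝ))]
    congr 1
    exact Finset.sum_congr rfl fun i _ => by ring
  refine ((((h1.fun_add (h4.fun_mul h5)).fun_add h2).fun_add h3).div_const 2).deriv.trans ?_
  field_simp
  ring

/-- The inequality behind `t e' + (2 + Ct) e ≥ 0`: `p` stands for `∂_t A`, `G` for the squared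
gradient, `c` for `4/(t²+1)²` and `c'` for `8t/(t²+1)³`. All but the singular term is estimated by
`|ab| ≤ (a² + b²)/2`; the constant is not optimized. -/
lemma energy_inequality_pointwise {q t c p A X G s₁ s₂ s₃ B : ℝ} (hq : 0 ≤ q) (ht : 0 < t) (ht1 : t ≤ 1)
    (hG : 0 ≤ G) (hc : 0 ≤ c) (h1 : |s₁| ≤ B) (h2 : |s₂| ≤ B) (h3 : |s₃| ≤ B) {c' : ℝ} (hc' : c' ≤ 2 * c) :
    0 ≤ (2 + (4 * B + 4 * q + 10) * t) * ((p ^ 2 + c * G + A ^ 2 + X ^ 2) / 2)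
      + t * ((s₁ * t - 1 / t) * p ^ 2 + (s₂ * t ^ 2 - 4 * q + 1) * (A * p) + s₃ * (X * p)
        + 2 * t * (A * X) - c' * G) := by
  have hB : 0 ≤ B := (abs_nonneg _).trans h1
  have hAp : |A * p| ≤ (A ^ 2 + p ^ 2) / 2 := by
    rw [abs_le]; constructor <;> nlinarith [sq_nonneg (A + p), sq_nonneg (A - p)]
  have hXp : |X * p| ≤ (X ^ 2 + p ^ 2) / 2 := by
    rw [abs_le]; constructor <;> nlinarith [sq_nonneg (X + p), sq_nonneg (X - p)]
  have hAX : |A * X| ≤ (A ^ 2 + X ^ 2) / 2 := by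
    rw [abs_le]; constructor <;> nlinarith [sq_nonneg (A + X), sq_nonneg (A - X)]
  have e1 : -(B * p ^ 2) ≤ s₁ * t * p ^ 2 := by
    have : |s₁ * t| ≤ B := by
      rw [abs_mul, abs_of_pos ht]; nlinarith [abs_nonneg s₁]
    nlinarith [abs_le.1 this, sq_nonneg p]
  have e2 : -((B + 4 * q + 1) * ((A ^ 2 + p ^ 2) / 2)) ≤ (s₂ * t ^ 2 - 4 * q + 1) * (A * p) := by
    have h : |s₂ * t ^ 2 - 4 * q + 1| ≤ B + 4 * q + 1 := by
      have ht2 : t ^ 2 ≤ 1 := by nlinarith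
      have : |s₂ * t ^ 2| ≤ B := by
        rw [abs_mul, abs_of_nonneg (sq_nonneg t)]; nlinarith [abs_nonneg s₂, sq_nonneg t]
      rw [abs_le] at this ⊢
      constructor <;> linarith
    have := mul_le_mul h hAp (abs_nonneg _) (by linarith)
    rw [← abs_mul] at this
    exact (abs_le.1 this).1
  have e3 : -(B * ((X ^ 2 + p ^ 2) / 2)) ≤ s₃ * (X * p) := by
    have := mul_le_mul h3 hXp (abs_nonneg _) hB
    rw [← abs_mul] at this
    exact (abs_le.1 this).1
  have e4 : -(A ^ 2 + X ^ 2) ≤ 2 * t * (A * X) := by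
    have : |2 * t * (A * X)| ≤ 2 * ((A ^ 2 + X ^ 2) / 2) := by
      rw [abs_mul, abs_of_pos (by positivity : 0 < 2 * t)]
      exact mul_le_mul (by linarith) hAX (abs_nonneg _) (by norm_num)
    linarith [(abs_le.1 this).1]
  have e5 : c' * G ≤ 2 * (c * G) := by nlinarith
  have hcG : 0 ≤ c * G := mul_nonneg hc hG
  have hsum : 0 ≤ (4 * B + 4 * q + 10) * ((p ^ 2 + c * G + A ^ 2 + X ^ 2) / 2)
      + (s₁ * t * p ^ 2 + (s₂ * t ^ 2 - 4 * q + 1) * (A * p) + s₃ * (X * p)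
        + 2 * t * (A * X) - c' * G) := by
    have m1 := mul_nonneg hB (sq_nonneg p)
    have m2 := mul_nonneg hB (sq_nonneg A)
    have m3 := mul_nonneg hB (sq_nonneg X)
    have m4 := mul_nonneg hB hcG
    have m5 := mul_nonneg hq (sq_nonneg p)
    have m6 := mul_nonneg hq (sq_nonneg A)
    have m7 := mul_nonneg hq (sq_nonneg X)
    have m8 := mul_nonneg hq hcG
    nlinarith [sq_nonneg p, sq_nonneg A, sq_nonneg X]
  -- The singular part contributes `t * (-1/t) * p² = -p²`, exactly the `p²` in twice the energy
  -- density. This fixes the 2, hence the power `t²` in the energy bound.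
  have hid : (2 + (4 * B + 4 * q + 10) * t) * ((p ^ 2 + c * G + A ^ 2 + X ^ 2) / 2)
      + t * ((s₁ * t - 1 / t) * p ^ 2 + (s₂ * t ^ 2 - 4 * q + 1) * (A * p) + s₃ * (X * p)
        + 2 * t * (A * X) - c' * G)
      = c * G + A ^ 2 + X ^ 2 + t * ((4 * B + 4 * q + 10) * ((p ^ 2 + c * G + A ^ 2 + X ^ 2) / 2)
      + (s₁ * t * p ^ 2 + (s₂ * t ^ 2 - 4 * q + 1) * (A * p) + s₃ * (X * p)
        + 2 * t * (A * X) - c' * G)) := by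
    field_simp
    ring
  rw [hid]
  have := mul_nonneg ht.le hsum
  nlinarith [sq_nonneg A, sq_nonneg X]

variable [MeasurableSpace E] [BorelSpace E] {a b : ℝ} {g : ℝ → ℝ}

lemma integral_fderiv_apply_eq_zero {w : E → ℝ} (hw : ContDiff ℝ 1 w) (hs : HasCompactSupport w)
    (v : E) : ∫ y, fderiv ℝ w y v = 0 := by
  have hc : Continuous (fun y => fderiv ℝ w y v) :=
    (hw.continuous_fderiv (by norm_num)).clm_apply continuous_const
  have hs' : HasCompactSupport (fun y => fderiv ℝ w y v) := hs.fderiv_apply ℝ v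
  have h := integral_mul_fderiv_eq_neg_fderiv_mul_of_integrable (μ := (volume : Measure E))
    (f := fun _ : E => (1 : ℝ)) (g := w) (v := v) (by simp)
    (by simpa using hc.integrable_of_hasCompactSupport hs')
    (by simpa using hw.continuous.integrable_of_hasCompactSupport hs)
    (fun x _ => differentiableAt_const _) (fun x _ => hw.differentiable (by norm_num) x)
  simpa using h

lemma IsCutoff.integrable_mul (hg : IsCutoff a b g) (ha : 0 < a) {u : E → ℝ}
    (hu : ContinuousOn u {0}ᶜ) : Integrable (fun y : E => g (‖y‖ ^ 2) * u y) :=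
  ((hg.contDiff_mul ha (by simp) (contDiffOn_zero.2 hu)).continuous).integrable_of_hasCompactSupport
    (hg.hasCompactSupport u)

/-- The integrand is the divergence of the compactly supported field `‖y‖² g(‖y‖²) v ∇u`: the
derivative of the weight is radial and pairs to 0 with `∇u`. -/
lemma integral_cutoff_green (hg : IsCutoff a b g) (ha : 0 < a) {u v : E → ℝ} (hu : HomSmooth u)
    (hv : HomSmooth v) :
    ∫ y : E, g (‖y‖ ^ 2) * (gradInner u v y + scaledLaplacian u y * v y) = 0 := by
  set e := stdOrthonormalBasis ℝ E
  have hg2 : IsCutoff a b (fun s => s * g s) := hg.mul_left contDiff_id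
  have hdu : ∀ i, ContDiffOn ℝ ∞ (fun y => fderiv ℝ u y (e i)) {0}ᶜ := fun i =>
    (hu.smooth.fderiv_of_isOpen isOpen_compl_singleton (by simp)).clm_apply contDiffOn_const
  have hw : ∀ i, ContDiff ℝ ∞ (fun y : E => ‖y‖ ^ 2 * g (‖y‖ ^ 2) * (fderiv ℝ u y (e i) * v y)) :=
    fun i => hg2.contDiff_mul ha le_rfl ((hdu i).mul hv.smooth)
  have hws : ∀ i, HasCompactSupport
      (fun y : E => ‖y‖ ^ 2 * g (‖y‖ ^ 2) * (fderiv ℝ u y (e i) * v y)) :=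
    fun i => hg2.hasCompactSupport _
  have h0 : ∑ i, ∫ y, fderiv ℝ
      (fun y : E => ‖y‖ ^ 2 * g (‖y‖ ^ 2) * (fderiv ℝ u y (e i) * v y)) y (e i) = 0 :=
    Finset.sum_eq_zero fun i _ => integral_fderiv_apply_eq_zero ((hw i).of_le (by norm_cast))
      (hws i) _
  rw [← integral_finsetSum] at h0
  swap
  · intro i _
    exact (((hw i).continuous_fderiv (by simp)).clm_apply
      continuous_const).integrable_of_hasCompactSupport ((hws i).fderiv_apply ℝ _)
  rw [← h0]
  refine integral_congr_ae ?_
  refine ae_of_all _ fun y => ?_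
  by_cases hy : y ∈ annulus E a b
  · have hy0 : y ≠ 0 := ne_zero_of_mem_annulus ha hy
    have hdu1 : ∀ i, HasFDerivAt (fun y => fderiv ℝ u y (e i))
        (fderiv ℝ (fun y => fderiv ℝ u y (e i)) y) y := fun i =>
      (((hdu i).contDiffAt (isOpen_compl_singleton.mem_nhds hy0)).differentiableAt
        (by simp)).hasFDerivAt
    have hv1 : HasFDerivAt v (fderiv ℝ v y) y :=
      ((hv.contDiffAt hy0).differentiableAt (by simp)).hasFDerivAt
    have hc := hasFDerivAt_comp_norm_sq (hg2.smooth.differentiable (by simp)) y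
    have key : ∀ i, fderiv ℝ
        (fun y : E => ‖y‖ ^ 2 * g (‖y‖ ^ 2) * (fderiv ℝ u y (e i) * v y)) y (e i)
        = 2 * deriv (fun s => s * g s) (‖y‖ ^ 2) * v y * (inner ℝ y (e i) * fderiv ℝ u y (e i))
          + ‖y‖ ^ 2 * g (‖y‖ ^ 2) * v y * fderiv ℝ (fun y => fderiv ℝ u y (e i)) y (e i)
          + ‖y‖ ^ 2 * g (‖y‖ ^ 2) * (fderiv ℝ u y (e i) * fderiv ℝ v y (e i)) := by
      intro i
      rw [(hc.fun_mul ((hdu1 i).fun_mul hv1)).fderiv]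
      simp
      ring
    have hs : ∑ i, inner ℝ y (e i) * fderiv ℝ u y (e i) = 0 := by
      rw [← hu.fderiv_self hy0]
      conv_rhs => enter [2]; rw [← e.sum_repr' y]
      rw [map_sum]
      simp [real_inner_comm]
    simp only [key, Finset.sum_add_distrib, ← Finset.mul_sum, hs, gradInner, scaledLaplacian]
    rw [laplacian_eq_sum_fderiv ((hu.contDiffAt hy0).of_le (by norm_cast))]
    ring
  · have hz : ∀ i, (fun y : E => ‖y‖ ^ 2 * g (‖y‖ ^ 2) * (fderiv ℝ u y (e i) * v y)) =ᶠ[𝓝 y]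
        fun _ => (0 : ℝ) := by
      intro i
      have : Tendsto (fun y : E => ‖y‖ ^ 2) (𝓝 y) (𝓝 (‖y‖ ^ 2)) :=
        (continuous_norm.pow 2).continuousAt
      filter_upwards [this.eventually (hg.eventually_eq_zero hy)] with t ht
      simp [ht]
    simp only [hg.eq_zero _ hy, (hz _).fderiv_eq]
    simp

/-- The cutoff confines the integrand to a compact annulus, where the time derivative is bounded
uniformly for times in `[t/2, 2t]`. -/
lemma SmoothFamily.hasDerivAt_integral_cutoff (hg : IsCutoff a b g) (ha : 0 < a)
    {H : ℝ → E → ℝ} (hH : SmoothFamily H) {t : ℝ} (ht : 0 < t) :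
    HasDerivAt (fun s => ∫ y : E, g (‖y‖ ^ 2) * H s y)
      (∫ y : E, g (‖y‖ ^ 2) * ModelSystem.tderiv H t y) t := by
  have hsp : ∀ {K : ℝ → E → ℝ}, SmoothFamily K → ∀ s, 0 < s → ContinuousOn (K s) {0}ᶜ :=
    fun hK s hs y hy => (hK.contDiffAt_space hs hy).continuousAt.continuousWithinAt
  obtain ⟨B, hB⟩ := (isCompact_Icc (a := t / 2) (b := 2 * t)).prod (isCompact_annulus (E := E) a b)
    |>.exists_bound_of_continuousOn (f := Function.uncurry (ModelSystem.tderiv H))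
      (hH.tderiv.continuousOn.mono fun p hp =>
        ⟨lt_of_lt_of_le (half_pos ht) hp.1.1, ne_zero_of_mem_annulus ha hp.2⟩)
  have hnhds : Ioo (t / 2) (2 * t) ∈ 𝓝 t := Ioo_mem_nhds (by linarith) (by linarith)
  refine (hasDerivAt_integral_of_dominated_loc_of_deriv_le (μ := volume)
    (F := fun s y => g (‖y‖ ^ 2) * H s y) (F' := fun s y => g (‖y‖ ^ 2) * ModelSystem.tderiv H s y)
    (bound := fun y => |g (‖y‖ ^ 2) * B|) hnhds ?_ ?_ ?_ ?_ ?_ ?_).2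
  · filter_upwards [lt_mem_nhds ht] with s hs
    exact (hg.integrable_mul ha (hsp hH s hs)).aestronglyMeasurable
  · exact hg.integrable_mul ha (hsp hH t ht)
  · exact (hg.integrable_mul ha (hsp hH.tderiv t ht)).aestronglyMeasurable
  · refine ae_of_all _ fun y s hs => ?_
    by_cases hy : y ∈ annulus E a b
    · rw [norm_mul, abs_mul, Real.norm_eq_abs]
      exact mul_le_mul_of_nonneg_left ((hB (s, y) ⟨⟨hs.1.le, hs.2.le⟩, hy⟩).trans (le_abs_self B))
        (abs_nonneg _)
    · simp [hg.eq_zero _ hy]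
  · exact (hg.integrable_mul ha (u := fun _ => B) continuousOn_const).abs
  · refine ae_of_all _ fun y s hs => ?_
    by_cases hy : y ∈ annulus E a b
    · exact (hH.hasDerivAt ((half_pos ht).trans hs.1) (ne_zero_of_mem_annulus ha hy)).const_mul _
    · simp only [hg.eq_zero _ hy, zero_mul]
      exact hasDerivAt_const _ _

end Energy

/-! ### From the energy bound to pointwise bounds on the time derivative. -/

section EnergyEstimate

variable {E : Type*} [NormedAddCommGroup E] [InnerProductSpace ℝ E] [FiniteDimensional ℝ E]

/-- The coefficients of the model system are bounded by `B` on `(0, 1]`. -/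
def CoeffBound (B : ℝ) (f₁ f₂ f₃ : ℝ → ℝ) : Prop :=
  ∀ t ∈ Ioc (0 : ℝ) 1, |f₁ t| ≤ B ∧ |f₂ t| ≤ B ∧ |f₃ t| ≤ B

variable {q B : ℝ} {f₁ f₂ f₃ : ℝ → ℝ} {A X : ℝ → E → ℝ}

lemma gradInner_self_nonneg (u : E → ℝ) (y : E) : 0 ≤ gradInner u u y :=
  mul_nonneg (sq_nonneg _) (Finset.sum_nonneg fun _ _ => mul_self_nonneg _)

lemma tderiv_sq_le_energyDensity (A X : ℝ → E → ℝ) (t : ℝ) (y : E) :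
    tderiv A t y ^ 2 ≤ 2 * energyDensity A X t y := by
  have h : 0 ≤ 4 / (t ^ 2 + 1) ^ 2 * gradInner (A t) (A t) y :=
    mul_nonneg (by positivity) (gradInner_self_nonneg _ _)
  unfold energyDensity
  nlinarith [sq_nonneg (A t y), sq_nonneg (X t y)]

/-- The left side collects the terms with no pointwise control; their integral against a radial
cutoff vanishes by `integral_cutoff_green`. -/
lemma IsHomSolution.energyDensity_inequality (h : IsHomSolution q f₁ f₂ f₃ A X) (hq : 0 ≤ q)
    (hB : CoeffBound B f₁ f₂ f₃) {t : ℝ} (ht : t ∈ Ioc (0 : ℝ) 1) {y : E} (hy : y ≠ 0) :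
    4 / (t ^ 2 + 1) ^ 2 * t *
        (gradInner (A t) (tderiv A t) y + ModelSystem.scaledLaplacian (A t) y * tderiv A t y)
      ≤ (2 + (4 * B + 4 * q + 10) * t) * energyDensity A X t y
        + t * tderiv (energyDensity A X) t y := by
  obtain ⟨h1, h2, h3⟩ := hB t ht
  have hc' : 8 * t / (t ^ 2 + 1) ^ 3 ≤ 2 * (4 / (t ^ 2 + 1) ^ 2) := by
    have ht0 := ht.1
    rw [← mul_div_assoc, div_le_div_iff₀ (by positivity) (by positivity)]
    have : t ≤ t ^ 2 + 1 := by nlinarith [sq_nonneg (t - 1)]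
    have hp : (0 : ℝ) < (t ^ 2 + 1) ^ 2 := by positivity
    nlinarith
  have hpt := energy_inequality_pointwise (p := tderiv A t y) (A := A t y) (X := X t y) hq ht.1 ht.2
    (gradInner_self_nonneg (A t) y) (c := 4 / (t ^ 2 + 1) ^ 2) (by positivity) h1 h2 h3 hc'
  rw [tderiv_energyDensity h.hom_alpha.smooth h.hom_chi.smooth ht.1 hy, h.main_eq t ht.1 y hy,
    h.chi_eq t ht.1 y hy]
  unfold energyDensity
  linarith

variable [MeasurableSpace E] [BorelSpace E]

/-- A Grönwall argument run backwards from `t = 1`. The rate `t⁻²` is the natural one, since `∂_t A`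
behaves like `𝒪/t`. -/
lemma IsHomSolution.exists_energy_le (h : IsHomSolution q f₁ f₂ f₃ A X) (hq : 0 ≤ q)
    (hB : CoeffBound B f₁ f₂ f₃) {a b : ℝ} (ha : 0 < a) {g : ℝ → ℝ} (hg : IsCutoff a b g)
    (hg0 : ∀ s, 0 ≤ g s) :
    ∃ C, ∀ t ∈ Ioc (0 : ℝ) 1, t ^ 2 * ∫ y : E, g (‖y‖ ^ 2) * energyDensity A X t y ≤ C := by
  set e : ℝ → ℝ := fun t => ∫ y : E, g (‖y‖ ^ 2) * energyDensity A X t y with he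
  set e' : ℝ → ℝ := fun t => ∫ y : E, g (‖y‖ ^ 2) * tderiv (energyDensity A X) t y with he'
  have hfam := smoothFamily_energyDensity h.hom_alpha.smooth h.hom_chi.smooth
  have hder : ∀ t, 0 < t → HasDerivAt e (e' t) t := fun t ht =>
    hfam.hasDerivAt_integral_cutoff hg ha ht
  have he0 : ∀ t, 0 ≤ e t := fun t => integral_nonneg fun y =>
    mul_nonneg (hg0 _) (by linarith [tderiv_sq_le_energyDensity A X t y, sq_nonneg (tderiv A t y)])
  set C := 4 * B + 4 * q + 10
  have hC : 0 ≤ C := by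
    have : 0 ≤ B := (abs_nonneg _).trans (hB 1 ⟨one_pos, le_rfl⟩).1
    positivity
  have hineq : ∀ t ∈ Ioc (0 : ℝ) 1, 0 ≤ (2 + C * t) * e t + t * e' t := by
    intro t ht
    have hcont : ∀ {K : ℝ → E → ℝ}, SmoothFamily K → ContinuousOn (K t) {0}ᶜ :=
      fun hK y hy => (hK.contDiffAt_space ht.1 hy).continuousAt.continuousWithinAt
    have i1 := hg.integrable_mul ha (hcont hfam)
    have i2 := hg.integrable_mul ha (hcont hfam.tderiv)
    have hu := h.hom_alpha.homSmooth ht.1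
    have hv := h.hom_alpha.tderiv.homSmooth ht.1
    have hgreen := integral_cutoff_green hg ha hu hv
    have hsum : (2 + C * t) * e t + t * e' t = ∫ y : E, ((2 + C * t) *
        (g (‖y‖ ^ 2) * energyDensity A X t y)
        + t * (g (‖y‖ ^ 2) * tderiv (energyDensity A X) t y)) := by
      rw [integral_add (i1.const_mul _) (i2.const_mul _), integral_const_mul, integral_const_mul]
    rw [hsum]
    calc (0 : ℝ) = ∫ y : E, 4 / (t ^ 2 + 1) ^ 2 * t * (g (‖y‖ ^ 2) *
          (gradInner (A t) (tderiv A t) y + ModelSystem.scaledLaplacian (A t) y * tderiv A t y)) := by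
          rw [integral_const_mul, hgreen, mul_zero]
      _ ≤ _ := by
          refine integral_mono ?_ ((i1.const_mul _).add (i2.const_mul _)) fun y => ?_
          · refine (hg.integrable_mul ha ?_).const_mul _
            have hd : ∀ {u : E → ℝ}, HomSmooth u → ∀ v, ContinuousOn (fun y => fderiv ℝ u y v) {0}ᶜ :=
              fun hu v => (hu.smooth.continuousOn_fderiv_of_isOpen isOpen_compl_singleton
                (by simp)).clm_apply continuousOn_const
            refine ContinuousOn.add ?_ ((hcont h.hom_alpha.scaledLaplacian.smooth).mul
              (hcont h.hom_alpha.tderiv.smooth))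
            exact (continuous_norm.pow 2).continuousOn.mul
              (continuousOn_finsetSum _ fun i _ => (hd hu _).mul (hd hv _))
          · by_cases hy : y ∈ annulus E a b
            · have := mul_le_mul_of_nonneg_left (h.energyDensity_inequality hq hB ht
                (ne_zero_of_mem_annulus ha hy)) (hg0 (‖y‖ ^ 2))
              simp only
              linarith
            · simp [hg.eq_zero _ hy]
  -- `t² exp(Ct)` is the integrating factor: the derivative is `t exp(Ct)` times the left side of
  -- `hineq`.
  have hmono : MonotoneOn (fun t => t ^ 2 * e t * Real.exp (C * t)) (Ioc 0 1) := by
    have hd : ∀ t, 0 < t → HasDerivAt (fun t => t ^ 2 * e t * Real.exp (C * t))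
        (t * Real.exp (C * t) * ((2 + C * t) * e t + t * e' t)) t := by
      intro t ht
      have h1 := (((hasDerivAt_id t).fun_pow 2).fun_mul (hder t ht)).fun_mul
        (((hasDerivAt_id t).const_mul C).exp)
      refine h1.congr_deriv ?_
      simp
      ring
    refine monotoneOn_of_deriv_nonneg (convex_Ioc 0 1)
      (fun t ht => (hd t ht.1).continuousAt.continuousWithinAt) ?_ ?_
    · intro t ht
      rw [interior_Ioc] at ht
      exact (hd t ht.1).differentiableAt.differentiableWithinAt
    · intro t ht
      rw [interior_Ioc] at ht
      rw [(hd t ht.1).deriv]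
      exact mul_nonneg (mul_nonneg ht.1.le (Real.exp_nonneg _)) (hineq t ⟨ht.1, ht.2.le⟩)
  refine ⟨(1 : ℝ) ^ 2 * e 1 * Real.exp (C * 1), fun t ht => ?_⟩
  refine le_trans ?_ (hmono ht ⟨one_pos, le_rfl⟩ ht.2)
  have h1 : 1 ≤ Real.exp (C * t) := Real.one_le_exp (mul_nonneg hC ht.1.le)
  exact le_mul_of_one_le_right (mul_nonneg (sq_nonneg _) (he0 t)) h1

lemma IsHomSolution.exists_annulusL1_tderiv_le (h : IsHomSolution q f₁ f₂ f₃ A X) (hq : 0 ≤ q)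
    (hB : CoeffBound B f₁ f₂ f₃) :
    ∃ C, ∀ t ∈ Ioc (0 : ℝ) 1, annulusL1 (1 / 4) (15 / 4) (tderiv A t) ≤ C / t := by
  -- This cutoff is 1 on `[1/4, 15/4]`, the support interval of the cutoff in the Sobolev
  -- inequality, and is itself supported in `[1/8, 31/8]`.
  obtain ⟨g, hg, hg0, hg1⟩ := exists_isCutoff (c := 2) (r := 7 / 4) (R := 15 / 8) (by norm_num)
    (by norm_num)
  norm_num at hg hg1
  have ha : (0 : ℝ) < 1 / 8 := by norm_num
  have ha' : (0 : ℝ) < 1 / 4 := by norm_num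
  obtain ⟨C, hC⟩ := h.exists_energy_le hq hB ha hg hg0
  set K := annulus E (1 / 4) (15 / 4) with hK
  have hKc : IsCompact K := isCompact_annulus _ _
  refine ⟨((volume K).toReal + 2 * C) / 2, fun t ht => ?_⟩
  have hv := h.hom_alpha.tderiv.homSmooth ht.1
  have hcont : ContinuousOn (tderiv A t) K := hv.continuousOn_annulus ha'
  have hfam := smoothFamily_energyDensity h.hom_alpha.smooth h.hom_chi.smooth
  have hint : Integrable (fun y : E => g (‖y‖ ^ 2) * energyDensity A X t y) :=
    hg.integrable_mul ha fun y hy =>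
      (hfam.contDiffAt_space ht.1 hy).continuousAt.continuousWithinAt
  have hed : ∀ y, 0 ≤ energyDensity A X t y := fun y => by
    linarith [tderiv_sq_le_energyDensity A X t y, sq_nonneg (tderiv A t y)]
  have hsq : ∫ y in K, tderiv A t y ^ 2 ≤ 2 * ∫ y : E, g (‖y‖ ^ 2) * energyDensity A X t y := by
    calc ∫ y in K, tderiv A t y ^ 2 ≤ ∫ y in K, 2 * (g (‖y‖ ^ 2) * energyDensity A X t y) := by
          refine setIntegral_mono_on ((hcont.pow 2).integrableOn_compact hKc)
            (hint.const_mul 2).integrableOn hKc.measurableSet fun y hy => ?_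
          rw [hg1 _ hy.1 hy.2, one_mul]
          exact tderiv_sq_le_energyDensity A X t y
      _ ≤ ∫ y, 2 * (g (‖y‖ ^ 2) * energyDensity A X t y) :=
          setIntegral_le_integral (hint.const_mul 2) (ae_of_all _ fun y =>
            mul_nonneg zero_le_two (mul_nonneg (hg0 _) (hed y)))
      _ = _ := integral_const_mul _ _
  have ht0 := ht.1
  have hsqc : ContinuousOn (fun y => (1 / t + t * tderiv A t y ^ 2) / 2) K := by fun_prop
  have hsqi : Integrable (fun y => t * tderiv A t y ^ 2) (volume.restrict K) :=
    ((hcont.pow 2).integrableOn_compact hKc).const_mul t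
  have hconst : Integrable (fun _ : E => 1 / t) (volume.restrict K) :=
    continuousOn_const.integrableOn_compact hKc
  -- The weighted inequality `2|p| ≤ 1/t + t p²` replaces Cauchy-Schwarz; both terms integrate to
  -- `O(1/t)`.
  calc annulusL1 (1 / 4) (15 / 4) (tderiv A t)
      ≤ ∫ y in K, (1 / t + t * tderiv A t y ^ 2) / 2 := by
        refine setIntegral_mono_on (hcont.abs.integrableOn_compact hKc)
          (hsqc.integrableOn_compact hKc) hKc.measurableSet fun y _ => ?_
        have : 0 ≤ (1 - t * |tderiv A t y|) ^ 2 / t := by positivity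
        have h2 : (1 - t * |tderiv A t y|) ^ 2 / t = 1 / t - 2 * |tderiv A t y|
            + t * tderiv A t y ^ 2 := by
          rw [sub_sq, mul_pow, sq_abs]
          field_simp
        linarith
    _ = ((volume K).toReal * (1 / t) + t * ∫ y in K, tderiv A t y ^ 2) / 2 := by
        rw [integral_div, integral_add hconst
          hsqi, integral_const_mul]
        simp [Measure.real]
    _ ≤ ((volume K).toReal * (1 / t) + t * (2 * (C / t ^ 2))) / 2 := by
        gcongr
        refine hsq.trans ?_
        gcongr
        rw [le_div_iff₀ (by positivity), mul_comm]
        exact hC t ht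
    _ = _ := by field_simp

/-- Points of the open annulus on which the derivatives are estimated. -/
def shell (E : Type*) [NormedAddCommGroup E] : Set E := {y | ‖y‖ ^ 2 ∈ Ioo (1 / 2 : ℝ) (7 / 2)}

/-- Iterated Laplacians of a solution are solutions, so each obeys the `L¹` bound; the Sobolev
inequality combines them. -/
lemma IsHomSolution.exists_norm_iteratedFDeriv_tderiv_le (h : IsHomSolution q f₁ f₂ f₃ A X)
    (hq : 0 ≤ q) (hB : CoeffBound B f₁ f₂ f₃) (k : ℕ) :
    ∃ C, 0 ≤ C ∧ ∀ t ∈ Ioc (0 : ℝ) 1, ∀ y ∈ shell E,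
      ‖iteratedFDeriv ℝ k (tderiv A t) y‖ ≤ C / t := by
  obtain ⟨C, hC, N, hN⟩ := exists_norm_iteratedFDeriv_le_annulusL1 (E := E) k
  choose c hc using fun j => (h.iterate_scaledLaplacian j).exists_annulusL1_tderiv_le hq hB
  refine ⟨C * ∑ j ∈ Finset.range N, |c j|, by positivity, fun t ht y hy => ?_⟩
  have ht0 := ht.1
  refine (hN _ (h.hom_alpha.tderiv.homSmooth ht.1) y hy).trans ?_
  rw [mul_div_assoc, Finset.sum_div]
  gcongr with j
  rw [← h.hom_alpha.tderiv_iterate_scaledLaplacian j ht.1]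
  exact (hc j t ht).trans (by gcongr; exact le_abs_self _)

end EnergyEstimate

/-! ### Logarithmic bounds for the solution and for the source. -/

section LogBounds

variable {E : Type*} [NormedAddCommGroup E] [InnerProductSpace ℝ E]

lemma isOpen_shell {E : Type*} [NormedAddCommGroup E] : IsOpen (shell E) :=
  isOpen_Ioo.preimage (continuous_norm.pow 2)

lemma ne_zero_of_mem_shell {E : Type*} [NormedAddCommGroup E] {y : E} (hy : y ∈ shell E) :
    y ≠ 0 := by
  rintro rfl
  have := hy.1
  norm_num at this

lemma mem_shell_of_norm_eq_one {E : Type*} [NormedAddCommGroup E] {y : E} (hy : ‖y‖ = 1) :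
    y ∈ shell E := by
  simp only [shell, mem_ofPred_eq, hy]
  norm_num

/-- All spatial derivatives grow at most logarithmically as `t → 0`. -/
def LogBounded (G : ℝ → E → ℝ) : Prop :=
  ∀ k : ℕ, ∃ C, 0 ≤ C ∧ ∀ t ∈ Ioc (0 : ℝ) 1, ∀ y ∈ shell E,
    ‖iteratedFDeriv ℝ k (G t) y‖ ≤ C * (1 - Real.log t)

lemma one_le_one_sub_log {t : ℝ} (ht : t ∈ Ioc (0 : ℝ) 1) : 1 ≤ 1 - Real.log t := by
  linarith [Real.log_nonpos ht.1.le ht.2]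

lemma norm_le_of_norm_deriv_le_div {V : Type*} [NormedAddCommGroup V] [NormedSpace ℝ V]
    [CompleteSpace V] {f f' : ℝ → V} {C t : ℝ} (ht : t ∈ Ioc (0 : ℝ) 1)
    (hd : ∀ s ∈ Icc t 1, HasDerivAt f (f' s) s) (hc : ContinuousOn f' (Icc t 1))
    (hb : ∀ s ∈ Icc t 1, ‖f' s‖ ≤ C / s) : ‖f t‖ ≤ ‖f 1‖ + C * (-Real.log t) := by
  have hI : uIcc t 1 = Icc t 1 := uIcc_of_le ht.2
  have h0 : (0 : ℝ) ∉ uIcc t 1 := by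
    rw [hI]; exact fun h => absurd h.1 (not_le.2 ht.1)
  have h1 : ∫ s in t..1, f' s = f 1 - f t :=
    intervalIntegral.integral_eq_sub_of_hasDerivAt (by rwa [hI])
      (by rw [← hI] at hc; exact hc.intervalIntegrable)
  have hint : IntervalIntegrable (fun s => C / s) volume t 1 := by
    refine ContinuousOn.intervalIntegrable fun s hs => ?_
    exact (continuousAt_const.div continuousAt_id
      fun (hs0 : s = 0) => h0 (hs0 ▸ hs)).continuousWithinAt
  have h2 : ‖∫ s in t..1, f' s‖ ≤ ∫ s in t..1, C / s :=
    intervalIntegral.norm_integral_le_of_norm_le ht.2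
      (ae_of_all _ fun s hs => hb s (Ioc_subset_Icc_self hs))
      hint
  have h3 : ∫ s in t..1, C / s = C * (-Real.log t) := by
    simp_rw [div_eq_mul_inv]
    rw [intervalIntegral.integral_const_mul, integral_inv h0]
    simp
  have h4 : f t = f 1 - ∫ s in t..1, f' s := by rw [h1]; abel
  rw [h4]
  exact (norm_sub_le _ _).trans (by linarith)

/-- Integrate `C/s` from `t` to 1; the value at time 1 is bounded on a compact annulus containing
the shell. -/
lemma SmoothFamily.logBounded_of_tderiv [FiniteDimensional ℝ E] {G : ℝ → E → ℝ}
    (hG : SmoothFamily G)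
    (h : ∀ k : ℕ, ∃ C, 0 ≤ C ∧ ∀ t ∈ Ioc (0 : ℝ) 1, ∀ y ∈ shell E,
      ‖_root_.iteratedFDeriv ℝ k (ModelSystem.tderiv G t) y‖ ≤ C / t) : LogBounded G := by
  intro k
  obtain ⟨C, hC, hb⟩ := h k
  obtain ⟨M, hM⟩ := (isCompact_annulus (E := E) (1 / 2) (7 / 2)).exists_bound_of_continuousOn
    (f := fun y => _root_.iteratedFDeriv ℝ k (G 1) y) fun y hy =>
      (((hG.iteratedFDeriv k).contDiffAt_space one_pos
        (ne_zero_of_mem_annulus (by norm_num) hy)).continuousAt).continuousWithinAt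
  refine ⟨max M 0 + C, by positivity, fun t ht y hy => ?_⟩
  have hy0 := ne_zero_of_mem_shell hy
  have := norm_le_of_norm_deriv_le_div (f := fun s => _root_.iteratedFDeriv ℝ k (G s) y) ht
    (fun s hs => hG.hasDerivAt_iteratedFDeriv k (ht.1.trans_le hs.1) hy0)
    (fun s hs => (((hG.tderiv.iteratedFDeriv k).contDiffAt_time (ht.1.trans_le hs.1)
      hy0).continuousAt).continuousWithinAt)
    (fun s hs => hb s ⟨ht.1.trans_le hs.1, hs.2⟩ y hy)
  have h1 := hM y (Ioo_subset_Icc_self hy)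
  have h2 := one_le_one_sub_log ht
  nlinarith [le_max_left M 0, le_max_right M 0]

/-- Only space is differentiated, so `w` need only be bounded. This admits arbitrary bounded
coefficients `fᵢ`. -/
lemma LogBounded.mul {G : ℝ → E → ℝ} (h : LogBounded G) (hG : SmoothFamily G) {w : ℝ → ℝ} {B : ℝ}
    (hw : ∀ t ∈ Ioc (0 : ℝ) 1, |w t| ≤ B) : LogBounded (fun t y => w t * G t y) := by
  intro k
  obtain ⟨C, hC, hb⟩ := h k
  have hB : 0 ≤ B := (abs_nonneg _).trans (hw 1 ⟨one_pos, le_rfl⟩)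
  refine ⟨B * C, by positivity, fun t ht y hy => ?_⟩
  have h1 := iteratedFDeriv_const_smul_apply (𝕜 := ℝ) (i := k) (a := w t) (f := G t) (x := y)
    ((hG.contDiffAt_space ht.1 (ne_zero_of_mem_shell hy)).of_le (by exact_mod_cast le_top))
  change ‖iteratedFDeriv ℝ k (w t • G t) y‖ ≤ _
  rw [h1, norm_smul, mul_assoc]
  exact mul_le_mul (hw t ht) (hb t ht y hy) (norm_nonneg _) hB

lemma norm_iteratedFDeriv_add_four_le {F₁ F₂ F₃ F₄ : E → ℝ} {k : ℕ} {y : E}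
    (h₁ : ContDiffAt ℝ k F₁ y) (h₂ : ContDiffAt ℝ k F₂ y) (h₃ : ContDiffAt ℝ k F₃ y)
    (h₄ : ContDiffAt ℝ k F₄ y) : ‖iteratedFDeriv ℝ k (F₁ + F₂ + F₃ + F₄) y‖
      ≤ ‖iteratedFDeriv ℝ k F₁ y‖ + ‖iteratedFDeriv ℝ k F₂ y‖ + ‖iteratedFDeriv ℝ k F₃ y‖
        + ‖iteratedFDeriv ℝ k F₄ y‖ := by
  have h₁₂ : ContDiffAt ℝ k (F₁ + F₂) y := h₁.add h₂
  have h₁₂₃ : ContDiffAt ℝ k (F₁ + F₂ + F₃) y := h₁₂.add h₃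
  rw [iteratedFDeriv_add_apply h₁₂₃ h₄, iteratedFDeriv_add_apply h₁₂ h₃,
    iteratedFDeriv_add_apply h₁ h₂]
  exact norm_add_le_of_le (norm_add_le_of_le (norm_add_le _ _) le_rfl) le_rfl

variable {q B : ℝ} {f₁ f₂ f₃ : ℝ → ℝ} {A X : ℝ → E → ℝ}

/-- The right-hand side `F` of `∂²A + t⁻¹ ∂A = F`. -/
noncomputable def sourceFamily (A : ℝ → E → ℝ) : ℝ → E → ℝ :=
  fun t y => tderiv (tderiv A) t y + 1 / t * tderiv A t y

lemma contDiffOn_one_div : ContDiffOn ℝ ∞ (fun t : ℝ => 1 / t) (Ioi 0) :=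
  contDiffOn_const.div contDiffOn_id fun _ ht => (ne_of_gt ht)

/-- The source is written through `A` alone because the individual terms of `F` contain the possibly
irregular `fᵢ`, whereas this expression is jointly smooth and so can be integrated in time. -/
lemma HomFamily.sourceFamily (hA : HomFamily A) : HomFamily (sourceFamily A) :=
  hA.tderiv.tderiv.add (hA.tderiv.mul contDiffOn_one_div)

variable [FiniteDimensional ℝ E] [MeasurableSpace E] [BorelSpace E]

namespace IsHomSolution

lemma logBounded_alpha (h : IsHomSolution q f₁ f₂ f₃ A X) (hq : 0 ≤ q)
    (hB : CoeffBound B f₁ f₂ f₃) : LogBounded A :=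
  h.hom_alpha.smooth.logBounded_of_tderiv (h.exists_norm_iteratedFDeriv_tderiv_le hq hB)

lemma logBounded_mul_tderiv (h : IsHomSolution q f₁ f₂ f₃ A X) (hq : 0 ≤ q)
    (hB : CoeffBound B f₁ f₂ f₃) : LogBounded (fun t y => t * tderiv A t y) := by
  intro k
  obtain ⟨C, hC, hb⟩ := h.exists_norm_iteratedFDeriv_tderiv_le hq hB k
  refine ⟨C, hC, fun t ht y hy => ?_⟩
  have h1 := iteratedFDeriv_const_smul_apply (𝕜 := ℝ) (i := k) (a := t) (f := tderiv A t) (x := y)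
    ((h.hom_alpha.tderiv.smooth.contDiffAt_space ht.1 (ne_zero_of_mem_shell hy)).of_le
      (by exact_mod_cast le_top))
  change ‖iteratedFDeriv ℝ k (t • tderiv A t) y‖ ≤ _
  have ht0 := ht.1
  rw [h1, norm_smul, Real.norm_of_nonneg ht0.le]
  calc t * ‖iteratedFDeriv ℝ k (tderiv A t) y‖ ≤ t * (C / t) := by gcongr; exact hb t ht y hy
    _ = C := by field_simp
    _ ≤ _ := le_mul_of_one_le_right hC (one_le_one_sub_log ht)

lemma logBounded_chi (h : IsHomSolution q f₁ f₂ f₃ A X) (hq : 0 ≤ q)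
    (hB : CoeffBound B f₁ f₂ f₃) : LogBounded X := by
  refine h.hom_chi.smooth.logBounded_of_tderiv fun k => ?_
  obtain ⟨C, hC, hb⟩ := h.logBounded_alpha hq hB k
  refine ⟨2 * C, by positivity, fun t ht y hy => ?_⟩
  have hy0 := ne_zero_of_mem_shell hy
  have h1 := iteratedFDeriv_const_smul_apply (𝕜 := ℝ) (i := k) (a := 2 * t) (f := A t) (x := y)
    ((h.hom_alpha.smooth.contDiffAt_space ht.1 hy0).of_le (by exact_mod_cast le_top))
  have e : tderiv X t =ᶠ[𝓝 y] (2 * t) • A t := by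
    filter_upwards [isOpen_compl_singleton.mem_nhds hy0] with z hz using h.chi_eq t ht.1 z hz
  have ht0 := ht.1
  rw [(e.iteratedFDeriv (𝕜 := ℝ) k).eq_of_nhds, h1, norm_smul,
    Real.norm_of_nonneg (by positivity), mul_assoc, mul_div_assoc]
  -- A crude bound: `∂_t X = 2tA` is in fact bounded, but `C/t` is the form that
  -- `logBounded_of_tderiv` takes.
  have h2 : 1 - Real.log t ≤ 1 / t := by
    have := Real.add_one_le_exp (-Real.log t)
    rw [Real.exp_neg, Real.exp_log ht0] at this
    rw [one_div]; linarith
  have h3 : t * (1 - Real.log t) ≤ 1 / t := by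
    have : 1 ≤ 1 / t := one_le_one_div ht0 ht.2
    calc t * (1 - Real.log t) ≤ t * (1 / t) := by gcongr
      _ = 1 := by field_simp
      _ ≤ _ := this
  calc 2 * (t * ‖iteratedFDeriv ℝ k (A t) y‖) ≤ 2 * (t * (C * (1 - Real.log t))) := by
        gcongr; exact hb t ht y hy
    _ = 2 * (C * (t * (1 - Real.log t))) := by ring
    _ ≤ 2 * (C * (1 / t)) := by gcongr
    _ = _ := by ring

/-- By the equation the source is a sum of four log-bounded families with bounded coefficients; the
Laplacian term is covered because it is itself a solution. -/
lemma logBounded_source (h : IsHomSolution q f₁ f₂ f₃ A X) (hq : 0 ≤ q)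
    (hB : CoeffBound B f₁ f₂ f₃) : LogBounded (sourceFamily A) := by
  have l1 := h.logBounded_mul_tderiv hq hB
  have l2 := h.logBounded_alpha hq hB
  have l3 := h.scaledLaplacian.logBounded_alpha hq hB
  have l4 := h.logBounded_chi hq hB
  have hB0 : 0 ≤ B := (abs_nonneg _).trans (hB 1 ⟨one_pos, le_rfl⟩).1
  intro k
  have g1 : ∀ t, 0 < t → ∀ y : E, y ≠ 0 → ContDiffAt ℝ k (fun y => f₁ t * (t * tderiv A t y)) y :=
    fun t ht y hy => contDiffAt_const.mul (contDiffAt_const.mul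
      ((h.hom_alpha.tderiv.smooth.contDiffAt_space ht hy).of_le (by exact_mod_cast le_top)))
  have g2 : ∀ t, 0 < t → ∀ y : E, y ≠ 0 → ContDiffAt ℝ k (fun y => (f₂ t * t ^ 2 - 4 * q) * A t y) y :=
    fun t ht y hy => contDiffAt_const.mul
      ((h.hom_alpha.smooth.contDiffAt_space ht hy).of_le (by exact_mod_cast le_top))
  have g3 : ∀ t, 0 < t → ∀ y : E, y ≠ 0 →
      ContDiffAt ℝ k (fun y => 4 / (t ^ 2 + 1) ^ 2 * ModelSystem.scaledLaplacian (A t) y) y :=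
    fun t ht y hy => contDiffAt_const.mul
      ((h.hom_alpha.scaledLaplacian.smooth.contDiffAt_space ht hy).of_le (by exact_mod_cast le_top))
  have g4 : ∀ t, 0 < t → ∀ y : E, y ≠ 0 → ContDiffAt ℝ k (fun y => f₃ t * X t y) y :=
    fun t ht y hy => contDiffAt_const.mul
      ((h.hom_chi.smooth.contDiffAt_space ht hy).of_le (by exact_mod_cast le_top))
  have b1 := l1.mul ((h.hom_alpha.tderiv.mul (w := fun t => t) contDiffOn_id).smooth)
    (w := f₁) (fun t ht => (hB t ht).1)
  have b2 := l2.mul h.hom_alpha.smooth (w := fun t => f₂ t * t ^ 2 - 4 * q) (B := B + 4 * q)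
    (fun t ht => by
      refine (abs_sub _ _).trans ?_
      rw [abs_mul, abs_of_nonneg (sq_nonneg t), abs_of_nonneg (by positivity : 0 ≤ 4 * q)]
      have ht2 : t ^ 2 ≤ 1 := by nlinarith [ht.1, ht.2]
      have := (hB t ht).2.1
      nlinarith [abs_nonneg (f₂ t), sq_nonneg t])
  have b3 := l3.mul h.hom_alpha.scaledLaplacian.smooth (w := fun t => 4 / (t ^ 2 + 1) ^ 2) (B := 4)
    (fun t ht => by
      rw [abs_of_nonneg (by positivity)]
      exact div_le_self (by norm_num) (one_le_pow₀ (by nlinarith [sq_nonneg t])))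
  have b4 := l4.mul h.hom_chi.smooth (w := f₃) (fun t ht => (hB t ht).2.2)
  obtain ⟨C1, hC1, h1⟩ := b1 k
  obtain ⟨C2, hC2, h2⟩ := b2 k
  obtain ⟨C3, hC3, h3⟩ := b3 k
  obtain ⟨C4, hC4, h4⟩ := b4 k
  refine ⟨C1 + C2 + C3 + C4, by positivity, fun t ht y hy => ?_⟩
  have hy0 := ne_zero_of_mem_shell hy
  have e : sourceFamily A t =ᶠ[𝓝 y] (fun y => f₁ t * (t * tderiv A t y))
      + (fun y => (f₂ t * t ^ 2 - 4 * q) * A t y)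
      + (fun y => 4 / (t ^ 2 + 1) ^ 2 * ModelSystem.scaledLaplacian (A t) y)
      + (fun y => f₃ t * X t y) := by
    filter_upwards [isOpen_compl_singleton.mem_nhds hy0] with z hz
    simp only [sourceFamily, h.main_eq t ht.1 z hz, Pi.add_apply]
    ring
  rw [(e.iteratedFDeriv (𝕜 := ℝ) k).eq_of_nhds]
  refine (norm_iteratedFDeriv_add_four_le (g1 t ht.1 y hy0) (g2 t ht.1 y hy0) (g3 t ht.1 y hy0)
    (g4 t ht.1 y hy0)).trans ?_
  simp only [add_mul]
  exact add_le_add (add_le_add (add_le_add (h1 t ht y hy) (h2 t ht y hy))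
    (h3 t ht y hy)) (h4 t ht y hy)

end IsHomSolution

end LogBounds

/-! ### Weighted time integrals down to `t = 0`. -/

section TimeIntegral

variable {E : Type*} [NormedAddCommGroup E] [InnerProductSpace ℝ E] {F : ℝ → E → ℝ} {w : ℝ → ℝ}
  {B τ : ℝ}

lemma intervalIntegrable_one_sub_log (a b : ℝ) :
    IntervalIntegrable (fun t => 1 - Real.log t) volume a b :=
  intervalIntegrable_const.sub intervalIntegral.intervalIntegrable_log'

lemma integral_one_sub_log (τ : ℝ) : ∫ t in (0 : ℝ)..τ, (1 - Real.log t) = τ * (2 - Real.log τ) := by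
  rw [intervalIntegral.integral_sub intervalIntegrable_const
    intervalIntegral.intervalIntegrable_log', integral_log]
  simp
  ring

lemma SmoothFamily.continuousOn_iteratedFDeriv_time (hF : SmoothFamily F) (k : ℕ) {y : E}
    (hy : y ≠ 0) : ContinuousOn (fun t => _root_.iteratedFDeriv ℝ k (F t) y) (Ioi 0) :=
  fun _ ht => ((hF.iteratedFDeriv k).contDiffAt_time ht hy).continuousAt.continuousWithinAt

lemma SmoothFamily.intervalIntegrable_iteratedFDeriv (hF : SmoothFamily F) (hw : ContinuousOn w (Ioi 0))
    (hτ : τ ∈ Ioc (0 : ℝ) 1) (hB : ∀ t ∈ Ioc 0 τ, |w t| ≤ B) {k : ℕ} {C : ℝ} {y : E} (hy : y ≠ 0)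
    (hC : ∀ t ∈ Ioc (0 : ℝ) 1, ‖_root_.iteratedFDeriv ℝ k (F t) y‖ ≤ C * (1 - Real.log t)) :
    IntervalIntegrable (fun t => w t • _root_.iteratedFDeriv ℝ k (F t) y) volume 0 τ ∧
      ‖∫ t in (0 : ℝ)..τ, w t • _root_.iteratedFDeriv ℝ k (F t) y‖
        ≤ C * B * (τ * (2 - Real.log τ)) := by
  have hB0 : 0 ≤ B := (abs_nonneg _).trans (hB τ ⟨hτ.1, le_rfl⟩)
  have hle : ∀ t ∈ Ioc 0 τ, ‖w t • _root_.iteratedFDeriv ℝ k (F t) y‖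
      ≤ C * B * (1 - Real.log t) := by
    intro t ht
    rw [norm_smul, mul_comm C B, mul_assoc]
    exact mul_le_mul (hB t ht) (hC t ⟨ht.1, ht.2.trans hτ.2⟩) (norm_nonneg _) hB0
  have hint := (intervalIntegrable_one_sub_log 0 τ).const_mul (C * B)
  constructor
  · refine hint.mono_fun ?_ ?_
    · rw [uIoc_of_le hτ.1.le]
      exact ((hw.smul (hF.continuousOn_iteratedFDeriv_time k hy)).mono
        fun t ht => ht.1).aestronglyMeasurable measurableSet_Ioc
    · rw [uIoc_of_le hτ.1.le]
      refine (ae_restrict_mem measurableSet_Ioc).mono fun t ht => ?_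
      exact (hle t ht).trans (le_abs_self _)
  · refine (intervalIntegral.norm_integral_le_of_norm_le hτ.1.le (ae_of_all _ hle) hint).trans
      (le_of_eq ?_)
    rw [intervalIntegral.integral_const_mul, integral_one_sub_log]

/-- Time integrals of a family with logarithmically bounded derivatives are smooth in space. -/
lemma LogBounded.hasFTaylorSeriesUpToOn_integral (hF : SmoothFamily F) (hl : LogBounded F)
    (hw : ContinuousOn w (Ioi 0)) (hτ : τ ∈ Ioc (0 : ℝ) 1) (hB : ∀ t ∈ Ioc 0 τ, |w t| ≤ B) :
    HasFTaylorSeriesUpToOn ∞ (fun y => ∫ t in (0 : ℝ)..τ, w t * F t y)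
      (fun y k => ∫ t in (0 : ℝ)..τ, w t • iteratedFDeriv ℝ k (F t) y) (shell E) := by
  have hB0 : 0 ≤ B := (abs_nonneg _).trans (hB τ ⟨hτ.1, le_rfl⟩)
  have hint : ∀ k : ℕ, ∀ y ∈ shell E,
      IntervalIntegrable (fun t => w t • iteratedFDeriv ℝ k (F t) y) volume 0 τ := by
    intro k y hy
    obtain ⟨C, hC, h⟩ := hl k
    exact (hF.intervalIntegrable_iteratedFDeriv hw hτ hB (ne_zero_of_mem_shell hy)
      fun t ht => h t ht y hy).1
  have hder : ∀ m : ℕ, ∀ y ∈ shell E,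
      HasFDerivAt (fun y => ∫ t in (0 : ℝ)..τ, w t • iteratedFDeriv ℝ m (F t) y)
        (∫ t in (0 : ℝ)..τ, w t • iteratedFDeriv ℝ m.succ (F t) y).curryLeft y := by
    intro m y hy
    obtain ⟨C, hC, h⟩ := hl (m + 1)
    have hfd : ∀ t : ℝ, ∀ z : E, (iteratedFDeriv ℝ (m + 1) (F t) z).curryLeft
        = fderiv ℝ (iteratedFDeriv ℝ m (F t)) z := fun t z => by
      rw [fderiv_iteratedFDeriv]; rfl
    -- Currying is a continuous linear map, so it passes through the integral.
    have hcurry : ∫ t in (0 : ℝ)..τ, w t • fderiv ℝ (iteratedFDeriv ℝ m (F t)) y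
        = (∫ t in (0 : ℝ)..τ, w t • iteratedFDeriv ℝ m.succ (F t) y).curryLeft := by
      obtain ⟨L, hL⟩ : ∃ L : (E [×(m + 1)]→L[ℝ] ℝ) →L[ℝ] (E →L[ℝ] (E [×m]→L[ℝ] ℝ)),
          ∀ f, L f = f.curryLeft :=
        ⟨(continuousMultilinearCurryLeftEquiv ℝ (fun _ : Fin (m + 1) => E)
          ℝ).toContinuousLinearEquiv.toContinuousLinearMap, fun _ => rfl⟩
      have := ContinuousLinearMap.intervalIntegral_comp_comm (𝕜 := ℝ) (E := E [×(m + 1)]→L[ℝ] ℝ)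
        (F := E →L[ℝ] (E [×m]→L[ℝ] ℝ)) L (hint (m + 1) y hy)
      rw [hL] at this
      refine Eq.trans ?_ this
      refine intervalIntegral.integral_congr fun t _ => ?_
      simp only [hL, ← hfd]
      rfl
    rw [← hcurry]
    -- The dominating function `C B (1 - log t)` is uniform over the open shell and integrable at 0.
    refine intervalIntegral.hasFDerivAt_integral_of_dominated_of_fderiv_le
      (F := fun z t => w t • iteratedFDeriv ℝ m (F t) z)
      (F' := fun z t => w t • fderiv ℝ (iteratedFDeriv ℝ m (F t)) z)
      (bound := fun t => C * B * (1 - Real.log t))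
      (isOpen_shell.mem_nhds hy) ?_ (hint m y hy) ?_ ?_
      ((intervalIntegrable_one_sub_log 0 τ).const_mul _) ?_
    · filter_upwards [isOpen_shell.mem_nhds hy] with z hz
      exact ((intervalIntegrable_iff).1 (hint m z hz)).aestronglyMeasurable
    · rw [uIoc_of_le hτ.1.le]
      refine (ContinuousOn.smul hw ?_ |>.mono fun t ht => ht.1).aestronglyMeasurable
        measurableSet_Ioc
      intro t ht
      exact ((hF.iteratedFDeriv m).fderiv.contDiffAt_time ht
        (ne_zero_of_mem_shell hy)).continuousAt.continuousWithinAt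
    · refine ae_of_all _ fun t ht z hz => ?_
      rw [uIoc_of_le hτ.1.le] at ht
      rw [norm_smul, norm_fderiv_iteratedFDeriv, mul_comm C B, mul_assoc]
      exact mul_le_mul (hB t ht) (h t ⟨ht.1, ht.2.trans hτ.2⟩ z hz) (norm_nonneg _) hB0
    · refine ae_of_all _ fun t ht z hz => ?_
      rw [uIoc_of_le hτ.1.le] at ht
      exact ((((hF.iteratedFDeriv m).contDiffAt_space ht.1
        (ne_zero_of_mem_shell hz)).differentiableAt (by simp)).hasFDerivAt).const_smul (w t)
  refine ⟨fun y hy => ?_, fun m _ y hy => (hder m y hy).hasFDerivWithinAt,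
    fun m _ y hy => (hder m y hy).continuousAt.continuousWithinAt⟩
  have := (continuousMultilinearCurryFin0 ℝ E ℝ).toContinuousLinearEquiv.toContinuousLinearMap.intervalIntegral_comp_comm
    (hint 0 y hy)
  refine this.symm.trans (intervalIntegral.integral_congr fun t _ => ?_)
  simp

lemma LogBounded.contDiffOn_integral (hF : SmoothFamily F) (hl : LogBounded F)
    (hw : ContinuousOn w (Ioi 0)) (hτ : τ ∈ Ioc (0 : ℝ) 1) (hB : ∀ t ∈ Ioc 0 τ, |w t| ≤ B) :
    ContDiffOn ℝ ∞ (fun y => ∫ t in (0 : ℝ)..τ, w t * F t y) (shell E) :=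
  (hl.hasFTaylorSeriesUpToOn_integral hF hw hτ hB).contDiffOn

/-- The constant precedes `τ`, `B` and `w`, so the weight may depend on `τ`, as `log τ - log t` and
`t/τ` do. -/
lemma LogBounded.exists_norm_iteratedFDeriv_integral_le (hF : SmoothFamily F) (hl : LogBounded F)
    (k : ℕ) : ∃ C, 0 ≤ C ∧ ∀ τ ∈ Ioc (0 : ℝ) 1, ∀ (B : ℝ) (w : ℝ → ℝ), ContinuousOn w (Ioi 0) →
      (∀ t ∈ Ioc 0 τ, |w t| ≤ B) → ∀ y ∈ shell E,
      ‖iteratedFDeriv ℝ k (fun y => ∫ t in (0 : ℝ)..τ, w t * F t y) y‖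
        ≤ C * B * (τ * (2 - Real.log τ)) := by
  obtain ⟨C, hC, h⟩ := hl k
  refine ⟨C, hC, fun τ hτ B w hw hB y hy => ?_⟩
  rw [← iteratedFDerivWithin_of_isOpen k isOpen_shell hy,
    ← (hl.hasFTaylorSeriesUpToOn_integral hF hw hτ hB).eq_iteratedFDerivWithin_of_uniqueDiffOn
      (by exact_mod_cast le_top) isOpen_shell.uniqueDiffOn hy]
  exact (hF.intervalIntegrable_iteratedFDeriv hw hτ hB (ne_zero_of_mem_shell hy)
      fun t ht => h t ht y hy).2

lemma LogBounded.intervalIntegrable (hF : SmoothFamily F) (hl : LogBounded F)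
    (hw : ContinuousOn w (Ioi 0)) (hB : ∀ t ∈ Ioc 0 1, |w t| ≤ B) {y : E} (hy : y ∈ shell E)
    (hτ : 0 < τ) : IntervalIntegrable (fun t => w t * F t y) volume 0 τ := by
  have hy0 := ne_zero_of_mem_shell hy
  have hc : ContinuousOn (fun t => w t * F t y) (Ioi 0) := hw.mul fun t ht =>
    (hF.contDiffAt_time ht hy0).continuousAt.continuousWithinAt
  obtain ⟨C, hC, h⟩ := hl 0
  have h1 := ((hF.intervalIntegrable_iteratedFDeriv hw (τ := 1) ⟨one_pos, le_rfl⟩ hB hy0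
      fun t ht => h t ht y hy).1)
  have h1' : IntervalIntegrable (fun t => w t * F t y) volume 0 1 := by
    refine h1.mono_fun ?_ (ae_of_all _ fun t => ?_)
    · rw [uIoc_of_le zero_le_one]
      exact (hc.mono fun t ht => ht.1).aestronglyMeasurable measurableSet_Ioc
    · simp only [norm_smul, norm_iteratedFDeriv_zero, norm_mul, le_refl]
  -- The bounds stop at time 1; between 1 and `τ` the integrand is continuous.
  refine h1'.trans (ContinuousOn.intervalIntegrable (hc.mono fun t ht => ?_))
  exact lt_of_lt_of_le (lt_min one_pos hτ) ht.1

end TimeIntegral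

/-! ### Passage between the sphere and the punctured space. -/

section Transfer

variable {n : ℕ}

lemma radialExt_apply (f : Sph n → ℝ) {y : EuclideanSpace ℝ (Fin (n + 1))} (hy : y ≠ 0) :
    radialExt f y = f ⟨‖y‖⁻¹ • y, by simp [norm_smul, hy]⟩ := dif_pos hy

lemma norm_coe_sph (x : Sph n) : ‖(x : EuclideanSpace ℝ (Fin (n + 1)))‖ = 1 :=
  norm_eq_of_mem_sphere x

lemma coe_sph_ne_zero (x : Sph n) : (x : EuclideanSpace ℝ (Fin (n + 1))) ≠ 0 := by
  intro h
  have := norm_coe_sph x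
  simp [h] at this

@[simp] lemma radialExt_coe (f : Sph n → ℝ) (x : Sph n) :
    radialExt f (x : EuclideanSpace ℝ (Fin (n + 1))) = f x := by
  rw [radialExt_apply f (coe_sph_ne_zero x)]
  congr
  ext1
  simp [norm_coe_sph x]

lemma coe_mem_shell (x : Sph n) :
    (x : EuclideanSpace ℝ (Fin (n + 1))) ∈ shell (EuclideanSpace ℝ (Fin (n + 1))) :=
  mem_shell_of_norm_eq_one (norm_coe_sph x)

lemma radialExt_smul (f : Sph n → ℝ) {c : ℝ} (hc : 0 < c) (y : EuclideanSpace ℝ (Fin (n + 1))) :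
    radialExt f (c • y) = radialExt f y := by
  rcases eq_or_ne y 0 with rfl | hy
  · simp
  · rw [radialExt_apply f hy, radialExt_apply f (smul_ne_zero hc.ne' hy)]
    congr 2
    rw [norm_smul, Real.norm_of_nonneg hc.le, smul_smul]
    congr 1
    field_simp

lemma radialExt_eq_of_hom {u : EuclideanSpace ℝ (Fin (n + 1)) → ℝ}
    (hu : ∀ c : ℝ, 0 < c → ∀ y, u (c • y) = u y) {f : Sph n → ℝ} (hf : ∀ x, f x = u x)
    {y : EuclideanSpace ℝ (Fin (n + 1))} (hy : y ≠ 0) : radialExt f y = u y := by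
  rw [radialExt_apply f hy, hf, hu _ (by positivity)]

lemma contMDiff_coe_sph : ContMDiff (𝓡 n) 𝓘(ℝ, EuclideanSpace ℝ (Fin (n + 1))) ∞
    ((↑) : Sph n → EuclideanSpace ℝ (Fin (n + 1))) := by
  have : Fact (Module.finrank ℝ (EuclideanSpace ℝ (Fin (n + 1))) = n + 1) :=
    ⟨finrank_euclideanSpace_fin⟩
  exact contMDiff_coe_sphere

lemma contMDiff_codRestrict_sph {g : EuclideanSpace ℝ (Fin (n + 1)) → EuclideanSpace ℝ (Fin (n + 1))}
    (hg : ContDiff ℝ ∞ g) (hg' : ∀ y, g y ∈ Metric.sphere (0 : EuclideanSpace ℝ (Fin (n + 1))) 1) :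
    ContMDiff 𝓘(ℝ, EuclideanSpace ℝ (Fin (n + 1))) (𝓡 n) ∞
      (Set.codRestrict g (Metric.sphere 0 1) hg' : EuclideanSpace ℝ (Fin (n + 1)) → Sph n) := by
  have : Fact (Module.finrank ℝ (EuclideanSpace ℝ (Fin (n + 1))) = n + 1) :=
    ⟨finrank_euclideanSpace_fin⟩
  exact hg.contMDiff.codRestrict_sphere hg'

/-- A globally smooth substitute for `y ↦ y / |y|` near `y₀`. Through it, smoothness on the sphere
passes to the radial extension. -/
lemma exists_contMDiff_direction {y₀ : EuclideanSpace ℝ (Fin (n + 1))} (hy₀ : y₀ ≠ 0) :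
    ∃ σ : EuclideanSpace ℝ (Fin (n + 1)) → Sph n,
      ContMDiff 𝓘(ℝ, EuclideanSpace ℝ (Fin (n + 1))) (𝓡 n) ∞ σ ∧
      ∀ᶠ y in 𝓝 y₀, ∀ f : Sph n → ℝ, radialExt f y = f (σ y) := by
  have hn : 0 < ‖y₀‖ := norm_pos_iff.2 hy₀
  let φ : ContDiffBump y₀ := ⟨‖y₀‖ / 4, ‖y₀‖ / 2, by positivity, by linarith⟩
  -- `g` is the identity near `y₀` and stays within `‖y₀‖/2` of `y₀`, so it never vanishes and can
  -- be normalized everywhere.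
  set g : EuclideanSpace ℝ (Fin (n + 1)) → EuclideanSpace ℝ (Fin (n + 1)) :=
    fun y => y₀ + φ y • (y - y₀) with hg
  have hg0 : ∀ y, g y ≠ 0 := by
    intro y h
    have h1 : ‖φ y • (y - y₀)‖ ≤ ‖y₀‖ / 2 := by
      by_cases hy : ‖y₀‖ / 2 ≤ dist y y₀
      · rw [φ.zero_of_le_dist hy, zero_smul, norm_zero]
        positivity
      · rw [norm_smul, ← dist_eq_norm, Real.norm_of_nonneg φ.nonneg]
        have := φ.le_one (x := y)
        have h0 := φ.nonneg (x := y)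
        nlinarith [dist_nonneg (x := y) (y := y₀)]
    have h2 : y₀ = -(φ y • (y - y₀)) := eq_neg_of_add_eq_zero_left h
    have h3 : ‖y₀‖ = ‖φ y • (y - y₀)‖ := by
      conv_lhs => rw [h2, norm_neg]
    linarith
  have hgd : ContDiff ℝ ∞ g := contDiff_const.add (φ.contDiff.smul (contDiff_id.sub contDiff_const))
  have hσd : ContDiff ℝ ∞ (fun y => ‖g y‖⁻¹ • g y) :=
    ((hgd.norm ℝ hg0).inv fun y => norm_ne_zero_iff.2 (hg0 y)).smul hgd
  have hσm : ∀ y, ‖g y‖⁻¹ • g y ∈ Metric.sphere (0 : EuclideanSpace ℝ (Fin (n + 1))) 1 := by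
    intro y
    simp [norm_smul, hg0 y]
  refine ⟨_, contMDiff_codRestrict_sph hσd hσm, ?_⟩
  filter_upwards [φ.eventuallyEq_one, isOpen_compl_singleton.mem_nhds hy₀] with y hy hy0 f
  rw [radialExt_apply f hy0]
  congr 1
  ext1
  have : g y = y := by simp [hg, hy]
  simp [this]

lemma SmoothOnPos.homFamily {α : ℝ → Sph n → ℝ} (hα : SmoothOnPos α) :
    HomFamily (fun t => radialExt (α t)) where
  smooth := by
    rintro ⟨t, y⟩ ⟨ht, hy⟩
    obtain ⟨σ, hσ, hσe⟩ := exists_contMDiff_direction hy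
    have h1 : ContMDiff 𝓘(ℝ, ℝ × EuclideanSpace ℝ (Fin (n + 1))) (𝓘(ℝ, ℝ).prod (𝓡 n)) ∞
        (fun p : ℝ × EuclideanSpace ℝ (Fin (n + 1)) => (p.1, σ p.2)) :=
      contDiff_fst.contMDiff.prodMk (hσ.comp contDiff_snd.contMDiff)
    have h2 : ContMDiffAt (𝓘(ℝ, ℝ).prod (𝓡 n)) 𝓘(ℝ, ℝ) ∞ (Function.uncurry α) (t, σ y) :=
      ContMDiffOn.contMDiffAt hα ((isOpen_Ioi.prod isOpen_univ).mem_nhds ⟨ht, mem_univ _⟩)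
    have h3 := (h2.comp (t, y) h1.contMDiffAt).contDiffAt
    refine (h3.congr_of_eventuallyEq ?_).contDiffWithinAt
    have h4 : Tendsto (fun p : ℝ × EuclideanSpace ℝ (Fin (n + 1)) => p.2) (𝓝 (t, y)) (𝓝 y) :=
      continuous_snd.continuousAt
    filter_upwards [h4.eventually hσe] with p hp using hp (α p.1)
  hom t _ c hc y := radialExt_smul (α t) hc y

lemma smooth_of_contDiffOn_shell {f : Sph n → ℝ} {u : EuclideanSpace ℝ (Fin (n + 1)) → ℝ}
    (hu : ContDiffOn ℝ ∞ u (shell _)) (hf : ∀ x : Sph n, f x = u x) : Smooth f := by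
  have h : f = u ∘ ((↑) : Sph n → EuclideanSpace ℝ (Fin (n + 1))) := funext hf
  rw [h]
  intro x
  exact ((hu.contDiffAt (isOpen_shell.mem_nhds (coe_mem_shell x))).contMDiffAt).comp x
    contMDiff_coe_sph.contMDiffAt

lemma tderiv_radialExt (α : ℝ → Sph n → ℝ) (t : ℝ) {y : EuclideanSpace ℝ (Fin (n + 1))}
    (hy : y ≠ 0) : tderiv (fun t => radialExt (α t)) t y = radialExt (dtau α t) y := by
  simp only [tderiv, radialExt_apply _ hy, dtau]

/-- Both sides are constant along rays and agree on the unit sphere, where `‖y‖ ^ 2 = 1`. -/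
lemma scaledLaplacian_radialExt {f : Sph n → ℝ} (hf : HomSmooth (radialExt f))
    {y : EuclideanSpace ℝ (Fin (n + 1))} (hy : y ≠ 0) :
    scaledLaplacian (radialExt f) y = radialExt (sphLaplacian f) y := by
  refine (radialExt_eq_of_hom hf.scaledLaplacian.hom (fun x => ?_) hy).symm
  simp [scaledLaplacian, sphLaplacian]

variable {q : ℝ} {f₁ f₂ f₃ : ℝ → ℝ} {α χ : ℝ → Sph n → ℝ}

lemma IsSmoothSolution.isHomSolution (h : IsSmoothSolution q f₁ f₂ f₃ α χ) :
    IsHomSolution q f₁ f₂ f₃ (fun t => radialExt (α t)) (fun t => radialExt (χ t)) where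
  hom_alpha := h.smooth_alpha.homFamily
  hom_chi := h.smooth_chi.homFamily
  main_eq t ht y hy := by
    have e : tderiv (tderiv fun t => radialExt (α t)) t y = radialExt (dtau (dtau α) t) y := by
      rw [← tderiv_radialExt _ _ hy]
      simp only [tderiv, radialExt_apply _ hy, dtau]
    have := h.main_eq t ht ⟨‖y‖⁻¹ • y, by simp [norm_smul, hy]⟩
    rw [e, tderiv_radialExt _ _ hy,
      scaledLaplacian_radialExt (h.smooth_alpha.homFamily.homSmooth ht) hy]
    simp only [radialExt_apply _ hy]
    linarith
  chi_eq t ht y hy := by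
    rw [tderiv_radialExt _ _ hy]
    simp only [radialExt_apply _ hy]
    exact h.chi_eq t ht _

end Transfer

/-! ### Curves in `C^∞(S^n)`. -/

section Curves

variable {E : Type*} [NormedAddCommGroup E] [InnerProductSpace ℝ E] {H : ℝ → E → ℝ} {τ₀ : ℝ}

lemma SmoothFamily.tendstoUniformlyOn_iteratedFDeriv [FiniteDimensional ℝ E] (hH : SmoothFamily H)
    (hτ₀ : 0 < τ₀) (k : ℕ) :
    TendstoUniformlyOn (fun τ y => _root_.iteratedFDeriv ℝ k (H τ) y)
      (fun y => _root_.iteratedFDeriv ℝ k (H τ₀) y) (𝓝 τ₀) (Metric.sphere (0 : E) 1) := by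
  have : ProperSpace E := FiniteDimensional.proper_real E
  rw [tendstoUniformlyOn_iff_tendstoUniformly_comp_coe]
  refine ContinuousOn.tendstoUniformly
    (f := fun τ (y : Metric.sphere (0 : E) 1) => _root_.iteratedFDeriv ℝ k (H τ) (y : E))
    (Ioi_mem_nhds hτ₀) ?_
  refine (hH.iteratedFDeriv k).continuousOn.comp (t := Ioi (0 : ℝ) ×ˢ ({0}ᶜ : Set E))
    (f := fun p : ℝ × Metric.sphere (0 : E) 1 => (p.1, (p.2 : E))) (by fun_prop) ?_
  rintro ⟨τ, y⟩ ⟨hτ, -⟩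
  exact ⟨hτ, ne_zero_of_mem_unit_sphere y⟩

lemma SmoothFamily.tendstoUniformlyOn_iteratedFDeriv_slope [FiniteDimensional ℝ E]
    (hH : SmoothFamily H) (hτ₀ : 0 < τ₀) (k : ℕ) :
    TendstoUniformlyOn
      (fun τ y => _root_.iteratedFDeriv ℝ k (fun z => slope (fun s => H s z) τ₀ τ) y)
      (fun y => _root_.iteratedFDeriv ℝ k (ModelSystem.tderiv H τ₀) y) (𝓝[≠] τ₀)
      (Metric.sphere (0 : E) 1) := by
  rw [Metric.tendstoUniformlyOn_iff]
  intro ε hε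
  have h1 := Metric.tendstoUniformlyOn_iff.1
    (hH.tderiv.tendstoUniformlyOn_iteratedFDeriv hτ₀ k) (ε / 2) (half_pos hε)
  obtain ⟨δ, hδ, hball⟩ := Metric.eventually_nhds_iff_ball.1 (h1.and (lt_mem_nhds hτ₀))
  filter_upwards [mem_nhdsWithin_of_mem_nhds (Metric.ball_mem_nhds τ₀ hδ), self_mem_nhdsWithin]
    with τ hτ hne y hy
  have hy0 : y ≠ 0 := ne_zero_of_mem_unit_sphere ⟨y, hy⟩
  set D := _root_.iteratedFDeriv ℝ k (ModelSystem.tderiv H τ₀) y with hD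
  -- The mean value inequality for `s ↦ D^k H(s) - s D` makes the convergence of difference
  -- quotients uniform in `y`, because that of the time derivative is.
  have hmv := (convex_ball τ₀ δ).norm_image_sub_le_of_norm_hasDerivWithin_le
    (f := fun s => _root_.iteratedFDeriv ℝ k (H s) y - s • D)
    (f' := fun s => _root_.iteratedFDeriv ℝ k (ModelSystem.tderiv H s) y - (1 : ℝ) • D)
    (C := ε / 2)
    (fun s hs => ((hH.hasDerivAt_iteratedFDeriv k (hball s hs).2 hy0).fun_sub
      ((hasDerivAt_id s).smul_const D)).hasDerivWithinAt)
    (fun s hs => by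
      have := (hball s hs).1 y hy
      rw [dist_comm, dist_eq_norm] at this
      rw [one_smul]
      exact this.le)
    (Metric.mem_ball_self hδ) hτ
  have hsub : τ - τ₀ ≠ 0 := sub_ne_zero.2 hne
  have cτ := (hH.contDiffAt_space (hball τ hτ).2 hy0).of_le (m := k) (by exact_mod_cast le_top)
  have c0 := (hH.contDiffAt_space hτ₀ hy0).of_le (m := k) (by exact_mod_cast le_top)
  have hfun : (fun z => slope (fun s => H s z) τ₀ τ) = (τ - τ₀)⁻¹ • (H τ - H τ₀) := by
    ext z; simp [slope_def_module]
  have hsl : _root_.iteratedFDeriv ℝ k (fun z => slope (fun s => H s z) τ₀ τ) y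
      = (τ - τ₀)⁻¹ • (_root_.iteratedFDeriv ℝ k (H τ) y - _root_.iteratedFDeriv ℝ k (H τ₀) y) := by
    have cs : ContDiffAt ℝ k (H τ - H τ₀) y := cτ.sub c0
    rw [hfun, iteratedFDeriv_const_smul_apply cs, iteratedFDeriv_sub_apply cτ c0]
  rw [dist_comm, dist_eq_norm, hsl]
  have hid : (τ - τ₀)⁻¹ • (_root_.iteratedFDeriv ℝ k (H τ) y - _root_.iteratedFDeriv ℝ k (H τ₀) y) - D
      = (τ - τ₀)⁻¹ • ((_root_.iteratedFDeriv ℝ k (H τ) y - τ • D)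
        - (_root_.iteratedFDeriv ℝ k (H τ₀) y - τ₀ • D)) := by
    have : D = (τ - τ₀)⁻¹ • ((τ - τ₀) • D) := by rw [smul_smul, inv_mul_cancel₀ hsub, one_smul]
    conv_lhs => rw [this]
    rw [← smul_sub, sub_smul]
    congr 1
    abel
  rw [hid, norm_smul, norm_inv]
  have hpos : 0 < ‖τ - τ₀‖ := norm_pos_iff.2 hsub
  calc ‖τ - τ₀‖⁻¹ * _ ≤ ‖τ - τ₀‖⁻¹ * (ε / 2 * ‖τ - τ₀‖) := by gcongr
    _ = ε / 2 := by field_simp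
    _ < ε := half_lt_self hε

lemma HomSmooth.homFamily {u : E → ℝ} (hu : HomSmooth u) : HomFamily (fun _ : ℝ => u) where
  smooth := hu.smooth.comp contDiffOn_snd fun _ hp => hp.2
  hom _ _ := hu.hom

variable {n : ℕ}

lemma radialExt_zero (f : Sph n → ℝ) : radialExt f 0 = 0 := by simp [radialExt]

lemma Smooth.homSmooth {f : Sph n → ℝ} (hf : Smooth f) : HomSmooth (radialExt f) where
  smooth y hy := by
    obtain ⟨σ, hσ, hσe⟩ := exists_contMDiff_direction hy
    refine ContDiffAt.contDiffWithinAt ?_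
    have h : ContDiffAt ℝ ∞ (f ∘ σ) y := (ContMDiff.comp hf hσ).contMDiffAt.contDiffAt
    exact h.congr_of_eventuallyEq (hσe.mono fun z hz => hz f)
  hom _ hc y := radialExt_smul f hc y

lemma HomSmooth.smooth_sph {f : Sph n → ℝ} (hf : HomSmooth (radialExt f)) : Smooth f :=
  smooth_of_contDiffOn_shell (hf.smooth.mono fun _ hy => ne_zero_of_mem_shell hy)
    fun x => (radialExt_coe f x).symm

lemma HomFamily.dtau {α : ℝ → Sph n → ℝ} (hα : HomFamily fun t => radialExt (α t)) :
    HomFamily fun t => radialExt (dtau α t) := by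
  have h : (fun t => radialExt (ModelSystem.dtau α t)) = ModelSystem.tderiv fun t => radialExt (α t) := by
    ext t y
    rcases eq_or_ne y 0 with rfl | hy
    · simp [radialExt_zero, ModelSystem.tderiv]
    · rw [tderiv_radialExt _ _ hy]
  rw [h]
  exact hα.tderiv

lemma radialExt_slope (G : ℝ → Sph n → ℝ) (a b : ℝ) :
    radialExt (slope G a b) = fun z => slope (fun s => radialExt (G s) z) a b := by
  ext z
  rcases eq_or_ne z 0 with rfl | hz
  · simp [radialExt_zero, slope_def_module]
  · simp [radialExt_apply _ hz, slope_def_module]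

lemma tendsto_mul_two_sub_log : Tendsto (fun τ : ℝ => τ * (2 - Real.log τ)) (𝓝 0) (𝓝 0) := by
  have h : Continuous fun τ : ℝ => 2 * τ - τ * Real.log τ :=
    (continuous_const.mul continuous_id).sub Real.continuous_mul_log
  have := h.tendsto 0
  simp only [mul_zero, zero_mul, sub_zero] at this
  exact this.congr fun τ => by ring

lemma tendstoUniformlyOn_of_norm_le {ι V : Type*} [NormedAddCommGroup V] {l : Filter ι}
    {F : ι → EuclideanSpace ℝ (Fin (n + 1)) → V} {f : EuclideanSpace ℝ (Fin (n + 1)) → V}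
    {b : ι → ℝ} (hb : Tendsto b l (𝓝 0))
    (h : ∀ᶠ i in l, ∀ x : Sph n, ‖F i x - f x‖ ≤ b i) :
    TendstoUniformlyOn F f l (Metric.sphere 0 1) := by
  rw [Metric.tendstoUniformlyOn_iff]
  intro ε hε
  filter_upwards [h, hb.eventually (gt_mem_nhds hε)] with i hi hi' y hy
  rw [dist_comm, dist_eq_norm]
  exact (hi ⟨y, hy⟩).trans_lt hi'

lemma eventually_pos_nhdsWithin_Ici_diff :
    ∀ᶠ τ in 𝓝[Ici (0 : ℝ) \ {0}] 0, τ ∈ Ioc (0 : ℝ) 1 := by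
  filter_upwards [self_mem_nhdsWithin, mem_nhdsWithin_of_mem_nhds (Iic_mem_nhds zero_lt_one)]
    with τ hτ hτ1
  exact ⟨lt_of_le_of_ne hτ.1 (Ne.symm hτ.2), hτ1⟩

-- At positive times joint smoothness and compactness of the sphere suffice. At 0 the bounds `hs`
-- and `hd` send difference quotients and time derivatives to 0, so the derivative there is 0;
-- convergence of the values is `hs` multiplied by `τ`.
open Classical in
lemma HomFamily.isC1Curve {α : ℝ → Sph n → ℝ} (hα : HomFamily fun t => radialExt (α t))
    {g : Sph n → ℝ} (hg : Smooth g)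
    (hs : ∀ k : ℕ, ∃ C, ∀ τ ∈ Ioc (0 : ℝ) 1, ∀ x : Sph n,
      ‖iteratedFDeriv ℝ k (radialExt fun x => (α τ x - g x) / τ)
        (x : EuclideanSpace ℝ (Fin (n + 1)))‖ ≤ C * (τ * (2 - Real.log τ)))
    (hd : ∀ k : ℕ, ∃ C, ∀ τ ∈ Ioc (0 : ℝ) 1, ∀ x : Sph n,
      ‖iteratedFDeriv ℝ k (radialExt (ModelSystem.dtau α τ))
        (x : EuclideanSpace ℝ (Fin (n + 1)))‖ ≤ C * (τ * (2 - Real.log τ))) :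
    IsC1Curve (fun τ => if 0 < τ then α τ else g) := by
  refine ⟨fun τ => if 0 < τ then ModelSystem.dtau α τ else fun _ => 0, fun τ₀ hτ₀ => ?_⟩
  have hzero : radialExt (fun _ : Sph n => (0 : ℝ)) = fun _ => 0 := by
    ext y; simp [radialExt]
  rcases eq_or_lt_of_le (mem_Ici.1 hτ₀) with h0 | h0
  · rw [← h0]
    simp only [lt_irrefl, if_false]
    refine ⟨hg, contMDiff_const, fun k => ?_, fun k => ?_, fun k => ?_⟩
    · obtain ⟨C, hC⟩ := hs k
      refine tendstoUniformlyOn_of_norm_le (b := fun τ => |τ * (C * (τ * (2 - Real.log τ)))|) ?_ ?_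
      · have : Tendsto (fun τ : ℝ => τ * (C * (τ * (2 - Real.log τ)))) (𝓝 0) (𝓝 (0 * (C * 0))) :=
          tendsto_id.mul (tendsto_mul_two_sub_log.const_mul C)
        simpa using (this.mono_left (nhdsWithin_le_nhds (s := Ici 0))).abs
      · filter_upwards [self_mem_nhdsWithin, mem_nhdsWithin_of_mem_nhds (Iic_mem_nhds zero_lt_one)]
          with τ hτ hτ1 x
        rcases eq_or_lt_of_le (mem_Ici.1 hτ) with h | h
        · simp [← h]
        · rw [if_pos h]
          have hx := coe_sph_ne_zero x
          have cα := ((hα.homSmooth h).contDiffAt hx).of_le (m := k) (by exact_mod_cast le_top)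
          have cg := ((hg.homSmooth).contDiffAt hx).of_le (m := k) (by exact_mod_cast le_top)
          have e : (radialExt fun x => (α τ x - g x) / τ)
              = τ⁻¹ • (radialExt (α τ) - radialExt g) := by
            ext z
            rcases eq_or_ne z 0 with rfl | hz
            · simp [radialExt_zero]
            · simp [radialExt_apply _ hz, div_eq_inv_mul]
          have hb := hC τ ⟨h, hτ1⟩ x
          have cs : ContDiffAt ℝ k (radialExt (α τ) - radialExt g) (x : EuclideanSpace ℝ _) :=
            cα.sub cg
          rw [e, iteratedFDeriv_const_smul_apply cs, iteratedFDeriv_sub_apply cα cg, norm_smul,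
            norm_inv, Real.norm_of_nonneg h.le, inv_mul_le_iff₀ h] at hb
          exact hb.trans (le_abs_self _)
    · obtain ⟨C, hC⟩ := hd k
      refine tendstoUniformlyOn_of_norm_le (b := fun τ => |C * (τ * (2 - Real.log τ))|) ?_ ?_
      · simpa using ((tendsto_mul_two_sub_log.const_mul C).mono_left
          (nhdsWithin_le_nhds (s := Ici 0))).abs
      · filter_upwards [self_mem_nhdsWithin, mem_nhdsWithin_of_mem_nhds (Iic_mem_nhds zero_lt_one)]
          with τ hτ hτ1 x
        rcases eq_or_lt_of_le (mem_Ici.1 hτ) with h | h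
        · simp [← h]
        · rw [if_pos h, hzero]
          have e0 : iteratedFDeriv ℝ k (fun _ : EuclideanSpace ℝ (Fin (n + 1)) => (0 : ℝ))
              (x : EuclideanSpace ℝ (Fin (n + 1))) = 0 := by
            simp
          rw [e0, sub_zero]
          exact (hC τ ⟨h, hτ1⟩ x).trans (le_abs_self _)
    · obtain ⟨C, hC⟩ := hs k
      refine tendstoUniformlyOn_of_norm_le (b := fun τ => C * (τ * (2 - Real.log τ))) ?_ ?_
      · simpa using ((tendsto_mul_two_sub_log.const_mul C).mono_left
          (nhdsWithin_le_nhds (s := Ici 0 \ {0})))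
      · filter_upwards [eventually_pos_nhdsWithin_Ici_diff] with τ hτ x
        have e0 : iteratedFDeriv ℝ k (fun _ : EuclideanSpace ℝ (Fin (n + 1)) => (0 : ℝ))
            (x : EuclideanSpace ℝ (Fin (n + 1))) = 0 := by
          simp
        rw [hzero, e0, sub_zero]
        have e : slope (fun τ => if 0 < τ then α τ else g) 0 τ = fun x => (α τ x - g x) / τ := by
          ext z
          simp [slope_def_module, hτ.1, div_eq_inv_mul]
        rw [e]
        exact hC τ hτ x
  · simp only [h0, if_true]
    have hpos : ∀ᶠ τ in 𝓝 τ₀, 0 < τ := lt_mem_nhds h0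
    refine ⟨(hα.homSmooth h0).smooth_sph, (hα.dtau.homSmooth h0).smooth_sph, fun k => ?_,
      fun k => ?_, fun k => ?_⟩
    · have h1 : TendstoUniformlyOn
          (fun τ y => iteratedFDeriv ℝ k (radialExt (if 0 < τ then α τ else g)) y)
          (fun y => iteratedFDeriv ℝ k (radialExt (α τ₀)) y) (𝓝 τ₀) (Metric.sphere 0 1) := by
        refine (hα.smooth.tendstoUniformlyOn_iteratedFDeriv h0 k).congr ?_
        filter_upwards [hpos] with τ hτ y _
        simp only [if_pos hτ]
      exact fun u hu => (h1 u hu).filter_mono nhdsWithin_le_nhds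
    · have h1 : TendstoUniformlyOn
          (fun τ y => iteratedFDeriv ℝ k
            (radialExt (if 0 < τ then ModelSystem.dtau α τ else fun _ => 0)) y)
          (fun y => iteratedFDeriv ℝ k (radialExt (ModelSystem.dtau α τ₀)) y) (𝓝 τ₀)
          (Metric.sphere 0 1) := by
        refine (hα.dtau.smooth.tendstoUniformlyOn_iteratedFDeriv h0 k).congr ?_
        filter_upwards [hpos] with τ hτ y _
        simp only [if_pos hτ]
      exact fun u hu => (h1 u hu).filter_mono nhdsWithin_le_nhds
    · have h1 := hα.smooth.tendstoUniformlyOn_iteratedFDeriv_slope h0 k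
      have h2 : TendstoUniformlyOn
          (fun τ y => iteratedFDeriv ℝ k (radialExt (slope (fun τ => if 0 < τ then α τ else g) τ₀ τ)) y)
          (fun y => iteratedFDeriv ℝ k (ModelSystem.tderiv (fun t => radialExt (α t)) τ₀) y) (𝓝[≠] τ₀)
          (Metric.sphere 0 1) := by
        refine h1.congr ?_
        filter_upwards [mem_nhdsWithin_of_mem_nhds hpos] with τ hτ y _
        have e : slope (fun τ => if 0 < τ then α τ else g) τ₀ τ = slope α τ₀ τ := by
          have : (0 : ℝ) < τ := hτ
          simp [slope_def_module, this, h0]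
        simp only [e, radialExt_slope]
      refine TendstoUniformlyOn.congr_right
        (fun u hu => (h2 u hu).filter_mono (nhdsWithin_mono _ fun τ hτ => hτ.2)) fun y hy => ?_
      have hy0 : y ≠ 0 := ne_zero_of_mem_unit_sphere ⟨y, hy⟩
      have e : ModelSystem.tderiv (fun t => radialExt (α t)) τ₀ =ᶠ[𝓝 y] radialExt (ModelSystem.dtau α τ₀) := by
        filter_upwards [isOpen_compl_singleton.mem_nhds hy0] with z hz
          using tderiv_radialExt α τ₀ hz
      exact (e.iteratedFDeriv (𝕜 := ℝ) k).eq_of_nhds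

end Curves

/-! ### The scalar equation `(t a')' = t F`, solved by variation of constants. -/

section Representation

variable {a a' F : ℝ → ℝ} {τ s : ℝ}

lemma uIcc_subset_Ioi (hτ : 0 < τ) (hs : 0 < s) : uIcc τ s ⊆ Ioi 0 :=
  fun _ ht => (lt_min hτ hs).trans_le ht.1

lemma intervalIntegrable_of_continuousOn_Ioi {g : ℝ → ℝ} (hg : ContinuousOn g (Ioi 0))
    (hτ : 0 < τ) (hs : 0 < s) : IntervalIntegrable g volume τ s :=
  (hg.mono (uIcc_subset_Ioi hτ hs)).intervalIntegrable

lemma continuousOn_log_Ioi : ContinuousOn Real.log (Ioi 0) :=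
  Real.continuousOn_log.mono fun _ h => ne_of_gt h

lemma integral_mul_eq_of_hasDerivAt (ha' : ∀ t, 0 < t → HasDerivAt (fun t => t * a' t) (t * F t) t)
    (hF : ContinuousOn F (Ioi 0)) (hτ : 0 < τ) (hs : 0 < s) :
    ∫ t in τ..s, t * F t = s * a' s - τ * a' τ :=
  intervalIntegral.integral_eq_sub_of_hasDerivAt
    (fun t ht => ha' t (uIcc_subset_Ioi hτ hs ht))
    (intervalIntegrable_of_continuousOn_Ioi (continuousOn_id.mul hF) hτ hs)

/-- `log t · (t a') - a` is an antiderivative: the two occurrences of `a'` cancel. -/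
lemma integral_mul_log_mul_eq_of_hasDerivAt (ha : ∀ t, 0 < t → HasDerivAt a (a' t) t)
    (ha' : ∀ t, 0 < t → HasDerivAt (fun t => t * a' t) (t * F t) t)
    (hF : ContinuousOn F (Ioi 0)) (hτ : 0 < τ) (hs : 0 < s) :
    ∫ t in τ..s, t * Real.log t * F t
      = (Real.log s * (s * a' s) - a s) - (Real.log τ * (τ * a' τ) - a τ) := by
  refine intervalIntegral.integral_eq_sub_of_hasDerivAt
    (f := fun t => Real.log t * (t * a' t) - a t) (fun t ht => ?_)
    (intervalIntegrable_of_continuousOn_Ioi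
      ((continuousOn_id.mul continuousOn_log_Ioi).mul hF) hτ hs)
  have ht0 : 0 < t := uIcc_subset_Ioi hτ hs ht
  convert ((Real.hasDerivAt_log ht0.ne').fun_mul (ha' t ht0)).fun_sub (ha t ht0) using 1
  field_simp
  ring

lemma eq_add_integral_to_one (ha : ∀ t, 0 < t → HasDerivAt a (a' t) t)
    (ha' : ∀ t, 0 < t → HasDerivAt (fun t => t * a' t) (t * F t) t)
    (hF : ContinuousOn F (Ioi 0)) (hτ : 0 < τ) :
    a τ = a 1 + a' 1 * Real.log τ - Real.log τ * (∫ t in τ..1, t * F t)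
      + ∫ t in τ..1, t * Real.log t * F t := by
  rw [integral_mul_eq_of_hasDerivAt ha' hF hτ one_pos,
    integral_mul_log_mul_eq_of_hasDerivAt ha ha' hF hτ one_pos]
  simp
  ring

lemma eq_add_integral_from_zero (ha : ∀ t, 0 < t → HasDerivAt a (a' t) t)
    (ha' : ∀ t, 0 < t → HasDerivAt (fun t => t * a' t) (t * F t) t)
    (hF : ContinuousOn F (Ioi 0)) (hτ : 0 < τ)
    (hi : ∀ τ, 0 < τ → IntervalIntegrable (fun t => t * F t) volume 0 τ)
    (hi' : ∀ τ, 0 < τ → IntervalIntegrable (fun t => t * Real.log t * F t) volume 0 τ) :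
    a τ = (a' 1 - ∫ t in (0 : ℝ)..1, t * F t) * Real.log τ
      + (a 1 + ∫ t in (0 : ℝ)..1, t * Real.log t * F t)
      + Real.log τ * (∫ t in (0 : ℝ)..τ, t * F t) - ∫ t in (0 : ℝ)..τ, t * Real.log t * F t := by
  rw [eq_add_integral_to_one ha ha' hF hτ,
    ← intervalIntegral.integral_add_adjacent_intervals (hi τ hτ) ((hi τ hτ).symm.trans (hi 1 one_pos)),
    ← intervalIntegral.integral_add_adjacent_intervals (hi' τ hτ)
      ((hi' τ hτ).symm.trans (hi' 1 one_pos))]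
  ring

/-- Merging the two integrals produces a kernel that vanishes at `t = τ`; estimating them separately
would not use this cancellation. -/
lemma sub_eq_integral_log_sub_log (ha : ∀ t, 0 < t → HasDerivAt a (a' t) t)
    (ha' : ∀ t, 0 < t → HasDerivAt (fun t => t * a' t) (t * F t) t)
    (hF : ContinuousOn F (Ioi 0)) (hτ : 0 < τ)
    (hi : ∀ τ, 0 < τ → IntervalIntegrable (fun t => t * F t) volume 0 τ)
    (hi' : ∀ τ, 0 < τ → IntervalIntegrable (fun t => t * Real.log t * F t) volume 0 τ) :
    a τ - (a' 1 - ∫ t in (0 : ℝ)..1, t * F t) * Real.log τ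
      - (a 1 + ∫ t in (0 : ℝ)..1, t * Real.log t * F t)
      = ∫ t in (0 : ℝ)..τ, (Real.log τ - Real.log t) * t * F t := by
  have h : ∫ t in (0 : ℝ)..τ, (Real.log τ - Real.log t) * t * F t
      = Real.log τ * (∫ t in (0 : ℝ)..τ, t * F t) - ∫ t in (0 : ℝ)..τ, t * Real.log t * F t := by
    rw [← intervalIntegral.integral_const_mul,
      ← intervalIntegral.integral_sub ((hi τ hτ).const_mul _) (hi' τ hτ)]
    congr 1
    ext t
    ring
  rw [h]
  linarith [eq_add_integral_from_zero ha ha' hF hτ hi hi']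

lemma deriv_sub_eq_integral_div
    (ha' : ∀ t, 0 < t → HasDerivAt (fun t => t * a' t) (t * F t) t)
    (hF : ContinuousOn F (Ioi 0)) (hτ : 0 < τ)
    (hi : ∀ τ, 0 < τ → IntervalIntegrable (fun t => t * F t) volume 0 τ) :
    a' τ - (a' 1 - ∫ t in (0 : ℝ)..1, t * F t) / τ = ∫ t in (0 : ℝ)..τ, t / τ * F t := by
  have h : ∫ t in (0 : ℝ)..τ, t / τ * F t = τ⁻¹ * ∫ t in (0 : ℝ)..τ, t * F t := by
    rw [← intervalIntegral.integral_const_mul]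
    congr 1
    ext t
    ring
  have h1 := integral_mul_eq_of_hasDerivAt ha' hF hτ one_pos
  rw [h, ← intervalIntegral.integral_add_adjacent_intervals (hi τ hτ)
    ((hi τ hτ).symm.trans (hi 1 one_pos)), h1]
  field_simp
  ring

end Representation

/-! ### Elementary bounds on the kernels. -/

section Weights

variable {t τ : ℝ}

/-- From `log x ≤ x` with `x = τ/t`. -/
lemma abs_log_sub_log_mul_le (ht : t ∈ Ioc 0 τ) : |(Real.log τ - Real.log t) * t| ≤ τ := by
  have hτ : 0 < τ := ht.1.trans_le ht.2
  rw [← Real.log_div hτ.ne' ht.1.ne', abs_of_nonneg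
    (mul_nonneg (Real.log_nonneg ((one_le_div ht.1).2 ht.2)) ht.1.le)]
  calc Real.log (τ / t) * t ≤ τ / t * t :=
        mul_le_mul_of_nonneg_right (Real.log_le_self (by have := ht.1; positivity)) ht.1.le
    _ = τ := div_mul_cancel₀ _ ht.1.ne'

/-- With `L = -log τ > 1` one has `2 + L ≤ 3L²`; this is where the exponent 2 of the logarithm in
the stated rates enters. -/
lemma two_sub_log_le (hτ : τ ∈ Ioo 0 (Real.exp (-1))) :
    2 - Real.log τ ≤ 3 * |Real.log τ| ^ 2 := by
  have h : Real.log τ < -1 := by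
    rw [← Real.log_exp (-1)]
    exact Real.log_lt_log hτ.1 hτ.2
  rw [sq_abs]
  nlinarith

lemma eventually_mem_Ioo_exp : ∀ᶠ τ in 𝓝[>] (0 : ℝ), τ ∈ Ioo 0 (Real.exp (-1)) :=
  Ioo_mem_nhdsGT (Real.exp_pos _)

end Weights

/-! ### Time integrals as functions on the sphere. -/

section Sphere

variable {n : ℕ} {F : ℝ → EuclideanSpace ℝ (Fin (n + 1)) → ℝ}

lemma radialExt_integral_eventuallyEq (hF : HomFamily F) {w : ℝ → ℝ} {τ : ℝ} (hτ : 0 < τ)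
    {f : Sph n → ℝ} (hf : ∀ x : Sph n, f x = ∫ t in (0 : ℝ)..τ, w t * F t x) (x : Sph n) :
    radialExt f =ᶠ[𝓝 (x : EuclideanSpace ℝ (Fin (n + 1)))]
      fun y => ∫ t in (0 : ℝ)..τ, w t * F t y := by
  filter_upwards [isOpen_compl_singleton.mem_nhds (coe_sph_ne_zero x)] with y hy
  refine radialExt_eq_of_hom (u := fun y => ∫ t in (0 : ℝ)..τ, w t * F t y) (fun c hc y => ?_) hf hy
  refine intervalIntegral.integral_congr_ae (ae_of_all _ fun t ht => ?_)
  rw [uIoc_of_le hτ.le] at ht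
  rw [hF.hom t ht.1 c hc y]

lemma LogBounded.exists_norm_iteratedFDeriv_radialExt_le (hF : HomFamily F) (hl : LogBounded F)
    (k : ℕ) : ∃ C, 0 ≤ C ∧ ∀ τ ∈ Ioc (0 : ℝ) 1, ∀ (B : ℝ) (w : ℝ → ℝ), ContinuousOn w (Ioi 0) →
      (∀ t ∈ Ioc 0 τ, |w t| ≤ B) → ∀ f : Sph n → ℝ,
      (∀ x : Sph n, f x = ∫ t in (0 : ℝ)..τ, w t * F t x) → ∀ x : Sph n,
      ‖iteratedFDeriv ℝ k (radialExt f) (x : EuclideanSpace ℝ (Fin (n + 1)))‖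
        ≤ C * B * (τ * (2 - Real.log τ)) := by
  obtain ⟨C, hC, h⟩ := hl.exists_norm_iteratedFDeriv_integral_le hF.smooth k
  refine ⟨C, hC, fun τ hτ B w hw hB f hf x => ?_⟩
  rw [((radialExt_integral_eventuallyEq hF hτ.1 hf x).iteratedFDeriv (𝕜 := ℝ) k).eq_of_nhds]
  exact h τ hτ B w hw hB x (coe_mem_shell x)

lemma LogBounded.smooth_integral (hF : HomFamily F) (hl : LogBounded F) {w : ℝ → ℝ} {B : ℝ}
    (hw : ContinuousOn w (Ioi 0)) (hB : ∀ t ∈ Ioc (0 : ℝ) 1, |w t| ≤ B) :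
    Smooth fun x : Sph n => ∫ t in (0 : ℝ)..1, w t * F t x :=
  smooth_of_contDiffOn_shell (hl.contDiffOn_integral hF.smooth hw ⟨one_pos, le_rfl⟩ hB)
    fun _ => rfl

end Sphere

/-! ### Asymptotic data of a solution. -/

section Asymptotics

variable {n : ℕ} {q B : ℝ} {f₁ f₂ f₃ : ℝ → ℝ} {α χ : ℝ → Sph n → ℝ} {t τ : ℝ}

/-- `∂²α + τ⁻¹ ∂α`, extended to be constant along rays. -/
noncomputable def sourceExt (α : ℝ → Sph n → ℝ) : ℝ → EuclideanSpace ℝ (Fin (n + 1)) → ℝ :=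
  sourceFamily fun t => radialExt (α t)

lemma SmoothOnPos.homFamily_sourceExt (hα : SmoothOnPos α) : HomFamily (sourceExt α) :=
  hα.homFamily.sourceFamily

lemma SmoothOnPos.hasDerivAt (hα : SmoothOnPos α) (ht : 0 < t) (x : Sph n) :
    HasDerivAt (fun s => α s x) (dtau α t x) t := by
  have := hα.homFamily.smooth.hasDerivAt ht (coe_sph_ne_zero x)
  rwa [tderiv_radialExt _ _ (coe_sph_ne_zero x), radialExt_coe,
    show (fun s => radialExt (α s) (x : EuclideanSpace ℝ (Fin (n + 1)))) = fun s => α s x from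
      funext fun s => radialExt_coe _ _] at this

lemma SmoothOnPos.hasDerivAt_mul_dtau (hα : SmoothOnPos α) (ht : 0 < t) (x : Sph n) :
    HasDerivAt (fun s => s * dtau α s x) (t * sourceExt α t x) t := by
  have e : (fun s => tderiv (fun t => radialExt (α t)) s (x : EuclideanSpace ℝ (Fin (n + 1))))
      = fun s => dtau α s x :=
    funext fun s => by rw [tderiv_radialExt _ _ (coe_sph_ne_zero x), radialExt_coe]
  have h : HasDerivAt (fun s => dtau α s x)
      (tderiv (tderiv fun t => radialExt (α t)) t (x : EuclideanSpace ℝ (Fin (n + 1)))) t := by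
    rw [← e]
    exact hα.homFamily.tderiv.smooth.hasDerivAt ht (coe_sph_ne_zero x)
  have e2 : t * sourceExt α t x = 1 * dtau α t x
      + t * tderiv (tderiv fun t => radialExt (α t)) t (x : EuclideanSpace ℝ (Fin (n + 1))) := by
    rw [← congrFun e t, sourceExt, sourceFamily]
    field_simp
    ring
  rw [e2]
  exact (hasDerivAt_id' t).fun_mul h

lemma SmoothOnPos.continuousOn_sourceExt (hα : SmoothOnPos α) (x : Sph n) :
    ContinuousOn (fun t => sourceExt α t x) (Ioi 0) := fun _ ht =>
  (hα.homFamily_sourceExt.smooth.contDiffAt_time ht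
    (coe_sph_ne_zero x)).continuousAt.continuousWithinAt

lemma SmoothOnPos.continuousOn_time (hα : SmoothOnPos α) (x : Sph n) :
    ContinuousOn (fun t => α t x) (Ioi 0) := fun _ ht =>
  (hα.hasDerivAt ht x).continuousAt.continuousWithinAt

lemma IsSmoothSolution.integral_alpha (h : IsSmoothSolution q f₁ f₂ f₃ α χ) (hτ : 0 < τ)
    (x : Sph n) : ∫ s in τ..1, 2 * s * α s x = χ 1 x - χ τ x := by
  refine intervalIntegral.integral_eq_sub_of_hasDerivAt (f := fun t => χ t x) (fun t ht => ?_)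
    (intervalIntegrable_of_continuousOn_Ioi
      ((continuousOn_const.mul continuousOn_id).mul (h.smooth_alpha.continuousOn_time x))
      hτ one_pos)
  have ht0 : 0 < t := uIcc_subset_Ioi hτ one_pos ht
  rw [← h.chi_eq t ht0 x]
  exact h.smooth_chi.hasDerivAt ht0 x

/-- The bracket multiplying `f₃` in `source` is `χ(t)`, by integrating `∂χ = 2tα`. The equation then
identifies `source` with a smooth expression in `α`, for positive times. -/
lemma IsSmoothSolution.source_eq (h : IsSmoothSolution q f₁ f₂ f₃ α χ) (ht : 0 < t) (x : Sph n) :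
    source q f₁ f₂ f₃ α (χ 1) t x = sourceExt α t x := by
  have hx := coe_sph_ne_zero x
  have hA := h.isHomSolution
  rw [sourceExt, sourceFamily, hA.main_eq t ht x hx,
    scaledLaplacian_radialExt (hA.hom_alpha.homSmooth ht) hx, tderiv_radialExt _ _ hx]
  simp only [radialExt_coe, source]
  rw [h.integral_alpha ht]
  ring

lemma IsSmoothSolution.eqOn_source (h : IsSmoothSolution q f₁ f₂ f₃ α χ) (w : ℝ → ℝ) (x : Sph n) :
    EqOn (fun t => w t * source q f₁ f₂ f₃ α (χ 1) t x) (fun t => w t * sourceExt α t x)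
      (Ioi 0) := fun t ht => by
  simp only [h.source_eq ht]

lemma IsSmoothSolution.integral_source (h : IsSmoothSolution q f₁ f₂ f₃ α χ) (w : ℝ → ℝ)
    (x : Sph n) {a b : ℝ} (ha : 0 ≤ a) (hb : 0 ≤ b) :
    ∫ t in a..b, w t * source q f₁ f₂ f₃ α (χ 1) t x = ∫ t in a..b, w t * sourceExt α t x :=
  intervalIntegral.integral_congr_ae (ae_of_all _ fun _ ht =>
    h.eqOn_source w x ((le_min ha hb).trans_lt ht.1))

lemma IsSmoothSolution.intervalIntegrable_source (h : IsSmoothSolution q f₁ f₂ f₃ α χ)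
    {w : ℝ → ℝ} {x : Sph n} (hτ : 0 < τ)
    (hi : IntervalIntegrable (fun t => w t * sourceExt α t x) volume 0 τ) :
    IntervalIntegrable (fun t => w t * source q f₁ f₂ f₃ α (χ 1) t x) volume 0 τ :=
  hi.congr fun _ ht => (h.eqOn_source w x ((le_min le_rfl hτ.le).trans_lt ht.1)).symm

lemma abs_mul_log_le_one (ht : t ∈ Ioc (0 : ℝ) 1) : |t * Real.log t| ≤ 1 := by
  rw [mul_comm]
  exact (Real.abs_log_mul_self_lt t ht.1 ht.2).le

lemma abs_le_one_of_mem_Ioc (ht : t ∈ Ioc (0 : ℝ) 1) : |t| ≤ 1 := by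
  rw [abs_of_pos ht.1]; exact ht.2

lemma abs_two_mul_le (ht : t ∈ Ioc 0 τ) : |2 * t| ≤ 2 * τ := by
  rw [abs_of_pos (mul_pos two_pos ht.1)]; linarith [ht.2]

lemma continuousOn_mul_log_Ioi : ContinuousOn (fun t : ℝ => t * Real.log t) (Ioi 0) :=
  Real.continuous_mul_log.continuousOn

/-- The coefficient of `log τ` in the expansion of `α`. -/
noncomputable def logCoeff (α : ℝ → Sph n → ℝ) (x : Sph n) : ℝ :=
  dtau α 1 x - ∫ t in (0 : ℝ)..1, t * sourceExt α t x

/-- The constant coefficient in the expansion of `α`. -/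
noncomputable def constCoeff (α : ℝ → Sph n → ℝ) (x : Sph n) : ℝ :=
  α 1 x + ∫ t in (0 : ℝ)..1, t * Real.log t * sourceExt α t x

/-- The limit of `χ` at `τ = 0`. -/
noncomputable def chiLimit (α χ : ℝ → Sph n → ℝ) (x : Sph n) : ℝ :=
  χ 1 x - ∫ t in (0 : ℝ)..1, 2 * t * α t x

namespace IsSmoothSolution

lemma logBounded_sourceExt (h : IsSmoothSolution q f₁ f₂ f₃ α χ) (hq : 0 ≤ q)
    (hB : CoeffBound B f₁ f₂ f₃) : LogBounded (sourceExt α) :=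
  h.isHomSolution.logBounded_source hq hB

lemma intervalIntegrable_mul (h : IsSmoothSolution q f₁ f₂ f₃ α χ) (hq : 0 ≤ q)
    (hB : CoeffBound B f₁ f₂ f₃) (hτ : 0 < τ) (x : Sph n) :
    IntervalIntegrable (fun t => t * sourceExt α t x) volume 0 τ :=
  (h.logBounded_sourceExt hq hB).intervalIntegrable h.smooth_alpha.homFamily_sourceExt.smooth
    continuousOn_id (fun _ => abs_le_one_of_mem_Ioc) (coe_mem_shell x) hτ

lemma intervalIntegrable_mul_log_mul (h : IsSmoothSolution q f₁ f₂ f₃ α χ) (hq : 0 ≤ q)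
    (hB : CoeffBound B f₁ f₂ f₃) (hτ : 0 < τ) (x : Sph n) :
    IntervalIntegrable (fun t => t * Real.log t * sourceExt α t x) volume 0 τ :=
  (h.logBounded_sourceExt hq hB).intervalIntegrable h.smooth_alpha.homFamily_sourceExt.smooth
    continuousOn_mul_log_Ioi (fun _ => abs_mul_log_le_one) (coe_mem_shell x) hτ

lemma intervalIntegrable_alpha (h : IsSmoothSolution q f₁ f₂ f₃ α χ) (hq : 0 ≤ q)
    (hB : CoeffBound B f₁ f₂ f₃) (hτ : 0 < τ) (x : Sph n) :
    IntervalIntegrable (fun t => 2 * t * α t x) volume 0 τ := by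
  simpa only [radialExt_coe] using (h.isHomSolution.logBounded_alpha hq hB).intervalIntegrable
    h.isHomSolution.hom_alpha.smooth (w := fun t => 2 * t)
    (continuousOn_const.mul continuousOn_id) (fun _ => abs_two_mul_le) (coe_mem_shell x) hτ

lemma smooth_logCoeff (h : IsSmoothSolution q f₁ f₂ f₃ α χ) (hq : 0 ≤ q)
    (hB : CoeffBound B f₁ f₂ f₃) : Smooth (logCoeff α) :=
  (h.isHomSolution.hom_alpha.dtau.homSmooth one_pos).smooth_sph.sub
    ((h.logBounded_sourceExt hq hB).smooth_integral h.smooth_alpha.homFamily_sourceExt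
      continuousOn_id fun _ => abs_le_one_of_mem_Ioc)

lemma smooth_constCoeff (h : IsSmoothSolution q f₁ f₂ f₃ α χ) (hq : 0 ≤ q)
    (hB : CoeffBound B f₁ f₂ f₃) : Smooth (constCoeff α) :=
  (h.isHomSolution.hom_alpha.homSmooth one_pos).smooth_sph.add
    ((h.logBounded_sourceExt hq hB).smooth_integral h.smooth_alpha.homFamily_sourceExt
      continuousOn_mul_log_Ioi fun _ => abs_mul_log_le_one)

lemma smooth_chiLimit (h : IsSmoothSolution q f₁ f₂ f₃ α χ) (hq : 0 ≤ q)
    (hB : CoeffBound B f₁ f₂ f₃) : Smooth (chiLimit α χ) := by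
  have := (h.isHomSolution.logBounded_alpha hq hB).smooth_integral h.isHomSolution.hom_alpha
      (continuousOn_const.mul continuousOn_id) fun _ => abs_two_mul_le
  simp only [radialExt_coe] at this
  exact (h.isHomSolution.hom_chi.homSmooth one_pos).smooth_sph.sub this

lemma alpha_sub_eq (h : IsSmoothSolution q f₁ f₂ f₃ α χ) (hq : 0 ≤ q)
    (hB : CoeffBound B f₁ f₂ f₃) (hτ : 0 < τ) (x : Sph n) :
    α τ x - logCoeff α x * Real.log τ - constCoeff α x
      = ∫ t in (0 : ℝ)..τ, (Real.log τ - Real.log t) * t * sourceExt α t x :=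
  sub_eq_integral_log_sub_log (a := fun t => α t x) (fun _ ht => h.smooth_alpha.hasDerivAt ht x)
    (fun _ ht => h.smooth_alpha.hasDerivAt_mul_dtau ht x) (h.smooth_alpha.continuousOn_sourceExt x)
    hτ (fun _ hτ => h.intervalIntegrable_mul hq hB hτ x)
    (fun _ hτ => h.intervalIntegrable_mul_log_mul hq hB hτ x)

lemma dtau_alpha_sub_eq (h : IsSmoothSolution q f₁ f₂ f₃ α χ) (hq : 0 ≤ q)
    (hB : CoeffBound B f₁ f₂ f₃) (hτ : 0 < τ) (x : Sph n) :
    dtau α τ x - logCoeff α x / τ = ∫ t in (0 : ℝ)..τ, t / τ * sourceExt α t x :=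
  deriv_sub_eq_integral_div (a' := fun t => dtau α t x)
    (fun _ ht => h.smooth_alpha.hasDerivAt_mul_dtau ht x) (h.smooth_alpha.continuousOn_sourceExt x)
    hτ (fun _ hτ => h.intervalIntegrable_mul hq hB hτ x)

lemma chi_sub_eq (h : IsSmoothSolution q f₁ f₂ f₃ α χ) (hq : 0 ≤ q)
    (hB : CoeffBound B f₁ f₂ f₃) (hτ : 0 < τ) (x : Sph n) :
    χ τ x - chiLimit α χ x = ∫ t in (0 : ℝ)..τ, 2 * t * α t x := by
  have hi := fun {τ : ℝ} (hτ : 0 < τ) => h.intervalIntegrable_alpha hq hB hτ x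
  rw [chiLimit, ← intervalIntegral.integral_add_adjacent_intervals (hi hτ)
    ((hi hτ).symm.trans (hi one_pos)), h.integral_alpha hτ]
  ring

lemma exists_norm_alpha_sub_le (h : IsSmoothSolution q f₁ f₂ f₃ α χ) (hq : 0 ≤ q)
    (hB : CoeffBound B f₁ f₂ f₃) (k : ℕ) : ∃ C, 0 ≤ C ∧ ∀ τ ∈ Ioc (0 : ℝ) 1, ∀ x : Sph n,
      ‖iteratedFDeriv ℝ k (radialExt fun x => α τ x - logCoeff α x * Real.log τ - constCoeff α x)
        (x : EuclideanSpace ℝ (Fin (n + 1)))‖ ≤ C * τ * (τ * (2 - Real.log τ)) := by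
  obtain ⟨C, hC, hb⟩ := (h.logBounded_sourceExt hq hB).exists_norm_iteratedFDeriv_radialExt_le
    h.smooth_alpha.homFamily_sourceExt k
  exact ⟨C, hC, fun τ hτ => hb τ hτ τ _
    ((continuousOn_const.sub continuousOn_log_Ioi).mul continuousOn_id)
    (fun _ => abs_log_sub_log_mul_le) _ fun x => h.alpha_sub_eq hq hB hτ.1 x⟩

lemma exists_norm_alpha_sub_div_le (h : IsSmoothSolution q f₁ f₂ f₃ α χ) (hq : 0 ≤ q)
    (hB : CoeffBound B f₁ f₂ f₃) (k : ℕ) : ∃ C, ∀ τ ∈ Ioc (0 : ℝ) 1, ∀ x : Sph n,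
      ‖iteratedFDeriv ℝ k
        (radialExt fun x => (α τ x - logCoeff α x * Real.log τ - constCoeff α x) / τ)
        (x : EuclideanSpace ℝ (Fin (n + 1)))‖ ≤ C * (τ * (2 - Real.log τ)) := by
  obtain ⟨C, hC, hb⟩ := (h.logBounded_sourceExt hq hB).exists_norm_iteratedFDeriv_radialExt_le
    h.smooth_alpha.homFamily_sourceExt k
  -- The division by `τ` is absorbed into the kernel, which is then bounded by 1.
  refine ⟨C * 1, fun τ hτ => hb τ hτ 1 (fun t => (Real.log τ - Real.log t) * t / τ)
    (((continuousOn_const.sub continuousOn_log_Ioi).mul continuousOn_id).div_const τ)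
    (fun t ht => ?_) _ fun x => ?_⟩
  · rw [abs_div, abs_of_pos hτ.1, div_le_one hτ.1]
    exact abs_log_sub_log_mul_le ht
  · rw [h.alpha_sub_eq hq hB hτ.1 x, ← intervalIntegral.integral_div]
    congr 1
    ext t
    ring

lemma exists_norm_dtau_alpha_sub_le (h : IsSmoothSolution q f₁ f₂ f₃ α χ) (hq : 0 ≤ q)
    (hB : CoeffBound B f₁ f₂ f₃) (k : ℕ) : ∃ C, 0 ≤ C ∧ ∀ τ ∈ Ioc (0 : ℝ) 1, ∀ x : Sph n,
      ‖iteratedFDeriv ℝ k (radialExt fun x => dtau α τ x - logCoeff α x / τ)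
        (x : EuclideanSpace ℝ (Fin (n + 1)))‖ ≤ C * (τ * (2 - Real.log τ)) := by
  obtain ⟨C, hC, hb⟩ := (h.logBounded_sourceExt hq hB).exists_norm_iteratedFDeriv_radialExt_le
    h.smooth_alpha.homFamily_sourceExt k
  refine ⟨C * 1, by linarith, fun τ hτ => hb τ hτ 1 (fun t => t / τ)
    (continuousOn_id.div_const τ) (fun t ht => ?_) _ fun x => h.dtau_alpha_sub_eq hq hB hτ.1 x⟩
  rw [abs_div, abs_of_pos hτ.1, abs_of_pos ht.1, div_le_one hτ.1]
  exact ht.2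

lemma exists_norm_chi_sub_div_le (h : IsSmoothSolution q f₁ f₂ f₃ α χ) (hq : 0 ≤ q)
    (hB : CoeffBound B f₁ f₂ f₃) (k : ℕ) : ∃ C, ∀ τ ∈ Ioc (0 : ℝ) 1, ∀ x : Sph n,
      ‖iteratedFDeriv ℝ k (radialExt fun x => (χ τ x - chiLimit α χ x) / τ)
        (x : EuclideanSpace ℝ (Fin (n + 1)))‖ ≤ C * (τ * (2 - Real.log τ)) := by
  obtain ⟨C, hC, hb⟩ := (h.isHomSolution.logBounded_alpha hq
    hB).exists_norm_iteratedFDeriv_radialExt_le h.isHomSolution.hom_alpha k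
  refine ⟨C * 2, fun τ hτ => hb τ hτ 2 (fun t => 2 * t / τ)
    ((continuousOn_const.mul continuousOn_id).div_const τ) (fun t ht => ?_) _ fun x => ?_⟩
  · rw [abs_div, abs_of_pos hτ.1, div_le_iff₀ hτ.1]
    exact abs_two_mul_le ht
  · rw [h.chi_sub_eq hq hB hτ.1 x, ← intervalIntegral.integral_div]
    simp only [radialExt_coe]
    congr 1
    ext t
    ring

lemma exists_norm_dtau_chi_le (h : IsSmoothSolution q f₁ f₂ f₃ α χ) (hq : 0 ≤ q)
    (hB : CoeffBound B f₁ f₂ f₃) (k : ℕ) : ∃ C, ∀ τ ∈ Ioc (0 : ℝ) 1, ∀ x : Sph n,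
      ‖iteratedFDeriv ℝ k (radialExt (dtau χ τ)) (x : EuclideanSpace ℝ (Fin (n + 1)))‖
        ≤ C * (τ * (2 - Real.log τ)) := by
  obtain ⟨C, hC, hb⟩ := h.isHomSolution.logBounded_alpha hq hB k
  refine ⟨2 * C, fun τ hτ x => ?_⟩
  have e : radialExt (dtau χ τ) = (2 * τ) • radialExt (α τ) := by
    ext y
    rcases eq_or_ne y 0 with rfl | hy
    · simp [radialExt_zero]
    · simp [radialExt_apply _ hy, h.chi_eq τ hτ.1]
  have hc := ((h.isHomSolution.hom_alpha.homSmooth hτ.1).contDiffAt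
    (coe_sph_ne_zero x)).of_le (m := k) (by exact_mod_cast le_top)
  rw [e, iteratedFDeriv_const_smul_apply hc, norm_smul, Real.norm_of_nonneg (by linarith [hτ.1])]
  have h1 := hb τ hτ x (coe_mem_shell x)
  calc 2 * τ * _ ≤ 2 * τ * (C * (1 - Real.log τ)) :=
        mul_le_mul_of_nonneg_left h1 (by linarith [hτ.1])
    _ ≤ 2 * τ * (C * (2 - Real.log τ)) := by
        have := hτ.1
        gcongr
        norm_num
    _ = 2 * C * (τ * (2 - Real.log τ)) := by ring

open Classical in
lemma isC1Curve_chi (h : IsSmoothSolution q f₁ f₂ f₃ α χ) (hq : 0 ≤ q)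
    (hB : CoeffBound B f₁ f₂ f₃) :
    IsC1Curve fun τ => if 0 < τ then χ τ else chiLimit α χ :=
  h.isHomSolution.hom_chi.isC1Curve (h.smooth_chiLimit hq hB)
    (h.exists_norm_chi_sub_div_le hq hB) (h.exists_norm_dtau_chi_le hq hB)

open Classical in
lemma isC1Curve_alpha_sub (h : IsSmoothSolution q f₁ f₂ f₃ α χ) (hq : 0 ≤ q)
    (hB : CoeffBound B f₁ f₂ f₃) :
    IsC1Curve fun τ => if 0 < τ then
      (fun x => α τ x - logCoeff α x * Real.log τ - constCoeff α x) else fun _ => 0 := by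
  have hlog : ContDiffOn ℝ ∞ (fun t : ℝ => -Real.log t) (Ioi 0) :=
    (Real.contDiffOn_log.mono fun _ h => ne_of_gt h).neg
  have hA := (h.isHomSolution.hom_alpha.add
    ((h.smooth_logCoeff hq hB).homSmooth.homFamily.mul hlog)).add
    ((h.smooth_constCoeff hq hB).homSmooth.homFamily.mul (contDiffOn_const (c := (-1 : ℝ))))
  have e : (fun τ => radialExt fun x => α τ x - logCoeff α x * Real.log τ - constCoeff α x)
      = fun τ y => radialExt (α τ) y + -Real.log τ * radialExt (logCoeff α) y
        + -1 * radialExt (constCoeff α) y := by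
    ext τ y
    rcases eq_or_ne y 0 with rfl | hy
    · simp [radialExt_zero]
    · simp only [radialExt_apply _ hy]
      ring
  rw [← e] at hA
  -- The remainder extends by the value 0 at `τ = 0`, so its difference quotient there is the
  -- remainder divided by `τ`.
  refine hA.isC1Curve contMDiff_const (fun k => ?_) fun k => ?_
  · simpa only [sub_zero] using h.exists_norm_alpha_sub_div_le hq hB k
  · obtain ⟨C, -, hC⟩ := h.exists_norm_dtau_alpha_sub_le hq hB k
    refine ⟨C, fun τ hτ => ?_⟩
    have e : dtau (fun τ x => α τ x - logCoeff α x * Real.log τ - constCoeff α x) τ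
        = fun x => dtau α τ x - logCoeff α x / τ := by
      ext x
      have := ((h.smooth_alpha.hasDerivAt hτ.1 x).fun_sub
        ((Real.hasDerivAt_log hτ.1.ne').const_mul (logCoeff α x))).sub_const (constCoeff α x)
      exact this.deriv
    rw [e]
    exact hC τ hτ

lemma hasAsymptoticData (h : IsSmoothSolution q f₁ f₂ f₃ α χ) (hq : 0 ≤ q)
    (hB : CoeffBound B f₁ f₂ f₃) :
    HasAsymptoticData α χ (chiLimit α χ) (logCoeff α) (constCoeff α) where
  smooth_chi₀ := h.smooth_chiLimit hq hB
  smooth_O := h.smooth_logCoeff hq hB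
  smooth_h := h.smooth_constCoeff hq hB
  alpha_C1 := ⟨_, fun τ hτ x => by rw [if_pos hτ], h.isC1Curve_alpha_sub hq hB⟩
  chi_C1 := ⟨_, fun τ hτ => if_pos hτ, if_neg (lt_irrefl _), h.isC1Curve_chi hq hB⟩
  alpha_expansion k := by
    obtain ⟨C, hC0, hC⟩ := h.exists_norm_alpha_sub_le hq hB k
    refine ⟨3 * C, eventually_mem_Ioo_exp.mono fun τ hτ x => ?_⟩
    have h1 : τ ≤ 1 := hτ.2.le.trans (Real.exp_le_one_iff.2 (by norm_num))
    refine (hC τ ⟨hτ.1, h1⟩ x).trans ?_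
    have h2 := mul_le_mul_of_nonneg_left (two_sub_log_le hτ) (mul_nonneg hC0 (sq_nonneg τ))
    linarith
  dtau_alpha_expansion k := by
    obtain ⟨C, hC0, hC⟩ := h.exists_norm_dtau_alpha_sub_le hq hB k
    refine ⟨3 * C, eventually_mem_Ioo_exp.mono fun τ hτ x => ?_⟩
    have h1 : τ ≤ 1 := hτ.2.le.trans (Real.exp_le_one_iff.2 (by norm_num))
    refine (hC τ ⟨hτ.1, h1⟩ x).trans ?_
    have h2 := mul_le_mul_of_nonneg_left (two_sub_log_le hτ) (mul_nonneg hC0 hτ.1.le)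
    linarith

end IsSmoothSolution

end Asymptotics

end ModelSystem

theorem mainTheorem7 (n : ℕ) (hn : 4 ≤ n) (hn_even : Even n)
    (q : ℝ) (hq : 1 ≤ q) (f₁ f₂ f₃ : ℝ → ℝ)
    (hf : ∃ B : ℝ, ∀ τ ∈ Ioc (0 : ℝ) 1, |f₁ τ| + |f₂ τ| + |f₃ τ| ≤ B)
    (χ₁ a₁ b₁ : ModelSystem.Sph n → ℝ)
    (hχ₁ : ModelSystem.Smooth χ₁) (ha₁ : ModelSystem.Smooth a₁) (hb₁ : ModelSystem.Smooth b₁)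
    (α χ : ℝ → ModelSystem.Sph n → ℝ)
    (hsol : ModelSystem.IsSmoothSolution q f₁ f₂ f₃ α χ)
    (hdata : ModelSystem.HasInitialData α χ χ₁ a₁ b₁) :
    ∃ χ₀ 𝒪 h : ModelSystem.Sph n → ℝ,
      ModelSystem.HasAsymptoticData α χ χ₀ 𝒪 h ∧
      ∀ x : ModelSystem.Sph n,
        (∀ τ : ℝ, 0 < τ →
          IntervalIntegrable (fun t => 2 * t * α t x) volume 0 τ ∧
          IntervalIntegrable
            (fun t => t * ModelSystem.source q f₁ f₂ f₃ α χ₁ t x) volume 0 τ ∧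
          IntervalIntegrable
            (fun t => t * Real.log t * ModelSystem.source q f₁ f₂ f₃ α χ₁ t x) volume 0 τ) ∧
        χ₀ x = χ₁ x - ∫ t in (0 : ℝ)..1, 2 * t * α t x ∧
        𝒪 x = b₁ x - ∫ t in (0 : ℝ)..1, t * ModelSystem.source q f₁ f₂ f₃ α χ₁ t x ∧
        h x = a₁ x
          + ∫ t in (0 : ℝ)..1, t * Real.log t * ModelSystem.source q f₁ f₂ f₃ α χ₁ t x ∧
        (∀ τ : ℝ, 0 < τ →
          α τ x = a₁ x + b₁ x * Real.log τ
            - Real.log τ * (∫ t in τ..1, t * ModelSystem.source q f₁ f₂ f₃ α χ₁ t x)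
            + ∫ t in τ..1, t * Real.log t * ModelSystem.source q f₁ f₂ f₃ α χ₁ t x) ∧
        (∀ τ : ℝ, 0 < τ →
          α τ x = 𝒪 x * Real.log τ + h x
            + Real.log τ * (∫ t in (0 : ℝ)..τ, t * ModelSystem.source q f₁ f₂ f₃ α χ₁ t x)
            - ∫ t in (0 : ℝ)..τ, t * Real.log t * ModelSystem.source q f₁ f₂ f₃ α χ₁ t x) := by
  obtain ⟨B, hB⟩ := hf
  have hq0 : 0 ≤ q := zero_le_one.trans hq
  have hB' : ModelSystem.CoeffBound B f₁ f₂ f₃ := fun t ht => by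
    have := hB t ht
    have := abs_nonneg (f₁ t)
    have := abs_nonneg (f₂ t)
    have := abs_nonneg (f₃ t)
    exact ⟨by linarith, by linarith, by linarith⟩
  obtain ⟨rfl, rfl, rfl⟩ := hdata
  refine ⟨_, _, _, hsol.hasAsymptoticData hq0 hB', fun x => ?_⟩
  have hi := fun τ (hτ : 0 < τ) => hsol.intervalIntegrable_mul hq0 hB' hτ x
  have hi' := fun τ (hτ : 0 < τ) => hsol.intervalIntegrable_mul_log_mul hq0 hB' hτ x
  have ha := fun t (ht : 0 < t) => hsol.smooth_alpha.hasDerivAt ht x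
  have ha' := fun t (ht : 0 < t) => hsol.smooth_alpha.hasDerivAt_mul_dtau ht x
  have hF := hsol.smooth_alpha.continuousOn_sourceExt x
  have e := fun {a b : ℝ} (ha : 0 ≤ a) (hb : 0 ≤ b) => hsol.integral_source (fun t => t) x ha hb
  have e' := fun {a b : ℝ} (ha : 0 ≤ a) (hb : 0 ≤ b) =>
    hsol.integral_source (fun t => t * Real.log t) x ha hb
  refine ⟨fun τ hτ => ⟨hsol.intervalIntegrable_alpha hq0 hB' hτ x,
    hsol.intervalIntegrable_source hτ (hi τ hτ), hsol.intervalIntegrable_source hτ (hi' τ hτ)⟩,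
    rfl, ?_, ?_, fun τ hτ => ?_, fun τ hτ => ?_⟩
  -- `source` and `sourceExt` are known to agree for `t > 0` only, hence the nonnegative endpoints;
  -- the left end 0 is not in the half-open interval of integration.
  · rw [e le_rfl zero_le_one]; rfl
  · rw [e' le_rfl zero_le_one]; rfl
  · rw [e hτ.le zero_le_one, e' hτ.le zero_le_one]
    exact ModelSystem.eq_add_integral_to_one ha ha' hF hτ
  · rw [e le_rfl hτ.le, e' le_rfl hτ.le]
    exact ModelSystem.eq_add_integral_from_zero ha ha' hF hτ hi hi'
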